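/- **Setting.** $G=(V,E)$ is a finite undirected graph with nonnegative edge weights $w(u,v)=w(v,u)$ (self-loops allowed) and no isolated vertex. $\pi$ is the probability measure on $V$ proportional to the weighted degree $\deg(v)=\sum_u w(v,u)$; a random edge is an ordered pair $(u,v)$ drawn with probability proportional to $w(u,v)$. $L=\mathrm{Id}-A$ is the normalized Laplacian, where $A(u,v)=w(u,v)/\deg(u)$ is the transition matrix of the random walk, and $\Pi_\lambda$ is the projection of $\mathbb R^V$ onto the span of the right eigenvectors of $L$ with eigenvalue $\le\lambda$, along the span of those with eigenvalue $>\lambda$. For $0<\lambda<2$, $C>0$ and an integer $D\ge2$, $G$ is *$(\lambda,C,D)$-certifiably 2-to-4 hypercontractive* if, in the indeterminates $(f(v))_{v\in V}$, the polynomial $$C\Big(\sum_v\pi(v)f(v)^2\Big)^2-\sum_v\pi(v)\big((\Pi_\lambda f)(v)\big)^4$$ is a sum of squares of degree at most $D$. An *affine Unique Games instance* $I$ on $G$ over a finite abelian group $\Sigma$ gives each edge a constraint $x_u-x_v=a_{u,v}$, i.e. $x_v=\pi_{u,v}(x_u)$ with $\pi_{u,v}(x)=x-a_{u,v}$ (the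 same constraint when the edge is read in the other direction). The value $\mathrm{val}_I(x)$ of $x\in\Sigma^V$ is the probability that a random edge is satisfied. In variables $X_{u,a}$ ($u\in V$, $a\in\Sigma$), let $\mathrm{val}_I(X)=\mathbb E_{(u,v)\sim E}\sum_aX_{u,a}X_{v,\pi_{u,v}(a)}$, and let $\mathcal A_I$ be the axioms $X_{u,a}^2=X_{u,a}$, $X_{u,a}X_{u,b}=0$ ($a\ne b$), $\sum_aX_{u,a}=1$. A *degree-$d$ pseudodistribution* $\mu$ satisfying $\mathcal A_I$ is a linear functional $\tilde{\mathbb E}$ on polynomials of degree $\le d$ with $\tilde{\mathbb E}[1]=1$, $\tilde{\mathbb E}[p^2]\ge0$ whenever $2\deg p\le d$, and $\tilde{\mathbb E}[fq]=0$ for each axiom $q=0$ and all $f$ with $\deg(fq)\le d$. It is *shift-symmetric* if it equals the uniform mixture of its shifts $\tilde{\mathbb E}_{+s}[\prod_iX_{u_i,a_i}]=\tilde{\mathbb E}[\prod_iX_{u_i,a_i-s}]$, $s\in\Sigma$. Its *value* is $\tilde{\mathbb E}[\mathrm{val}_I(X)]$. *Condition & Round* draws $u\sim\pi$ and then, independently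 for every $v\in V$, a label $Y_v$ with $\Pr[Y_v=a]=\tilde{\mathbb E}[X_{v,a}X_{u,0}]/\tilde{\mathbb E}[X_{u,0}]$; it outputs $Y$. **Theorem.** There are absolute constants $K,c$, a polynomial $P$ with natural-number coefficients, and one fixed randomized real-RAM program $\mathcal P$ such that the following holds. Let $G$ be $(\lambda,C,D)$-certifiably 2-to-4 hypercontractive, let $0<\varepsilon<\lambda^2/100$, and let $d$ be an integer with $$d\ \ge\ D+K\,t\,\log^c(t+2),\qquad t=\frac{C}{\varepsilon\lambda^4}.$$ Let $I$ be an affine Unique Games instance on $G$ over $\Sigma$, and let $\mu$ be a shift-symmetric degree-$d$ pseudodistribution satisfying $\mathcal A_I$, of value at least $1-\varepsilon$. Then 1. for every numbering of $V$ and $\Sigma$, on input the weight matrix of $G$, the table of moments of $\mu$ and the numbers $|V|$, $|\Sigma|$ and that of the label $0$, every run of $\mathcal P$ stops within $P(|V|\cdot|\Sigma|)$ steps; 2. the output of $\mathcal P$ has exactly the law of Condition & Round, which is a probability distribution on $\Sigma^V$; 3. the expected value of the output assignment is at least $\dfrac{\varepsilon\lambda^4}{64\,C}$. Here one step of a real-RAM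 program is one elementary operation: storing a constant, adding or (truncated) subtracting natural numbers, an arithmetic operation on or comparison of real numbers, reading an input entry, writing an output entry, tossing a coin whose bias is held in a register, or a branching or loop test. -/

import Mathlib

noncomputable section

namespace UG

/-! ### Weighted graphs, random walk, normalized Laplacian -/

/-- An undirected graph with nonnegative edge weights (loops allowed, weight `0` means no edge) in
which every vertex meets an edge of positive weight, so that the random walk is defined. -/
structure WeightedGraph (V : Type*) [Fintype V] where
  w : V → V → ℝ
  symm : ∀ u v, w u v = w v u
  nonneg : ∀ u v, 0 ≤ w u v
  deg_pos : ∀ u, 0 < ∑ v, w u v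

namespace WeightedGraph

variable {V : Type*} [Fintype V] (G : WeightedGraph V)

/-- Weighted degree. -/
def deg (u : V) : ℝ := ∑ v, G.w u v

/-- Total weight over ordered pairs. -/
def totalWeight : ℝ := ∑ u, G.deg u

/-- The distribution of a random edge, as a distribution on ordered pairs. -/
def edgeProb (u v : V) : ℝ := G.w u v / G.totalWeight

/-- The stationary measure: probability proportional to the weighted degree. -/
def stat (u : V) : ℝ := G.deg u / G.totalWeight

/-- Transition matrix of the random walk. -/
def transition : Matrix V V ℝ := Matrix.of fun u v => G.w u v / G.deg u

/-- The normalized Laplacian `Id - A`, acting on functions (column vectors). -/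
def laplacian : Module.End ℝ (V → ℝ) := LinearMap.id - G.transition.mulVecLin

/-- Span of the (right) eigenvectors of the Laplacian with eigenvalue at most `lam`. -/
def lowSpace (lam : ℝ) : Submodule ℝ (V → ℝ) :=
  ⨆ μ ∈ Set.Iic lam, Module.End.eigenspace G.laplacian μ

/-- Span of the (right) eigenvectors of the Laplacian with eigenvalue larger than `lam`. -/
def highSpace (lam : ℝ) : Submodule ℝ (V → ℝ) :=
  ⨆ μ ∈ Set.Ioi lam, Module.End.eigenspace G.laplacian μ

theorem iSup_eigenspace_laplacian : ⨆ μ, Module.End.eigenspace G.laplacian μ = ⊤ := by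
  have hd : ∀ u, 0 < G.deg u := G.deg_pos
  have hs : ∀ u, Real.sqrt (G.deg u) ≠ 0 := fun u => (Real.sqrt_pos.2 (hd u)).ne'
  -- conjugation by the square root of the degree makes the Laplacian symmetric
  let φ : (V → ℝ) ≃ₗ[ℝ] EuclideanSpace ℝ V :=
    (LinearEquiv.piCongrRight fun u =>
      LinearEquiv.smulOfNeZero ℝ ℝ (Real.sqrt (G.deg u)) (hs u)).trans
      (WithLp.linearEquiv 2 ℝ (V → ℝ)).symm
  have hφ : ∀ f u, φ f u = Real.sqrt (G.deg u) * f u := fun f u => rfl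
  have hφs : ∀ x u, φ.symm x u = x u / Real.sqrt (G.deg u) := by
    intro x u
    have := hφ (φ.symm x) u
    rw [LinearEquiv.apply_symm_apply] at this
    rw [this]; field_simp [hs u]
  let T : Module.End ℝ (EuclideanSpace ℝ V) := φ.toLinearMap ∘ₗ G.laplacian ∘ₗ φ.symm.toLinearMap
  have hTe : ∀ x u, T x u =
      x u - ∑ v, G.w u v / (Real.sqrt (G.deg u) * Real.sqrt (G.deg v)) * x v := by
    intro x u
    change φ (G.laplacian (φ.symm x)) u = _
    rw [hφ]
    simp only [laplacian, transition, LinearMap.sub_apply, LinearMap.id_apply, Pi.sub_apply,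
      Matrix.mulVecLin_apply, Matrix.mulVec, dotProduct, Matrix.of_apply, hφs]
    rw [mul_sub, Finset.mul_sum]
    congr 1
    · field_simp [hs u]
    · refine Finset.sum_congr rfl fun v _ => ?_
      have h1 := hs u
      have h2 := hs v
      have h3 : G.deg u = Real.sqrt (G.deg u) * Real.sqrt (G.deg u) :=
        (Real.mul_self_sqrt (hd u).le).symm
      generalize Real.sqrt (G.deg u) = a at *
      generalize Real.sqrt (G.deg v) = b at *
      rw [h3]
      field_simp
  have hT : T.IsSymmetric := by
    intro x y
    simp only [PiLp.inner_apply, hTe, RCLike.inner_apply, conj_trivial, mul_sub, sub_mul,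
      Finset.sum_sub_distrib, Finset.mul_sum, Finset.sum_mul]
    congr 1
    rw [Finset.sum_comm]
    refine Finset.sum_congr rfl fun u _ => Finset.sum_congr rfl fun v _ => ?_
    rw [G.symm v u]; ring
  have htop : ⨆ μ, Module.End.eigenspace T μ = ⊤ :=
    Submodule.orthogonal_eq_bot_iff.mp hT.orthogonalComplement_iSup_eigenspaces_eq_bot
  have hmap := congrArg (Submodule.map φ.symm.toLinearMap) htop
  rw [Submodule.map_top, LinearEquiv.range, Submodule.map_iSup] at hmap
  rw [eq_top_iff, ← hmap]
  refine iSup_mono fun μ => ?_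
  rintro _ ⟨x, hx, rfl⟩
  rw [SetLike.mem_coe, Module.End.mem_eigenspace_iff] at hx
  rw [Module.End.mem_eigenspace_iff]
  have h2 := congrArg φ.symm hx
  simpa [T] using h2

theorem isCompl_low_high (lam : ℝ) : IsCompl (G.lowSpace lam) (G.highSpace lam) := by
  constructor
  · exact (Module.End.eigenspaces_iSupIndep G.laplacian).disjoint_biSup_biSup
      (Set.Iic_disjoint_Ioi le_rfl)
  · rw [codisjoint_iff, eq_top_iff, ← G.iSup_eigenspace_laplacian]
    refine iSup_le fun μ => ?_
    rcases le_or_gt μ lam with h | h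
    · exact le_sup_of_le_left (le_iSup₂_of_le μ h le_rfl)
    · exact le_sup_of_le_right (le_iSup₂_of_le μ h le_rfl)

/-- The projection onto the eigenspaces of eigenvalue at most `lam`. -/
def lowProj (lam : ℝ) : (V → ℝ) →ₗ[ℝ] (V → ℝ) :=
  (G.lowSpace lam).projection (G.highSpace lam) (G.isCompl_low_high lam)

end WeightedGraph

/-! ### Sum-of-squares proofs and certifiable hypercontractivity -/

/-- A degree-`D` sum-of-squares proof (from no axioms) of the inequality `g ≤ f`. -/
def SosLe {σ : Type*} (D : ℕ) (g f : MvPolynomial σ ℝ) : Prop :=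
  ∃ s : MvPolynomial σ ℝ, IsSumSq s ∧ s.totalDegree ≤ D ∧ f = g + s

section Hypercontractivity

variable {V : Type*} [Fintype V] [DecidableEq V]

/-- The linear forms `(P f)(v)` in the indeterminates `f(u)`, `u ∈ V`. -/
def formOf (P : (V → ℝ) →ₗ[ℝ] (V → ℝ)) (v : V) : MvPolynomial V ℝ :=
  ∑ u, MvPolynomial.C (P (Pi.single u 1) v) * MvPolynomial.X u

/-- `‖Π f‖₄⁴ ≤ C ‖f‖₂⁴` (norms for the stationary measure, `Π` the projection to the eigenspaces of
Laplacian eigenvalue at most `lam`), as an inequality between polynomials in the values of `f`, has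
a degree-`D` sum-of-squares proof. -/
def CertHypercontractive (G : WeightedGraph V) (lam C : ℝ) (D : ℕ) : Prop :=
  SosLe D
    (∑ v, MvPolynomial.C (G.stat v) * formOf (G.lowProj lam) v ^ 4)
    (MvPolynomial.C C * (∑ v, MvPolynomial.C (G.stat v) * MvPolynomial.X v ^ 2) ^ 2)

end Hypercontractivity

/-! ### Unique games -/

/-- A unique games instance with constraint graph `G` and alphabet `S`. The constraint of an edge
does not depend on the direction in which it is read; `perm u v` is irrelevant at non-edges. -/
structure Instance {V : Type*} [Fintype V] (G : WeightedGraph V) (S : Type*) where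
  perm : V → V → Equiv.Perm S
  symm : ∀ u v, u ≠ v → 0 < G.w u v → perm v u = (perm u v).symm

section Games

variable {V S : Type*} [Fintype V] {G : WeightedGraph V}

/-- All constraints have the form `x_u - x_v = a_{u,v}`. -/
def Instance.IsAffine [AddCommGroup S] (I : Instance G S) : Prop :=
  ∃ a : V → V → S, ∀ u v, 0 < G.w u v → ∀ x, I.perm u v x = x - a u v

/-- The value of an assignment: the probability that a random edge is satisfied. -/
def Instance.value [DecidableEq S] (I : Instance G S) (x : V → S) : ℝ :=
  ∑ u, ∑ v, G.edgeProb u v * (if I.perm u v (x u) = x v then 1 else 0)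

variable [Fintype S]

/-- The value as a quadratic polynomial in the indicator variables `X (u, a)`. -/
def Instance.valuePoly (I : Instance G S) : MvPolynomial (V × S) ℝ :=
  ∑ u, ∑ v, MvPolynomial.C (G.edgeProb u v) *
    ∑ a, MvPolynomial.X (u, a) * MvPolynomial.X (v, I.perm u v a)

end Games

/-! ### Pseudodistributions -/

section Pseudo

/-- A degree-`d` pseudoexpectation operator. It is represented by a linear functional on all
polynomials, of which only the values at polynomials of degree at most `d` are meaningful. -/
structure IsPseudoexpectation {σ : Type*} (d : ℕ) (E : MvPolynomial σ ℝ →ₗ[ℝ] ℝ) : Prop where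
  one : E 1 = 1
  sq_nonneg : ∀ p : MvPolynomial σ ℝ, 2 * p.totalDegree ≤ d → 0 ≤ E (p ^ 2)

/-- The degree-`d` pseudoexpectation `E` satisfies the axiom `q = 0`. -/
def SatisfiesEq {σ : Type*} (d : ℕ) (E : MvPolynomial σ ℝ →ₗ[ℝ] ℝ) (q : MvPolynomial σ ℝ) : Prop :=
  ∀ f : MvPolynomial σ ℝ, (f * q).totalDegree ≤ d → E (f * q) = 0

variable {V S : Type*}

/-- The unique games axioms: the variables `X (u, a)` are `0/1` indicators of `u` having label `a`,
and each vertex has exactly one label. -/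
structure SatisfiesUG [Fintype S] (d : ℕ) (E : MvPolynomial (V × S) ℝ →ₗ[ℝ] ℝ) : Prop where
  boolean : ∀ u a,
    SatisfiesEq d E (MvPolynomial.X (u, a) ^ 2 - MvPolynomial.X (u, a))
  disjoint : ∀ u a b, a ≠ b →
    SatisfiesEq d E (MvPolynomial.X (u, a) * MvPolynomial.X (u, b))
  total : ∀ u, SatisfiesEq d E (∑ a, MvPolynomial.X (u, a) - 1)

/-- The uniform mixture of all global shifts of a pseudodistribution: under the shift by `s`, the
moment of `∏ X (uᵢ, aᵢ)` is the original moment of `∏ X (uᵢ, aᵢ - s)`. -/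
def symmetrize [Fintype S] [AddCommGroup S] (E : MvPolynomial (V × S) ℝ →ₗ[ℝ] ℝ) :
    MvPolynomial (V × S) ℝ →ₗ[ℝ] ℝ :=
  (Fintype.card S : ℝ)⁻¹ • ∑ s : S,
    E ∘ₗ (MvPolynomial.rename (R := ℝ) fun i : V × S => (i.1, i.2 - s)).toLinearMap

/-- Invariance under symmetrization. -/
def ShiftSymmetric [Fintype S] [AddCommGroup S] (d : ℕ)
    (E : MvPolynomial (V × S) ℝ →ₗ[ℝ] ℝ) : Prop :=
  ∀ p : MvPolynomial (V × S) ℝ, p.totalDegree ≤ d → symmetrize E p = E p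

/-- The conditional marginal of the event `X_v = a` given `X_u = 0`. -/
def condMarginal [Zero S] (E : MvPolynomial (V × S) ℝ →ₗ[ℝ] ℝ) (u v : V) (a : S) : ℝ :=
  E (MvPolynomial.X (v, a) * MvPolynomial.X (u, 0)) / E (MvPolynomial.X (u, 0))

/-- The law of Condition & Round: choose `u` from the stationary measure, condition on `X_u = 0`,
and draw the labels of all vertices independently from the conditional marginals. This is the
probability that the assignment `y` is drawn. -/
def condRoundProb [Fintype V] [Zero S] (G : WeightedGraph V)
    (E : MvPolynomial (V × S) ℝ →ₗ[ℝ] ℝ) (y : V → S) : ℝ :=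
  ∑ u, G.stat u * ∏ v, condMarginal E u v (y v)

end Pseudo

/-! ### Randomized real-RAM programs with a step count -/

/-- A memory state: registers holding natural numbers, registers holding real numbers, read-only
input arrays of reals (`input t i` is entry `i` of array `t`), and an output array of naturals. -/
structure State where
  nat : ℕ → ℕ
  real : ℕ → ℝ
  input : ℕ → ℕ → ℝ
  out : ℕ → ℕ

/-- Elementary instructions. Each takes one time step. -/
inductive Instr
  | nconst (dst c : ℕ)
  | nadd (dst a b : ℕ)
  | nsub (dst a b : ℕ)
  | rconst (dst : ℕ) (c : ℤ)
  | radd (dst a b : ℕ)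
  | rsub (dst a b : ℕ)
  | rmul (dst a b : ℕ)
  | rdiv (dst a b : ℕ)
  | rle (dst a b : ℕ)
  | load (dst t a : ℕ)
  | coin (dst a : ℕ)
  | write (a b : ℕ)

/-- Assign a natural register. -/
def State.setNat (s : State) (dst x : ℕ) : State := { s with nat := Function.update s.nat dst x }

/-- Assign a real register. -/
def State.setReal (s : State) (dst : ℕ) (x : ℝ) : State :=
  { s with real := Function.update s.real dst x }

/-- A biased coin that shows `true` with probability `p` (truncated to the interval `[0, 1]`). -/
def coin (p : ℝ) : PMF Bool :=
  PMF.ofFintype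
    (fun b => cond b (ENNReal.ofReal (min p 1)) (1 - ENNReal.ofReal (min p 1)))
    (by simp)

/-- The effect of an instruction. Subtraction of naturals truncates at `0`, `rle` compares two real
registers, `load` reads an input array at an address held in a register, `coin` tosses a coin whose
bias is held in a real register, `write a b` sets the output cell number `nat a` to `nat b`. -/
def Instr.exec : Instr → State → PMF State
  | nconst dst c, s => PMF.pure (s.setNat dst c)
  | nadd dst a b, s => PMF.pure (s.setNat dst (s.nat a + s.nat b))
  | nsub dst a b, s => PMF.pure (s.setNat dst (s.nat a - s.nat b))
  | rconst dst c, s => PMF.pure (s.setReal dst c)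
  | radd dst a b, s => PMF.pure (s.setReal dst (s.real a + s.real b))
  | rsub dst a b, s => PMF.pure (s.setReal dst (s.real a - s.real b))
  | rmul dst a b, s => PMF.pure (s.setReal dst (s.real a * s.real b))
  | rdiv dst a b, s => PMF.pure (s.setReal dst (s.real a / s.real b))
  | rle dst a b, s => by
      classical exact PMF.pure (s.setNat dst (if s.real a ≤ s.real b then 1 else 0))
  | load dst t a, s => PMF.pure (s.setReal dst (s.input t (s.nat a)))
  | coin dst a, s => (UG.coin (s.real a)).map fun b => s.setNat dst (cond b 1 0)
  | write a b, s => PMF.pure { s with out := Function.update s.out (s.nat a) (s.nat b) }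

/-- Programs: instructions, sequencing, branching on a register being `0`, and repeating a body as
many times as a register says on entry. A program is a finite object with fixed register numbers. -/
inductive Prog
  | instr (i : Instr)
  | seq (p q : Prog)
  | ifz (r : ℕ) (p q : Prog)
  | loop (r : ℕ) (p : Prog)

/-- Run a program: the law of the final state together with the number of steps. Every instruction,
every branching test and every loop test costs one step. -/
def Prog.run : Prog → State → PMF (State × ℕ)
  | instr i, s => (i.exec s).map fun s' => (s', 1)
  | seq p q, s => (p.run s).bind fun x => (q.run x.1).map fun y => (y.1, x.2 + y.2)
  | ifz r p q, s => (if s.nat r = 0 then p.run s else q.run s).map fun x => (x.1, x.2 + 1)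
  | loop r p, s =>
      Nat.rec (motive := fun _ => PMF (State × ℕ)) (PMF.pure (s, 1))
        (fun _ acc => acc.bind fun x => (p.run x.1).map fun y => (y.1, x.2 + y.2 + 1))
        (s.nat r)

/-! ### Input and output of the rounding algorithm -/

section Encoding

variable {V S : Type*} {n k : ℕ}

/-- The weight matrix as an array: `w u v` is stored at address `i * n + j` if `u`, `v` are the
vertices number `i`, `j`. -/
def weightTable [Fintype V] (G : WeightedGraph V) (eV : V ≃ Fin n) (m : ℕ) : ℝ :=
  if h : m < n * n then
    G.w (eV.symm (finProdFinEquiv.symm ⟨m, h⟩).1) (eV.symm (finProdFinEquiv.symm ⟨m, h⟩).2)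
  else 0

/-- The variables `X (u, a)` numbered from `1` to `n * k`, namely `1 + i * k + j` if `u` is vertex
number `i` and `a` is label number `j`; the number `0` stands for the constant `1`. -/
def digitPoly (eV : V ≃ Fin n) (eS : S ≃ Fin k) (c : ℕ) : MvPolynomial (V × S) ℝ :=
  if h : 0 < c ∧ c - 1 < n * k then
    MvPolynomial.X (eV.symm (finProdFinEquiv.symm ⟨c - 1, h.2⟩).1,
      eS.symm (finProdFinEquiv.symm ⟨c - 1, h.2⟩).2)
  else 1

/-- The table of all moments of degree at most `d`: the address, written in base `n * k + 1` with at
most `d` digits, lists the variables whose product is taken. -/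
def momentTable (eV : V ≃ Fin n) (eS : S ≃ Fin k) (d : ℕ)
    (E : MvPolynomial (V × S) ℝ →ₗ[ℝ] ℝ) (m : ℕ) : ℝ :=
  if m < (n * k + 1) ^ d then
    E (((Nat.digits (n * k + 1) m).map (digitPoly eV eS)).prod)
  else 0

/-- The initial state: registers `0`, `1`, `2` hold the number of vertices, the number of labels and
the number of the label `0`; array `0` holds the weights and array `1` the moments. -/
def initState [Fintype V] [Zero S] (G : WeightedGraph V) (eV : V ≃ Fin n) (eS : S ≃ Fin k) (d : ℕ)
    (E : MvPolynomial (V × S) ℝ →ₗ[ℝ] ℝ) : State where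
  nat r := if r = 0 then n else if r = 1 then k else if r = 2 then (eS 0 : ℕ) else 0
  real _ := 0
  input t := if t = 0 then weightTable G eV else if t = 1 then momentTable eV eS d E else fun _ => 0
  out _ := 0

/-- The probability that a program, started in `s`, outputs the assignment `y`, i.e. ends with the
number of the label `y v` in the output cell of every vertex `v`. -/
def outputProb (eV : V ≃ Fin n) (eS : S ≃ Fin k) (prog : Prog) (s : State) (y : V → S) : ℝ :=
  (((prog.run s).map fun x => fun v : V => x.1.out (eV v)) fun v => (eS (y v) : ℕ)).toReal

end Encoding

end UG

end

/-! In degree at most d, a pseudodistribution obeying the label axioms is integration against a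
signed measure ν on assignments (`SatisfiesUG.exists_signedMeasure`), so polynomials can be treated
as functions on assignments. For two independent samples x, x' from ν, squares of functions of low
degree in each sample still have nonnegative expectation, by the Schur product theorem
(`pairE_sq_nonneg`). Hence any inequality whose difference lies in `pairCone`, in low enough degree,
may be averaged over ν × ν.

Let F_s(v) be the indicator of x'_v - x_v = s times the fraction of the constraints at v that x'
satisfies. Since the constraints are affine, an edge satisfied by both samples carries the same
shift at its two ends. For value at least 1 - ε the functions F_s therefore behave like a partition
with small boundary: the average of ∑_s ⟨F_s, L F_s⟩ is at most 4ε. The part of F_s above eigenvalue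
λ is then small, and ∑_s ⟨F_s, Π F_s⟩ is close to 1. The tangent inequality a⁴ ≥ 4a - 3, weighted by
F_s, turns this into a lower bound on ∑_s ‖Π F_s‖₄⁴, and hypercontractivity bounds that sum above by
C ∑_s ‖F_s‖₂⁴. The last sum is at most the average, over random vertices u and v, of the indicator
that the shifts at u and v agree times the local value at v. So this average is at least (1 - 8ε -
16ε/λ)/C (`Instance.le_pairE_agree`).

This event can be rounded. If the shifts at u and v agree and x' satisfies the constraint (v, w),
then x_v and x'_w satisfy it up to the shift at u. Shift symmetry moves the label of u to 0 in both
samples, after which x_v and x'_w are independent draws from the marginals conditioned on X_u = 0.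
These are the labels that Condition & Round gives to v ≠ w (`Instance.pairE_agree_le`). The
resulting bound on the expected value is stronger than the one claimed, and degree 24 suffices for
it.

The program samples u and all labels by reservoir sampling from unnormalized weights and moments. It
is coupled step by step to an abstract sampler, with an exact step count (`condRoundProg_sim`), and
the law of that sampler is computed in closed form (`reservoir_apply`, `iter_fillStep`). -/

noncomputable section

namespace UG

open MvPolynomial

set_option linter.unusedSectionVars false

/-! ### Pseudodistributions as signed measures on assignments -/

section SignedMeasure

variable {V S : Type*} [Fintype V] [DecidableEq V] [Fintype S] [DecidableEq S]

/-- The indicator vector of an assignment. -/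
def pt (x : V → S) (i : V × S) : ℝ := if x i.1 = i.2 then 1 else 0

/-- The monomial of a partial assignment; the vertices labelled `0` are left out. -/
def reducedMonomial [Zero S] (τ : V → S) : MvPolynomial (V × S) ℝ :=
  ∏ u, if τ u = 0 then 1 else X (u, τ u)

theorem eval_pt_boolean (x : V → S) (u : V) (a : S) :
    eval (pt x) (X (u, a) ^ 2 - X (u, a) : MvPolynomial (V × S) ℝ) = 0 := by
  by_cases h : x u = a <;> simp [pt, h]

theorem eval_pt_disjoint (x : V → S) (u : V) {a b : S} (hab : a ≠ b) :
    eval (pt x) (X (u, a) * X (u, b) : MvPolynomial (V × S) ℝ) = 0 := by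
  by_cases h : x u = a
  · simp [pt, h, hab]
  · simp [pt, h]

theorem eval_pt_total (x : V → S) (u : V) :
    eval (pt x) (∑ a, X (u, a) - 1 : MvPolynomial (V × S) ℝ) = 0 := by
  simp [pt]

theorem totalDegree_prod_X_le {σ ι : Type*} (s : Finset ι) (f : ι → σ) :
    (∏ i ∈ s, X (f i) : MvPolynomial σ ℝ).totalDegree ≤ s.card := by
  refine (totalDegree_finsetProd _ _).trans ?_
  simp

theorem reducedMonomial_eq [Zero S] (τ : V → S) :
    reducedMonomial τ = ∏ u ∈ Finset.univ.filter (fun u => τ u ≠ 0), X (u, τ u) := by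
  rw [reducedMonomial, Finset.prod_filter]
  exact Finset.prod_congr rfl fun u _ => by by_cases h : τ u = 0 <;> simp [h]

theorem totalDegree_reducedMonomial_le [Zero S] (τ : V → S) :
    (reducedMonomial τ).totalDegree ≤ (Finset.univ.filter fun u => τ u ≠ 0).card := by
  rw [reducedMonomial_eq]
  exact totalDegree_prod_X_le _ _

theorem reducedMonomial_update [Zero S] (τ : V → S) {u : V} (hu : τ u = 0) {a : S} (ha : a ≠ 0) :
    reducedMonomial (Function.update τ u a) = X (u, a) * reducedMonomial τ := by
  rw [reducedMonomial, reducedMonomial, ← Finset.mul_prod_erase _ _ (Finset.mem_univ u),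
    ← Finset.mul_prod_erase _ (fun u => if τ u = 0 then 1 else _) (Finset.mem_univ u)]
  simp only [Function.update_self, ha, hu, if_false, if_true, one_mul]
  congr 1
  refine Finset.prod_congr rfl fun v hv => ?_
  rw [Function.update_of_ne (Finset.ne_of_mem_erase hv)]

variable {d : ℕ} {L : MvPolynomial (V × S) ℝ →ₗ[ℝ] ℝ}

/-- Each factor X(u,0) is eliminated through X(u,0) = 1 - ∑_{a ≠ 0} X(u,a), which leaves reduced
monomials only. The elimination does not raise the degree, so every use of the axiom stays within
degree d. -/
theorem SatisfiesUG.map_zeroLabels [Zero S] (hL : SatisfiesUG d L)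
    (h : ∀ τ : V → S, L (reducedMonomial τ) = 0) (Z : Finset V) :
    ∀ τ : V → S, (∀ u ∈ Z, τ u = 0) →
      Z.card + (Finset.univ.filter fun u => τ u ≠ 0).card ≤ d →
      L ((∏ u ∈ Z, X (u, 0)) * reducedMonomial τ) = 0 := by
  induction Z using Finset.induction_on with
  | empty => intro τ _ _; simpa using h τ
  | insert u Z hu ih =>
    intro τ hτ hd
    rw [Finset.card_insert_of_notMem hu] at hd
    have hτu : τ u = 0 := hτ u (Finset.mem_insert_self _ _)
    have hτZ : ∀ v ∈ Z, τ v = 0 := fun v hv => hτ v (Finset.mem_insert_of_mem hv)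
    set f : MvPolynomial (V × S) ℝ := (∏ u ∈ Z, X (u, 0)) * reducedMonomial τ with hf
    have hfd : f.totalDegree ≤ Z.card + (Finset.univ.filter fun u => τ u ≠ 0).card :=
      (totalDegree_mul _ _).trans
        (add_le_add (totalDegree_prod_X_le _ _) (totalDegree_reducedMonomial_le τ))
    have hX : (∑ a, X (u, a) - 1 : MvPolynomial (V × S) ℝ).totalDegree ≤ 1 := by
      refine (totalDegree_sub _ _).trans (max_le ?_ (by simp))
      exact totalDegree_finsetSum_le fun a _ => by simp
    have ht := hL.total u f ((totalDegree_mul _ _).trans (by omega))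
    have hs : ∑ a, L (f * X (u, a)) = L (f * X (u, 0)) := by
      refine Fintype.sum_eq_single 0 fun a ha0 => ?_
      have := ih (Function.update τ u a) (fun v hv => by
        rw [Function.update_of_ne (ne_of_mem_of_not_mem hv hu)]; exact hτZ v hv) ?_
      · rw [reducedMonomial_update τ hτu ha0] at this
        rw [← this, hf]
        congr 1
        ring
      · have : (Finset.univ.filter fun v => Function.update τ u a v ≠ 0) ⊆
            insert u (Finset.univ.filter fun u => τ u ≠ 0) := by
          intro v hv
          by_cases hvu : v = u
          · simp [hvu]
          · simpa [Function.update_of_ne hvu, hvu] using hv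
        have := (Finset.card_le_card this).trans (Finset.card_insert_le _ _)
        omega
    have h0 : L f = 0 := ih τ hτZ (by omega)
    rw [mul_sub, mul_one, Finset.mul_sum, map_sub, map_sum, h0, sub_zero, hs] at ht
    rw [Finset.prod_insert hu, ← ht, hf]
    congr 1
    ring

theorem SatisfiesUG.map_prod_X [Zero S] (hL : SatisfiesUG d L)
    (h : ∀ τ : V → S, L (reducedMonomial τ) = 0) (T : Finset V) (a : V → S) (hT : T.card ≤ d) :
    L (∏ u ∈ T, X (u, a u)) = 0 := by
  have h1 := hL.map_zeroLabels h (T.filter fun u => a u = 0) (fun u => if u ∈ T then a u else 0)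
  have h2 : (Finset.univ.filter fun u => (if u ∈ T then a u else 0) ≠ 0) =
      T.filter fun u => ¬ a u = 0 := by
    ext u
    by_cases hu : u ∈ T <;> simp [hu]
  rw [reducedMonomial_eq, h2] at h1
  rw [← Finset.prod_filter_mul_prod_filter_not T (fun u => a u = 0)]
  convert h1 ?_ ?_ using 3
  · exact Finset.prod_congr rfl fun u hu => by rw [(Finset.mem_filter.1 hu).2]
  · exact Finset.prod_congr rfl fun u hu => by rw [if_pos (Finset.mem_filter.1 hu).1]
  · intro u hu
    have := Finset.mem_filter.1 hu
    simp [this.2]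
  · rw [Finset.card_filter_add_card_filter_not]
    exact hT

/-- The set T collects the vertices already met, with their labels. A further variable at a vertex
of T is absorbed by the boolean axiom or annihilated by disjointness; at a new vertex it joins T. -/
theorem SatisfiesUG.map_multiset_prod_X [Zero S] (hL : SatisfiesUG d L)
    (h : ∀ τ : V → S, L (reducedMonomial τ) = 0) (l : Multiset (V × S)) :
    ∀ (T : Finset V) (a : V → S), l.card + T.card ≤ d →
      L ((l.map X).prod * ∏ u ∈ T, X (u, a u)) = 0 := by
  induction l using Multiset.induction_on with
  | empty => intro T a hT; simpa using hL.map_prod_X h T a (by simpa using hT)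
  | cons i l ih =>
    obtain ⟨u, b⟩ := i
    intro T a hT
    rw [Multiset.card_cons] at hT
    have hl : ((l.map X).prod : MvPolynomial (V × S) ℝ).totalDegree ≤ l.card := by
      refine (totalDegree_multiset_prod _).trans ?_
      simp
    rw [Multiset.map_cons, Multiset.prod_cons]
    by_cases hu : u ∈ T
    · rw [← Finset.mul_prod_erase _ _ hu]
      set r : MvPolynomial (V × S) ℝ := (l.map X).prod * ∏ u ∈ T.erase u, X (u, a u) with hr
      have hrd : r.totalDegree ≤ l.card + (T.card - 1) := by
        refine (totalDegree_mul _ _).trans (add_le_add hl ?_)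
        rw [← Finset.card_erase_of_mem hu]
        exact totalDegree_prod_X_le _ _
      have hTp : 0 < T.card := Finset.card_pos.2 ⟨u, hu⟩
      by_cases hb : b = a u
      · have h1 := hL.boolean u b r ?_
        · have h2 := ih T a (by omega)
          rw [← Finset.mul_prod_erase _ _ hu] at h2
          rw [mul_sub, map_sub, sub_eq_zero] at h1
          rw [← h2, ← hb]
          convert h1 using 2 <;> rw [hr] <;> ring
        · refine (totalDegree_mul _ _).trans ?_
          have : (X (u, b) ^ 2 - X (u, b) : MvPolynomial (V × S) ℝ).totalDegree ≤ 2 :=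
            (totalDegree_sub _ _).trans (max_le (by simp) (by simp))
          omega
      · have h1 := hL.disjoint u b (a u) hb r ?_
        · rw [← h1, hr]
          congr 1
          ring
        · refine (totalDegree_mul _ _).trans ?_
          have : (X (u, b) * X (u, a u) : MvPolynomial (V × S) ℝ).totalDegree ≤ 2 :=
            (totalDegree_mul _ _).trans (by simp)
          omega
    · have h1 := ih (insert u T) (Function.update a u b)
        (by rw [Finset.card_insert_of_notMem hu]; omega)
      rw [Finset.prod_insert hu, Function.update_self] at h1
      rw [← h1]
      congr 1
      have : ∏ v ∈ T, X (v, Function.update a u b v) =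
          (∏ v ∈ T, X (v, a v) : MvPolynomial (V × S) ℝ) :=
        Finset.prod_congr rfl fun v hv => by
          rw [Function.update_of_ne (ne_of_mem_of_not_mem hv hu)]
      rw [this]
      ring

theorem SatisfiesUG.eq_zero [Zero S] (hL : SatisfiesUG d L)
    (h : ∀ τ : V → S, L (reducedMonomial τ) = 0) (p : MvPolynomial (V × S) ℝ)
    (hp : p.totalDegree ≤ d) : L p = 0 := by
  rw [p.as_sum, map_sum]
  refine Finset.sum_eq_zero fun s hs => ?_
  have hs' := (le_totalDegree hs).trans hp
  rw [monomial_eq, ← smul_eq_C_mul, map_smul]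
  have h1 := hL.map_multiset_prod_X h (Finsupp.toMultiset s) ∅ (fun _ => 0) (by
    rw [Finsupp.card_toMultiset, Finset.card_empty, add_zero]; exact hs')
  rw [Finset.prod_empty, mul_one, Finsupp.toMultiset_map, Finsupp.prod_toMultiset,
    Finsupp.prod_mapDomain_index (by simp) (by intros; rw [pow_add])] at h1
  rw [h1, smul_zero]

/-- The inverse of the matrix of the evaluations of the reduced monomials at one vertex. -/
def labelKernel [Zero S] (b t : S) : ℝ :=
  if b = 0 then (if t = 0 then 1 else -1) else if b = t then 1 else 0

theorem sum_labelKernel [Zero S] (t t' : S) :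
    ∑ b, labelKernel b t * (if t' = 0 then 1 else if b = t' then 1 else 0) =
      if t = t' then 1 else 0 := by
  by_cases ht' : t' = 0
  · subst ht'
    simp only [if_true, mul_one]
    rw [← Finset.add_sum_erase _ _ (Finset.mem_univ (0 : S))]
    have : ∑ b ∈ Finset.univ.erase 0, labelKernel b t =
        ∑ b ∈ Finset.univ.erase 0, if b = t then (1 : ℝ) else 0 :=
      Finset.sum_congr rfl fun b hb => by
        rw [labelKernel, if_neg (Finset.ne_of_mem_erase hb)]
    rw [this, Finset.sum_ite_eq']
    by_cases ht : t = 0 <;> simp [labelKernel, ht]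
  · simp only [ht', if_false]
    simp [labelKernel, ht', eq_comm]

/-- In degree at most `d`, a functional satisfying the unique games axioms is integration against a
signed measure on the assignments. -/
theorem SatisfiesUG.exists_signedMeasure [Zero S] (hL : SatisfiesUG d L) :
    ∃ ν : (V → S) → ℝ, ∀ p : MvPolynomial (V × S) ℝ, p.totalDegree ≤ d →
      L p = ∑ x, ν x * eval (pt x) p := by
  -- Möbius inversion, one vertex at a time: ν is chosen to reproduce L on every reduced monomial.
  -- Reduced monomials of degree above d also enter, and their arbitrary values do no harm, because
  -- the comparison is made only up to degree d.
  let ν : (V → S) → ℝ := fun x => ∑ τ, L (reducedMonomial τ) * ∏ u, labelKernel (x u) (τ u)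
  let M : MvPolynomial (V × S) ℝ →ₗ[ℝ] ℝ := ∑ x, ν x • (aeval (pt x)).toLinearMap
  have hM : ∀ p, M p = ∑ x, ν x * eval (pt x) p := by
    intro p
    simp [M, LinearMap.sum_apply, aeval_eq_eval]
  refine ⟨ν, fun p hp => ?_⟩
  rw [← hM, ← sub_eq_zero, ← LinearMap.sub_apply]
  -- L - M satisfies the axioms, since they vanish at honest assignments, and it kills all reduced
  -- monomials. These two facts determine it in degree at most d.
  refine SatisfiesUG.eq_zero (d := d) ?_ ?_ p hp
  · refine ⟨fun u a f hf => ?_, fun u a b hab f hf => ?_, fun u f hf => ?_⟩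
    · rw [LinearMap.sub_apply, hL.boolean u a f hf, hM]
      simp only [map_mul, eval_pt_boolean, mul_zero, Finset.sum_const_zero, sub_zero]
    · rw [LinearMap.sub_apply, hL.disjoint u a b hab f hf, hM]
      simp only [map_mul (eval _) f, eval_pt_disjoint _ _ hab, mul_zero, Finset.sum_const_zero,
        sub_zero]
    · rw [LinearMap.sub_apply, hL.total u f hf, hM]
      simp only [map_mul, eval_pt_total, mul_zero, Finset.sum_const_zero, sub_zero]
  · intro τ'
    rw [LinearMap.sub_apply, hM, sub_eq_zero]
    have he : ∀ x : V → S, eval (pt x) (reducedMonomial τ') =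
        ∏ u, if τ' u = 0 then (1 : ℝ) else if x u = τ' u then 1 else 0 := by
      intro x
      rw [reducedMonomial, map_prod]
      refine Finset.prod_congr rfl fun u _ => ?_
      by_cases h : τ' u = 0 <;> simp [h, pt]
    simp only [he, ν, Finset.sum_mul]
    rw [Finset.sum_comm]
    simp only [mul_assoc, ← Finset.prod_mul_distrib, ← Finset.mul_sum]
    -- The evaluation matrix is a tensor power of the one-vertex matrix, so the product of the
    -- one-vertex inverses inverts it.
    have hs : ∀ τ : V → S, ∑ x : V → S, ∏ u, labelKernel (x u) (τ u) *
        (if τ' u = 0 then (1 : ℝ) else if x u = τ' u then 1 else 0) =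
        if τ = τ' then 1 else 0 := by
      intro τ
      rw [← Fintype.prod_sum (fun u b => labelKernel b (τ u) *
        (if τ' u = 0 then (1 : ℝ) else if b = τ' u then 1 else 0))]
      simp only [sum_labelKernel]
      by_cases h : τ = τ'
      · simp [h]
      · obtain ⟨u, hu⟩ := Function.ne_iff.1 h
        rw [if_neg h, Finset.prod_eq_zero (Finset.mem_univ u) (if_neg hu)]
    simp only [hs]
    simp

end SignedMeasure

/-! ### Two independent samples and the cone of sums of squares -/

section PairCone

variable (V S : Type*) [Fintype V] [DecidableEq V] [Fintype S] [DecidableEq S]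

/-- Affine functions of the label indicators of one assignment. -/
def affineSpace : Submodule ℝ ((V → S) → ℝ) :=
  Submodule.span ℝ (insert 1 (Set.range fun (i : V × S) (x : V → S) => pt x i))

variable {V S}

/-- A function of the first of two assignments. -/
def onFst : ((V → S) → ℝ) →ₐ[ℝ] ((V → S) × (V → S) → ℝ) where
  toFun f z := f z.1
  map_one' := rfl
  map_mul' _ _ := rfl
  map_zero' := rfl
  map_add' _ _ := rfl
  commutes' _ := rfl

/-- A function of the second of two assignments. -/
def onSnd : ((V → S) → ℝ) →ₐ[ℝ] ((V → S) × (V → S) → ℝ) where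
  toFun f z := f z.2
  map_one' := rfl
  map_mul' _ _ := rfl
  map_zero' := rfl
  map_add' _ _ := rfl
  commutes' _ := rfl

theorem onFst_apply (f : (V → S) → ℝ) (z : (V → S) × (V → S)) : onFst f z = f z.1 := rfl

theorem onSnd_apply (f : (V → S) → ℝ) (z : (V → S) × (V → S)) : onSnd f z = f z.2 := rfl

variable (V S) in
/-- Functions of a pair of assignments of degree at most `m` in each of them. -/
def pairSpace (m : ℕ) : Submodule ℝ ((V → S) × (V → S) → ℝ) :=
  ((affineSpace V S) ^ m).map onFst.toLinearMap * ((affineSpace V S) ^ m).map onSnd.toLinearMap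

theorem one_mem_affineSpace : (1 : (V → S) → ℝ) ∈ affineSpace V S :=
  Submodule.subset_span (Set.mem_insert _ _)

theorem pt_mem_affineSpace (u : V) (a : S) :
    (fun x : V → S => if x u = a then (1 : ℝ) else 0) ∈ affineSpace V S :=
  Submodule.subset_span (Set.mem_insert_of_mem _ ⟨(u, a), rfl⟩)

/-- The way back from functions to polynomials: it transfers positivity of the pseudoexpectation on
squares to ν. -/
theorem exists_poly_of_mem_affineSpace_pow (m : ℕ) :
    ∀ f ∈ (affineSpace V S) ^ m, ∃ p : MvPolynomial (V × S) ℝ,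
      p.totalDegree ≤ m ∧ ∀ x, f x = eval (pt x) p := by
  induction m with
  | zero =>
    intro f hf
    rw [pow_zero, Submodule.mem_one] at hf
    obtain ⟨r, rfl⟩ := hf
    exact ⟨C r, by simp, fun x => by simp⟩
  | succ m ih =>
    intro f hf
    rw [pow_succ] at hf
    induction hf using Submodule.mul_induction_on' with
    | mem_mul_mem f hf g hg =>
      obtain ⟨p, hp, hpf⟩ := ih f hf
      suffices h : ∃ q : MvPolynomial (V × S) ℝ, q.totalDegree ≤ 1 ∧ ∀ x, g x = eval (pt x) q by
        obtain ⟨q, hq, hqg⟩ := h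
        refine ⟨p * q, (totalDegree_mul _ _).trans (add_le_add hp hq), fun x => ?_⟩
        rw [map_mul, ← hpf, ← hqg]; rfl
      induction hg using Submodule.span_induction with
      | mem g hg =>
        rcases hg with rfl | ⟨i, rfl⟩
        · exact ⟨1, by simp, fun x => by simp⟩
        · exact ⟨X i, by simp, fun x => by simp⟩
      | zero => exact ⟨0, by simp, fun x => by simp⟩
      | add g g' _ _ h h' =>
        obtain ⟨q, hq, hqg⟩ := h
        obtain ⟨q', hq', hqg'⟩ := h'
        exact ⟨q + q', (totalDegree_add _ _).trans (max_le hq hq'), fun x => by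
          rw [map_add, ← hqg, ← hqg']; rfl⟩
      | smul c g _ h =>
        obtain ⟨q, hq, hqg⟩ := h
        exact ⟨c • q, (totalDegree_smul_le _ _).trans hq, fun x => by
          rw [smul_eval, ← hqg]; rfl⟩
    | add f _ g _ hf hg =>
      obtain ⟨p, hp, hpf⟩ := hf
      obtain ⟨q, hq, hqg⟩ := hg
      exact ⟨p + q, (totalDegree_add _ _).trans (max_le hp hq), fun x => by
        rw [map_add, ← hpf, ← hqg]; rfl⟩

theorem pairSpace_mul (m n : ℕ) : pairSpace V S m * pairSpace V S n = pairSpace V S (m + n) := by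
  simp only [pairSpace, pow_add]
  rw [Submodule.map_mul, Submodule.map_mul]
  ring

theorem mul_mem_pairSpace {m n : ℕ} {F G : (V → S) × (V → S) → ℝ}
    (hF : F ∈ pairSpace V S m) (hG : G ∈ pairSpace V S n) : F * G ∈ pairSpace V S (m + n) := by
  rw [← pairSpace_mul]
  exact Submodule.mul_mem_mul hF hG

theorem one_mem_affineSpace_pow (m : ℕ) : (1 : (V → S) → ℝ) ∈ affineSpace V S ^ m := by
  simpa using Submodule.pow_mem_pow _ one_mem_affineSpace m

theorem one_mem_pairSpace (m : ℕ) : (1 : (V → S) × (V → S) → ℝ) ∈ pairSpace V S m := by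
  have := Submodule.mul_mem_mul (R := ℝ)
    (Submodule.mem_map_of_mem (f := onFst.toLinearMap) (one_mem_affineSpace_pow (V := V) (S := S) m))
    (Submodule.mem_map_of_mem (f := onSnd.toLinearMap) (one_mem_affineSpace_pow (V := V) (S := S) m))
  simpa [pairSpace] using this

theorem pairSpace_mono {m n : ℕ} (h : m ≤ n) : pairSpace V S m ≤ pairSpace V S n := by
  intro F hF
  obtain ⟨k, rfl⟩ := Nat.exists_eq_add_of_le h
  simpa using mul_mem_pairSpace hF (one_mem_pairSpace k)

theorem const_mem_pairSpace (c : ℝ) (m : ℕ) : (fun _ => c) ∈ pairSpace V S m := by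
  have := (pairSpace V S m).smul_mem c (one_mem_pairSpace m)
  convert this using 1
  ext z; simp

theorem fst_mem_pairSpace (u : V) (a : S) :
    (fun z : (V → S) × (V → S) => if z.1 u = a then (1 : ℝ) else 0) ∈ pairSpace V S 1 := by
  have := Submodule.mul_mem_mul (R := ℝ)
    (Submodule.mem_map_of_mem (f := onFst.toLinearMap) (pt_mem_affineSpace (V := V) (S := S) u a))
    (Submodule.mem_map_of_mem (f := onSnd.toLinearMap) (one_mem_affineSpace (V := V) (S := S)))
  rw [pairSpace, pow_one]
  convert this using 1
  ext z; simp [onFst_apply]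

theorem snd_mem_pairSpace (u : V) (a : S) :
    (fun z : (V → S) × (V → S) => if z.2 u = a then (1 : ℝ) else 0) ∈ pairSpace V S 1 := by
  have := Submodule.mul_mem_mul (R := ℝ)
    (Submodule.mem_map_of_mem (f := onFst.toLinearMap) (one_mem_affineSpace (V := V) (S := S)))
    (Submodule.mem_map_of_mem (f := onSnd.toLinearMap) (pt_mem_affineSpace (V := V) (S := S) u a))
  rw [pairSpace, pow_one]
  convert this using 1
  ext z; simp [onSnd_apply]

/-- Expectation over two independent samples from a signed measure. -/
def pairE (ν : (V → S) → ℝ) : ((V → S) × (V → S) → ℝ) →ₗ[ℝ] ℝ where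
  toFun F := ∑ z, ν z.1 * ν z.2 * F z
  map_add' F G := by simp [mul_add, Finset.sum_add_distrib]
  map_smul' c F := by
    rw [Finset.smul_sum]
    exact Finset.sum_congr rfl fun z _ => by simp; ring

theorem pairE_apply (ν : (V → S) → ℝ) (F : (V → S) × (V → S) → ℝ) :
    pairE ν F = ∑ z, ν z.1 * ν z.2 * F z := rfl

theorem pairE_mul (ν f g : (V → S) → ℝ) :
    pairE ν (fun z => f z.1 * g z.2) = (∑ x, ν x * f x) * ∑ x, ν x * g x := by
  rw [pairE_apply, Fintype.sum_prod_type, Finset.sum_mul_sum]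
  exact Finset.sum_congr rfl fun x _ => Finset.sum_congr rfl fun y _ => by ring

theorem exists_of_mem_pairSpace {m : ℕ} {F : (V → S) × (V → S) → ℝ} (hF : F ∈ pairSpace V S m) :
    ∃ (n : ℕ) (a b : Fin n → (V → S) → ℝ), (∀ i, a i ∈ affineSpace V S ^ m) ∧
      (∀ i, b i ∈ affineSpace V S ^ m) ∧ F = fun z => ∑ i, a i z.1 * b i z.2 := by
  induction hF using Submodule.mul_induction_on' with
  | mem_mul_mem F hF G hG =>
    obtain ⟨f, hf, rfl⟩ := hF
    obtain ⟨g, hg, rfl⟩ := hG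
    exact ⟨1, fun _ => f, fun _ => g, fun _ => hf, fun _ => hg, by ext z; simp [onFst_apply, onSnd_apply]⟩
  | add F _ G _ hF hG =>
    obtain ⟨n, a, b, ha, hb, rfl⟩ := hF
    obtain ⟨n', a', b', ha', hb', rfl⟩ := hG
    refine ⟨n + n', Fin.append a a', Fin.append b b', fun i => ?_, fun i => ?_, ?_⟩
    · refine Fin.addCases (fun i => ?_) (fun i => ?_) i
      · rw [Fin.append_left]; exact ha i
      · rw [Fin.append_right]; exact ha' i
    · refine Fin.addCases (fun i => ?_) (fun i => ?_) i
      · rw [Fin.append_left]; exact hb i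
      · rw [Fin.append_right]; exact hb' i
    · ext z
      simp [Fin.sum_univ_add]

/-- The quadratic form of this matrix at c is the ν-integral of the square of ∑ c_i a_i, so
positivity on squares is all that is needed although ν is signed. -/
theorem posSemidef_gram {m n : ℕ} {ν : (V → S) → ℝ}
    (hν : ∀ f ∈ affineSpace V S ^ m, 0 ≤ ∑ x, ν x * f x ^ 2)
    (a : Fin n → (V → S) → ℝ) (ha : ∀ i, a i ∈ affineSpace V S ^ m) :
    (Matrix.of fun i j => ∑ x, ν x * (a i x * a j x)).PosSemidef := by
  rw [Matrix.posSemidef_iff_dotProduct_mulVec]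
  refine ⟨?_, fun c => ?_⟩
  · ext i j
    simp [mul_comm (a i _)]
  · refine (hν (∑ i, c i • a i)
      (Submodule.sum_mem _ fun i _ => Submodule.smul_mem _ _ (ha i))).trans_eq ?_
    simp only [dotProduct, Matrix.mulVec, Matrix.of_apply, Finset.sum_apply, Pi.smul_apply,
      smul_eq_mul, sq, Finset.mul_sum, Finset.sum_mul, star_trivial]
    rw [Finset.sum_comm]
    refine Finset.sum_congr rfl fun i _ => ?_
    rw [Finset.sum_comm]
    refine Finset.sum_congr rfl fun j _ => Finset.sum_congr rfl fun x _ => ?_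
    ring

/-- For F = ∑ a_i(x) b_i(x') the integral of F² factors entrywise: it is the sum of all entries of
the Hadamard product of the Gram matrices of the a_i and of the b_i. The Schur product theorem makes
that product positive semidefinite, and the all-ones vector is the test vector. -/
theorem pairE_sq_nonneg {m : ℕ} {ν : (V → S) → ℝ}
    (hν : ∀ f ∈ affineSpace V S ^ m, 0 ≤ ∑ x, ν x * f x ^ 2)
    {F : (V → S) × (V → S) → ℝ} (hF : F ∈ pairSpace V S m) : 0 ≤ pairE ν (F ^ 2) := by
  obtain ⟨n, a, b, ha, hb, rfl⟩ := exists_of_mem_pairSpace hF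
  have h := (Matrix.posSemidef_iff_dotProduct_mulVec.1
    ((posSemidef_gram hν a ha).hadamard (posSemidef_gram hν b hb))).2 1
  refine (show (0 : ℝ) ≤ _ from h).trans_eq ?_
  have h1 : (fun z : (V → S) × (V → S) => ∑ i, a i z.1 * b i z.2) ^ 2 =
      ∑ i, ∑ j, fun z => (a i z.1 * a j z.1) * (b i z.2 * b j z.2) := by
    ext z
    simp only [Pi.pow_apply, sq, Finset.sum_mul_sum, Finset.sum_apply]
    exact Finset.sum_congr rfl fun i _ => Finset.sum_congr rfl fun j _ => by ring
  rw [h1, map_sum]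
  simp only [map_sum]
  simp only [dotProduct, Matrix.mulVec, Matrix.hadamard, Matrix.of_apply, Pi.one_apply, mul_one,
    star_one, one_mul]
  exact Finset.sum_congr rfl fun i _ => Finset.sum_congr rfl fun j _ =>
    (pairE_mul ν (fun x => a i x * a j x) (fun x => b i x * b j x)).symm

variable (V S) in
/-- Sums of squares of functions of degree at most `m` in each of two assignments. -/
def pairCone (m : ℕ) : AddSubmonoid ((V → S) × (V → S) → ℝ) :=
  AddSubmonoid.closure {F | ∃ G ∈ pairSpace V S m, F = G ^ 2}

theorem sq_mem_pairCone {m : ℕ} {G : (V → S) × (V → S) → ℝ} (hG : G ∈ pairSpace V S m) :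
    G ^ 2 ∈ pairCone V S m := AddSubmonoid.subset_closure ⟨G, hG, rfl⟩

theorem pairE_nonneg {m : ℕ} {ν : (V → S) → ℝ}
    (hν : ∀ f ∈ affineSpace V S ^ m, 0 ≤ ∑ x, ν x * f x ^ 2)
    {F : (V → S) × (V → S) → ℝ} (hF : F ∈ pairCone V S m) : 0 ≤ pairE ν F := by
  induction hF using AddSubmonoid.closure_induction with
  | mem F hF =>
    obtain ⟨G, hG, rfl⟩ := hF
    exact pairE_sq_nonneg hν hG
  | zero => simp
  | add F G _ _ hF hG => rw [map_add]; exact add_nonneg hF hG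

theorem pairCone_mono {m n : ℕ} (h : m ≤ n) : pairCone V S m ≤ pairCone V S n :=
  AddSubmonoid.closure_mono fun _ ⟨G, hG, h'⟩ => ⟨G, pairSpace_mono h hG, h'⟩

theorem mul_mem_pairCone {m n : ℕ} {F G : (V → S) × (V → S) → ℝ}
    (hF : F ∈ pairCone V S m) (hG : G ∈ pairCone V S n) : F * G ∈ pairCone V S (m + n) := by
  induction hF using AddSubmonoid.closure_induction with
  | mem F hF =>
    obtain ⟨F, hF, rfl⟩ := hF
    induction hG using AddSubmonoid.closure_induction with
    | mem G hG =>
      obtain ⟨G, hG, rfl⟩ := hG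
      rw [← mul_pow]
      exact sq_mem_pairCone (mul_mem_pairSpace hF hG)
    | zero => rw [mul_zero]; exact zero_mem _
    | add G G' _ _ h h' => rw [mul_add]; exact add_mem h h'
  | zero => rw [zero_mul]; exact zero_mem _
  | add F F' _ _ h h' => rw [add_mul]; exact add_mem h h'

theorem const_mem_pairCone {c : ℝ} (hc : 0 ≤ c) (m : ℕ) :
    (fun _ => c : (V → S) × (V → S) → ℝ) ∈ pairCone V S m := by
  convert sq_mem_pairCone (const_mem_pairSpace (V := V) (S := S) (Real.sqrt c) m) using 1
  ext z
  simp [Real.sq_sqrt hc]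

theorem smul_mem_pairCone {c : ℝ} (hc : 0 ≤ c) {m : ℕ} {F : (V → S) × (V → S) → ℝ}
    (hF : F ∈ pairCone V S m) : c • F ∈ pairCone V S m := by
  have := mul_mem_pairCone (const_mem_pairCone (V := V) (S := S) hc 0) hF
  rw [zero_add] at this
  exact this

/-- Idempotent functions of low degree are squares. -/
theorem mem_pairCone_of_idem {m : ℕ} {F : (V → S) × (V → S) → ℝ} (hF : F ∈ pairSpace V S m)
    (h : ∀ z, F z = 0 ∨ F z = 1) : F ∈ pairCone V S m := by
  convert sq_mem_pairCone hF using 1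
  ext z
  rcases h z with h | h <;> simp [h]

end PairCone

/-! ### Degrees of the squares in a sum of squares -/

section SumOfSquaresDegree

variable {σ : Type*}

theorem homogeneousComponent_sq {p : MvPolynomial σ ℝ} {m : ℕ} (hp : p.totalDegree ≤ m) :
    homogeneousComponent (2 * m) (p ^ 2) = homogeneousComponent m p ^ 2 := by
  have hs : p = ∑ i ∈ Finset.range (m + 1), homogeneousComponent i p := by
    conv_lhs => rw [← sum_homogeneousComponent p]
    refine Finset.sum_subset (Finset.range_mono (by omega)) fun i _ hi => ?_
    exact homogeneousComponent_eq_zero _ _ (by simpa using hi)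
  conv_lhs => rw [hs]
  rw [sq, Finset.sum_mul_sum, map_sum]
  simp only [map_sum]
  have h : ∀ i j, homogeneousComponent (2 * m)
      (homogeneousComponent i p * homogeneousComponent j p) =
      if i + j = 2 * m then homogeneousComponent i p * homogeneousComponent j p else 0 := by
    intro i j
    rw [homogeneousComponent_of_mem (n := i + j)]
    · simp only [eq_comm]
    · exact (homogeneousComponent_isHomogeneous i p).mul (homogeneousComponent_isHomogeneous j p)
  simp only [h]
  rw [Finset.sum_eq_single m, Finset.sum_eq_single m]
  · rw [if_pos (by omega), sq]
  · intro j hj hjm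
    exact if_neg (by have := Finset.mem_range.1 hj; omega)
  · intro hm; simp at hm
  · intro i hi him
    refine Finset.sum_eq_zero fun j hj => if_neg ?_
    have := Finset.mem_range.1 hi
    have := Finset.mem_range.1 hj
    omega
  · intro hm; simp at hm

theorem eq_zero_of_sum_sq_eq_zero (l : List (MvPolynomial σ ℝ))
    (h : (l.map fun q => q ^ 2).sum = 0) : ∀ q ∈ l, q = 0 := by
  intro q hq
  refine MvPolynomial.funext fun x => ?_
  have h1 : (l.map fun q => eval x q ^ 2).sum = 0 := by
    have := congrArg (eval x) h
    rw [map_list_sum, List.map_map, map_zero] at this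
    rw [← this]
    congr 1
    exact List.map_congr_left fun q _ => by simp
  have h2 : ∀ y ∈ l.map fun q => eval x q ^ 2, (0 : ℝ) ≤ y := by
    intro y hy
    obtain ⟨q, -, rfl⟩ := List.mem_map.1 hy
    positivity
  have h3 := List.single_le_sum h2 _ (List.mem_map_of_mem hq)
  rw [h1] at h3
  rw [map_zero]
  exact pow_eq_zero_iff two_ne_zero |>.1 (le_antisymm h3 (sq_nonneg _))

theorem totalDegree_lt_of_homogeneousComponent_eq_zero {p : MvPolynomial σ ℝ} {m : ℕ}
    (hp : p.totalDegree ≤ m + 1) (h : homogeneousComponent (m + 1) p = 0) :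
    p.totalDegree ≤ m := by
  refine Finset.sup_le fun s hs => ?_
  have h1 : s.degree ≤ m + 1 := (le_totalDegree hs).trans hp
  rcases h1.eq_or_lt with h1 | h1
  · have := coeff_homogeneousComponent (m + 1) p s
    rw [h, if_pos h1, coeff_zero] at this
    exact absurd this.symm (mem_support_iff.1 hs)
  · exact Nat.lt_succ_iff.1 h1

/-- Leading forms cannot cancel over ℝ. If all degrees are at most m + j + 1, the component of
degree 2(m + j + 1) of the sum is the sum of the squares of the leading forms. It vanishes, so each
leading form does, and the common bound drops by one. -/
theorem degree_le_of_sum_sq (l : List (MvPolynomial σ ℝ)) (m : ℕ)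
    (h : (l.map fun q => q ^ 2).sum.totalDegree ≤ 2 * m) (j : ℕ) :
    (∀ q ∈ l, q.totalDegree ≤ m + j) → ∀ q ∈ l, q.totalDegree ≤ m := by
  induction j with
  | zero => exact fun h => h
  | succ j ih =>
    intro hl
    refine ih fun q hq => totalDegree_lt_of_homogeneousComponent_eq_zero (hl q hq) ?_
    have h1 := homogeneousComponent_eq_zero (2 * (m + j + 1)) _ (h.trans_lt (by omega))
    rw [map_list_sum, List.map_map] at h1
    refine eq_zero_of_sum_sq_eq_zero (l.map (homogeneousComponent (m + j + 1))) ?_ _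
      (List.mem_map_of_mem hq)
    rw [← h1, List.map_map]
    congr 1
    exact List.map_congr_left fun q hq => (homogeneousComponent_sq (hl q hq)).symm

/-- In a sum of squares of degree at most `2m` every square is that of a polynomial of degree at
most `m`. -/
theorem exists_list_of_isSumSq {s : MvPolynomial σ ℝ} (hs : IsSumSq s) {m : ℕ}
    (hd : s.totalDegree ≤ 2 * m) : ∃ l : List (MvPolynomial σ ℝ),
      (∀ q ∈ l, q.totalDegree ≤ m) ∧ s = (l.map fun q => q ^ 2).sum := by
  have h : ∃ l : List (MvPolynomial σ ℝ), s = (l.map fun q => q ^ 2).sum := by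
    clear hd
    induction hs with
    | zero => exact ⟨[], rfl⟩
    | sq_add a _ ih =>
      obtain ⟨l, rfl⟩ := ih
      exact ⟨a :: l, by simp [sq]⟩
  obtain ⟨l, rfl⟩ := h
  -- The sum of all degrees is a crude common bound from which the descent starts.
  refine ⟨l, degree_le_of_sum_sq l m hd ((l.map totalDegree).sum) fun q hq => ?_, rfl⟩
  exact (List.single_le_sum (by simp) _ (List.mem_map_of_mem hq)).trans (Nat.le_add_left _ _)

end SumOfSquaresDegree

/-! ### Spectral estimates for the normalized Laplacian -/

namespace WeightedGraph

variable {V : Type*} [Fintype V] (G : WeightedGraph V)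

theorem totalWeight_pos [Nonempty V] : 0 < G.totalWeight :=
  Finset.sum_pos (fun u _ => G.deg_pos u) Finset.univ_nonempty

theorem totalWeight_nonneg : 0 ≤ G.totalWeight :=
  Finset.sum_nonneg fun u _ => (G.deg_pos u).le

theorem stat_nonneg (u : V) : 0 ≤ G.stat u := div_nonneg (G.deg_pos u).le G.totalWeight_nonneg

theorem edgeProb_nonneg (u v : V) : 0 ≤ G.edgeProb u v :=
  div_nonneg (G.nonneg u v) G.totalWeight_nonneg

theorem edgeProb_symm (u v : V) : G.edgeProb u v = G.edgeProb v u := by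
  rw [edgeProb, edgeProb, G.symm]

theorem sum_stat [Nonempty V] : ∑ u, G.stat u = 1 := by
  simp only [stat, ← Finset.sum_div]
  exact div_self G.totalWeight_pos.ne'

theorem sum_edgeProb (u : V) : ∑ v, G.edgeProb u v = G.stat u := by
  simp only [edgeProb, stat, ← Finset.sum_div]
  rfl

theorem sum_edgeProb' (v : V) : ∑ u, G.edgeProb u v = G.stat v := by
  rw [← G.sum_edgeProb v]
  exact Finset.sum_congr rfl fun u _ => G.edgeProb_symm u v

theorem stat_mul_transition (u v : V) : G.stat u * G.transition u v = G.edgeProb u v := by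
  have := (G.deg_pos u).ne'
  simp only [stat, transition, edgeProb, Matrix.of_apply]
  change G.deg u ≠ 0 at this
  field_simp

theorem sum_transition (u : V) : ∑ v, G.transition u v = 1 := by
  simp only [transition, Matrix.of_apply, ← Finset.sum_div]
  exact div_self (G.deg_pos u).ne'

theorem transition_nonneg (u v : V) : 0 ≤ G.transition u v :=
  div_nonneg (G.nonneg u v) (G.deg_pos u).le

theorem laplacian_apply (f : V → ℝ) (u : V) :
    G.laplacian f u = f u - ∑ v, G.transition u v * f v := rfl

/-- The inner product of the stationary measure. -/
def statInner : LinearMap.BilinForm ℝ (V → ℝ) :=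
  LinearMap.mk₂ ℝ (fun f g => ∑ u, G.stat u * (f u * g u))
    (fun f f' g => by simp [mul_add, add_mul, Finset.sum_add_distrib])
    (fun c f g => by
      simp only [Pi.smul_apply, smul_eq_mul, Finset.mul_sum]
      exact Finset.sum_congr rfl fun u _ => by ring)
    (fun f g g' => by simp [mul_add, Finset.sum_add_distrib])
    (fun c f g => by
      simp only [Pi.smul_apply, smul_eq_mul, Finset.mul_sum]
      exact Finset.sum_congr rfl fun u _ => by ring)

theorem statInner_apply (f g : V → ℝ) : G.statInner f g = ∑ u, G.stat u * (f u * g u) := rfl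

theorem statInner_comm (f g : V → ℝ) : G.statInner f g = G.statInner g f := by
  simp only [statInner_apply, mul_comm (f _)]

theorem statInner_self_nonneg (f : V → ℝ) : 0 ≤ G.statInner f f :=
  Finset.sum_nonneg fun u _ => mul_nonneg (G.stat_nonneg u) (mul_self_nonneg _)

theorem statInner_laplacian (f g : V → ℝ) : G.statInner f (G.laplacian g) =
    G.statInner f g - ∑ u, ∑ v, G.edgeProb u v * (f u * g v) := by
  simp only [statInner_apply, laplacian_apply, mul_sub, Finset.sum_sub_distrib, Finset.mul_sum]
  congr 1
  refine Finset.sum_congr rfl fun u _ => Finset.sum_congr rfl fun v _ => ?_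
  rw [← stat_mul_transition]; ring

theorem statInner_laplacian_comm (f g : V → ℝ) :
    G.statInner f (G.laplacian g) = G.statInner (G.laplacian f) g := by
  rw [G.statInner_comm (G.laplacian f), statInner_laplacian, statInner_laplacian,
    G.statInner_comm g f, Finset.sum_comm]
  congr 1
  refine Finset.sum_congr rfl fun u _ => Finset.sum_congr rfl fun v _ => ?_
  rw [G.edgeProb_symm]; ring

theorem statInner_laplacian_nonneg (f : V → ℝ) : 0 ≤ G.statInner f (G.laplacian f) := by
  have h : 2 * G.statInner f (G.laplacian f) =
      ∑ u, ∑ v, G.edgeProb u v * (f u - f v) ^ 2 := by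
    have h1 : ∀ u v, G.edgeProb u v * (f u - f v) ^ 2 = G.edgeProb u v * (f u * f u) +
        G.edgeProb u v * (f v * f v) - 2 * (G.edgeProb u v * (f u * f v)) := fun u v => by ring
    simp only [h1, Finset.sum_sub_distrib, Finset.sum_add_distrib]
    rw [Finset.sum_comm (f := fun u v => G.edgeProb u v * (f v * f v))]
    simp only [← Finset.sum_mul, sum_edgeProb, sum_edgeProb', ← Finset.mul_sum]
    rw [statInner_laplacian, statInner_apply]; ring
  have : 0 ≤ ∑ u, ∑ v, G.edgeProb u v * (f u - f v) ^ 2 :=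
    Finset.sum_nonneg fun u _ => Finset.sum_nonneg fun v _ =>
      mul_nonneg (G.edgeProb_nonneg u v) (sq_nonneg _)
  linarith

theorem statInner_eigenspace {μ μ' : ℝ} (h : μ ≠ μ') {f g : V → ℝ}
    (hf : f ∈ Module.End.eigenspace G.laplacian μ)
    (hg : g ∈ Module.End.eigenspace G.laplacian μ') : G.statInner f g = 0 := by
  rw [Module.End.mem_eigenspace_iff] at hf hg
  have h1 := G.statInner_laplacian_comm f g
  rw [hf, hg, map_smul, map_smul, LinearMap.smul_apply, smul_eq_mul, smul_eq_mul] at h1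
  have h2 : (μ - μ') * G.statInner f g = 0 := by linarith
  exact (mul_eq_zero.1 h2).resolve_left (sub_ne_zero.2 h)

variable (lam : ℝ)

theorem statInner_low_high {f g : V → ℝ} (hf : f ∈ G.lowSpace lam) (hg : g ∈ G.highSpace lam) :
    G.statInner f g = 0 := by
  have h1 : G.lowSpace lam ≤ LinearMap.ker (G.statInner g) := by
    refine iSup₂_le fun μ hμ f hf => ?_
    have h2 : G.highSpace lam ≤ LinearMap.ker (G.statInner f) :=
      iSup₂_le fun μ' hμ' g hg =>
        G.statInner_eigenspace (ne_of_lt (lt_of_le_of_lt hμ hμ')) hf hg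
    rw [LinearMap.mem_ker, statInner_comm]
    exact h2 hg
  rw [statInner_comm]
  exact h1 hf

theorem laplacian_mem_highSpace {f : V → ℝ} (hf : f ∈ G.highSpace lam) :
    G.laplacian f ∈ G.highSpace lam := by
  have h : G.highSpace lam ≤ (G.highSpace lam).comap G.laplacian := by
    refine iSup₂_le fun μ hμ f hf => ?_
    rw [Submodule.mem_comap, Module.End.mem_eigenspace_iff.1 hf]
    exact Submodule.smul_mem _ _
      ((le_iSup₂_of_le (f := fun μ (_ : μ ∈ Set.Ioi lam) =>
        Module.End.eigenspace G.laplacian μ) μ hμ le_rfl) hf)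
  exact h hf

/-- Eigenvectors of distinct eigenvalues are orthogonal for the stationary measure, so both forms
are diagonal in the eigenvector decomposition of f and compare term by term. -/
theorem le_statInner_laplacian_of_mem_highSpace {f : V → ℝ} (hf : f ∈ G.highSpace lam) :
    lam * G.statInner f f ≤ G.statInner f (G.laplacian f) := by
  obtain ⟨c, hc, rfl⟩ := (Submodule.mem_iSup_iff_exists_finsupp _ _).1 hf
  have hc1 : ∀ μ, c μ ∈ Module.End.eigenspace G.laplacian μ := by
    intro μ
    have := hc μ
    by_cases h : μ ∈ Set.Ioi lam
    · simpa [h] using this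
    · simp only [h, iSup_false, Submodule.mem_bot] at this
      rw [this]; exact zero_mem _
  have hc2 : ∀ μ, G.laplacian (c μ) = μ • c μ := fun μ => Module.End.mem_eigenspace_iff.1 (hc1 μ)
  have hc3 : ∀ μ ∈ c.support, lam ≤ μ := by
    intro μ hμ
    by_contra h
    have := hc μ
    have h' : μ ∉ Set.Ioi lam := fun h' => h (le_of_lt h')
    simp only [h', iSup_false, Submodule.mem_bot] at this
    exact Finsupp.mem_support_iff.1 hμ this
  have horth : ∀ μ ∈ c.support, ∀ μ' ∈ c.support, μ' ≠ μ → G.statInner (c μ) (c μ') = 0 :=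
    fun μ _ μ' _ h => G.statInner_eigenspace h.symm (hc1 μ) (hc1 μ')
  simp only [Finsupp.sum, map_sum, LinearMap.sum_apply, hc2, map_smul, smul_eq_mul]
  rw [Finset.mul_sum]
  simp only [Finset.mul_sum]
  rw [Finset.sum_comm]
  conv_rhs => rw [Finset.sum_comm]
  refine Finset.sum_le_sum fun μ hμ => Finset.sum_le_sum fun μ' hμ' => ?_
  by_cases h : μ' = μ
  · rw [h]
    exact mul_le_mul_of_nonneg_right (hc3 μ hμ) (G.statInner_self_nonneg _)
  · rw [horth μ hμ μ' hμ' h]; simp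

/-- The projection to the low eigenspaces loses at most the Dirichlet form divided by `lam`. -/
theorem lowProj_form_nonneg (hlam : 0 < lam) (f : V → ℝ) :
    0 ≤ G.statInner f (G.lowProj lam f) - G.statInner f f +
      lam⁻¹ * G.statInner f (G.laplacian f) := by
  set l := G.lowProj lam f with hl
  have hlm : l ∈ G.lowSpace lam := Submodule.projection_apply_mem _ _
  have hhm : f - l ∈ G.highSpace lam := by
    rw [← Submodule.projection_apply_eq_zero_iff (G.isCompl_low_high lam), map_sub, hl, lowProj,
      Submodule.projection_apply_of_mem_left _ (Submodule.projection_apply_mem _ _), sub_self]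
  set h := f - l with hh
  have hf : f = l + h := by rw [hh]; abel
  have h1 := G.statInner_low_high lam hlm hhm
  have h1' : G.statInner h l = 0 := by rw [statInner_comm]; exact h1
  have h2 := G.statInner_low_high lam hlm (G.laplacian_mem_highSpace lam hhm)
  have h3 : G.statInner h (G.laplacian l) = 0 := by
    rw [statInner_laplacian_comm, statInner_comm]; exact h2
  have h4 := G.le_statInner_laplacian_of_mem_highSpace lam hhm
  have h5 := G.statInner_laplacian_nonneg l
  -- For f = l + h with l low and h high all cross terms vanish, and the form becomes -⟨h,h⟩ +
  -- λ⁻¹⟨l,Ll⟩ + λ⁻¹⟨h,Lh⟩.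
  rw [hf]
  simp only [map_add, LinearMap.add_apply, h1, h1', h2, h3]
  have h6 : G.statInner h h ≤ lam⁻¹ * G.statInner h (G.laplacian h) := by
    rw [inv_mul_eq_div, le_div_iff₀ hlam, mul_comm]; exact h4
  have h7 : 0 ≤ lam⁻¹ * G.statInner l (G.laplacian l) := by positivity
  linarith

theorem lowProj_const (hlam : 0 < lam) : G.lowProj lam 1 = 1 := by
  refine Submodule.projection_apply_of_mem_left _ ?_
  refine (le_iSup₂_of_le (f := fun μ (_ : μ ∈ Set.Iic lam) =>
    Module.End.eigenspace G.laplacian μ) 0 hlam.le le_rfl) ?_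
  rw [Module.End.mem_eigenspace_iff, zero_smul]
  ext u
  rw [laplacian_apply]
  simp [sum_transition]

end WeightedGraph

/-- Nonnegative quadratic forms are sums of squares of linear forms. -/
theorem exists_sum_sq_of_bilin_nonneg {V : Type*} [Fintype V] [DecidableEq V]
    (B : LinearMap.BilinForm ℝ (V → ℝ)) (h : ∀ f, 0 ≤ B f f) :
    ∃ (m : ℕ) (b : Fin m → V → ℝ), ∀ f, B f f = ∑ i, (∑ u, b i u * f u) ^ 2 := by
  -- B need not be symmetric, but its quadratic form only sees the symmetric part, whose matrix is a
  -- sum of rank-one squares.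
  let M : Matrix V V ℝ := Matrix.of fun u v =>
    (B (Pi.single u 1) (Pi.single v 1) + B (Pi.single v 1) (Pi.single u 1)) / 2
  have hB : ∀ f, B f f = ∑ u, ∑ v, f u * f v * B (Pi.single u 1) (Pi.single v 1) := by
    intro f
    have hf : f = ∑ u, f u • (Pi.single u 1 : V → ℝ) := by
      ext v
      simp [Finset.sum_apply, Pi.single_apply]
    conv_lhs => rw [hf]
    simp only [map_sum, LinearMap.sum_apply, map_smul, LinearMap.smul_apply, smul_eq_mul]
    simp only [Finset.mul_sum]
    rw [Finset.sum_comm]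
    refine Finset.sum_congr rfl fun u _ => Finset.sum_congr rfl fun v _ => ?_
    ring
  have hM : ∀ f, ∑ u, ∑ v, f u * f v * M u v = B f f := by
    intro f
    have h1 : ∀ u v, f u * f v * M u v = (f u * f v * B (Pi.single u 1) (Pi.single v 1)) / 2 +
        (f v * f u * B (Pi.single v 1) (Pi.single u 1)) / 2 := fun u v => by
      simp only [M, Matrix.of_apply]; ring
    simp only [h1, Finset.sum_add_distrib, ← Finset.sum_div]
    rw [Finset.sum_comm (f := fun u v => f v * f u * B (Pi.single v 1) (Pi.single u 1)), ← hB]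
    ring
  have hpos : M.PosSemidef := by
    rw [Matrix.posSemidef_iff_dotProduct_mulVec]
    refine ⟨?_, fun f => ?_⟩
    · ext u v
      simp [M, add_comm]
    · refine (h f).trans_eq ?_
      rw [← hM]
      simp only [dotProduct, Matrix.mulVec, Finset.mul_sum, star_trivial, Pi.star_apply]
      exact Finset.sum_congr rfl fun u _ => Finset.sum_congr rfl fun v _ => by ring
  obtain ⟨m, b, hb⟩ := Matrix.posSemidef_iff_eq_sum_vecMulVec.1 hpos
  refine ⟨m, b, fun f => ?_⟩
  have h1 : ∀ i, (∑ u, b i u * f u) ^ 2 = ∑ u, ∑ v, f u * f v * (b i u * b i v) := fun i => by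
    rw [sq, Finset.sum_mul_sum]
    exact Finset.sum_congr rfl fun u _ => Finset.sum_congr rfl fun v _ => by ring
  rw [← hM, hb]
  simp only [h1, Matrix.sum_apply, Matrix.vecMulVec_apply, Finset.mul_sum,
    star_trivial]
  conv_rhs => rw [Finset.sum_comm]
  refine Finset.sum_congr rfl fun u _ => ?_
  conv_rhs => rw [Finset.sum_comm]

/-! ### Calculus of functions of a pair of assignments -/

section PairFunctions

variable {V S : Type*} [Fintype V] [DecidableEq V] [Fintype S] [DecidableEq S]

theorem sum_smul_mem_pairSpace {ι : Type*} (s : Finset ι) (c : ι → ℝ) {m : ℕ}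
    {F : ι → (V → S) × (V → S) → ℝ} (hF : ∀ i ∈ s, F i ∈ pairSpace V S m) :
    (fun z => ∑ i ∈ s, c i * F i z) ∈ pairSpace V S m := by
  convert (pairSpace V S m).sum_mem fun i hi => (pairSpace V S m).smul_mem (c i) (hF i hi) using 1
  ext z
  simp [Finset.sum_apply]

theorem sum_mem_pairSpace {ι : Type*} (s : Finset ι) {m : ℕ}
    {F : ι → (V → S) × (V → S) → ℝ} (hF : ∀ i ∈ s, F i ∈ pairSpace V S m) :
    (fun z => ∑ i ∈ s, F i z) ∈ pairSpace V S m := by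
  simpa using sum_smul_mem_pairSpace s (fun _ => 1) hF

theorem sum_smul_mem_pairCone {ι : Type*} (s : Finset ι) {c : ι → ℝ} {m : ℕ}
    {F : ι → (V → S) × (V → S) → ℝ} (hc : ∀ i ∈ s, 0 ≤ c i)
    (hF : ∀ i ∈ s, F i ∈ pairCone V S m) :
    (fun z => ∑ i ∈ s, c i * F i z) ∈ pairCone V S m := by
  convert (pairCone V S m).sum_mem fun i hi => smul_mem_pairCone (hc i hi) (hF i hi) using 1
  ext z
  simp [Finset.sum_apply]

theorem sum_mem_pairCone {ι : Type*} (s : Finset ι) {m : ℕ}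
    {F : ι → (V → S) × (V → S) → ℝ} (hF : ∀ i ∈ s, F i ∈ pairCone V S m) :
    (fun z => ∑ i ∈ s, F i z) ∈ pairCone V S m := by
  simpa using sum_smul_mem_pairCone s (c := fun _ => 1) (fun _ _ => zero_le_one) hF

theorem mem_pairCone_congr {m : ℕ} {F G : (V → S) × (V → S) → ℝ} (hG : G ∈ pairCone V S m)
    (h : ∀ z, F z = G z) : F ∈ pairCone V S m := by
  rwa [funext h]

/-- Functions which are provably between `0` and `1`. -/
def IsUnitValued (m : ℕ) (F : (V → S) × (V → S) → ℝ) : Prop :=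
  F ∈ pairCone V S m ∧ 1 - F ∈ pairCone V S m

theorem mul_mem_pairSpace_of_le {m n k : ℕ} {F G : (V → S) × (V → S) → ℝ}
    (hF : F ∈ pairSpace V S m) (hG : G ∈ pairSpace V S n) (hk : m + n ≤ k) :
    (fun z => F z * G z) ∈ pairSpace V S k :=
  pairSpace_mono hk (mul_mem_pairSpace hF hG)

theorem mul_mem_pairCone_of_le {m n k : ℕ} {F G : (V → S) × (V → S) → ℝ}
    (hF : F ∈ pairCone V S m) (hG : G ∈ pairCone V S n) (hk : m + n ≤ k) :
    (fun z => F z * G z) ∈ pairCone V S k :=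
  pairCone_mono hk (mul_mem_pairCone hF hG)

theorem IsUnitValued.mul {m n k : ℕ} {F G : (V → S) × (V → S) → ℝ} (hF : IsUnitValued m F)
    (hG : IsUnitValued n G) (hk : m + n ≤ k) : IsUnitValued k fun z => F z * G z := by
  suffices h : IsUnitValued (m + n) (F * G) from
    ⟨pairCone_mono hk h.1, pairCone_mono hk h.2⟩
  refine ⟨mul_mem_pairCone hF.1 hG.1, ?_⟩
  have : 1 - F * G = (1 - F) + F * (1 - G) := by ring
  rw [this]
  exact add_mem (pairCone_mono (by omega) hF.2) (mul_mem_pairCone hF.1 hG.2)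

theorem isUnitValued_of_idem {m : ℕ} {F : (V → S) × (V → S) → ℝ} (hF : F ∈ pairSpace V S m)
    (h : ∀ z, F z = 0 ∨ F z = 1) : IsUnitValued m F := by
  refine ⟨mem_pairCone_of_idem hF h, mem_pairCone_of_idem
    (Submodule.sub_mem _ (one_mem_pairSpace m) hF) fun z => ?_⟩
  rcases h z with h | h <;> simp [h]

theorem IsUnitValued.sum {ι : Type*} [Fintype ι] {c : ι → ℝ} {m : ℕ}
    {F : ι → (V → S) × (V → S) → ℝ} (hc : ∀ i, 0 ≤ c i) (hc1 : ∑ i, c i = 1)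
    (hF : ∀ i, IsUnitValued m (F i)) : IsUnitValued m (fun z => ∑ i, c i * F i z) := by
  refine ⟨sum_smul_mem_pairCone _ (fun i _ => hc i) fun i _ => (hF i).1, ?_⟩
  refine mem_pairCone_congr
    (sum_smul_mem_pairCone Finset.univ (fun i _ => hc i) fun i _ => (hF i).2) fun z => ?_
  simp [mul_sub, Finset.sum_sub_distrib, hc1]

theorem pow_mem_pairSpace {m : ℕ} {F : (V → S) × (V → S) → ℝ} (hF : F ∈ pairSpace V S m) (n : ℕ) :
    F ^ n ∈ pairSpace V S (m * n) := by
  induction n with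
  | zero => exact one_mem_pairSpace _
  | succ n ih => rw [pow_succ, mul_add, mul_one]; exact mul_mem_pairSpace ih hF

theorem eval_mem_pairSpace {ι : Type*} {m n : ℕ} {F : ι → (V → S) × (V → S) → ℝ}
    (hF : ∀ i, F i ∈ pairSpace V S m) (q : MvPolynomial ι ℝ) (hq : q.totalDegree ≤ n) :
    (fun z => eval (fun i => F i z) q) ∈ pairSpace V S (m * n) := by
  simp only [eval_eq]
  refine sum_smul_mem_pairSpace (F := fun s z => ∏ i ∈ s.support, F i z ^ s i) q.support _ ?_
  intro s hs
  have h : ∀ T : Finset ι, (fun z => ∏ i ∈ T, F i z ^ s i) ∈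
      pairSpace V S (m * ∑ i ∈ T, s i) := by
    classical
    intro T
    induction T using Finset.induction_on with
    | empty => simpa using const_mem_pairSpace 1 0
    | insert i T hi ih =>
      simp only [Finset.prod_insert hi, Finset.sum_insert hi, mul_add]
      exact mul_mem_pairSpace (pow_mem_pairSpace (hF i) (s i)) ih
  exact pairSpace_mono (Nat.mul_le_mul_left m ((le_totalDegree hs).trans hq)) (h s.support)

theorem pairE_mono {m : ℕ} {ν : (V → S) → ℝ}
    (hν : ∀ f ∈ affineSpace V S ^ m, 0 ≤ ∑ x, ν x * f x ^ 2)
    {F G : (V → S) × (V → S) → ℝ} (h : G - F ∈ pairCone V S m) : pairE ν F ≤ pairE ν G := by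
  have := pairE_nonneg hν h
  rw [map_sub] at this
  linarith

end PairFunctions

/-! ### The shift partition of two assignments -/

section Correlation

variable {V S : Type*} [Fintype V] [DecidableEq V] [Fintype S] [DecidableEq S] [AddCommGroup S]
  {G : WeightedGraph V}

/-- Indicator of the two assignments differing by `s` at `u`. -/
def shiftInd (s : S) (u : V) (z : (V → S) × (V → S)) : ℝ := if z.2 u - z.1 u = s then 1 else 0

/-- Indicator of the two assignments differing by the same shift at `u` and `v`. -/
def agree (u v : V) (z : (V → S) × (V → S)) : ℝ :=
  if z.2 u - z.1 u = z.2 v - z.1 v then 1 else 0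

/-- Indicator of a constraint being satisfied by an assignment. -/
def Instance.sat (I : Instance G S) (u v : V) (x : V → S) : ℝ :=
  if I.perm u v (x u) = x v then 1 else 0

/-- The fraction of the constraints at `v` which the second assignment satisfies. -/
def Instance.localValue (I : Instance G S) (v : V) (z : (V → S) × (V → S)) : ℝ :=
  ∑ w, G.transition v w * I.sat v w z.2

/-- The part of the shift partition with shift `s`, weighted by the local value. -/
def Instance.part (I : Instance G S) (s : S) (v : V) (z : (V → S) × (V → S)) : ℝ :=
  shiftInd s v z * I.localValue v z

theorem shiftInd_mem_pairSpace (s : S) (u : V) :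
    (shiftInd s u : (V → S) × (V → S) → ℝ) ∈ pairSpace V S 2 := by
  have : (shiftInd s u : (V → S) × (V → S) → ℝ) = fun z => ∑ a : S,
      (if z.1 u = a then (1 : ℝ) else 0) * (if z.2 u = a + s then (1 : ℝ) else 0) := by
    ext z
    rw [Fintype.sum_eq_single (z.1 u) fun a ha => by rw [if_neg (Ne.symm ha), zero_mul]]
    simp [shiftInd, sub_eq_iff_eq_add, add_comm]
  rw [this]
  exact sum_mem_pairSpace _ fun a _ =>
    mul_mem_pairSpace_of_le (fst_mem_pairSpace u a) (snd_mem_pairSpace u (a + s)) le_rfl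

theorem isUnitValued_shiftInd (s : S) (u : V) :
    IsUnitValued 2 (shiftInd s u : (V → S) × (V → S) → ℝ) :=
  isUnitValued_of_idem (shiftInd_mem_pairSpace s u) fun z => by
    unfold shiftInd; split_ifs <;> simp

theorem agree_eq (u v : V) (z : (V → S) × (V → S)) :
    agree u v z = ∑ s, shiftInd s u z * shiftInd s v z := by
  simp [agree, shiftInd, eq_comm]

theorem agree_mem_pairSpace (u v : V) :
    (agree u v : (V → S) × (V → S) → ℝ) ∈ pairSpace V S 4 := by
  rw [funext (agree_eq u v)]
  exact sum_mem_pairSpace _ fun s _ =>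
    mul_mem_pairSpace_of_le (shiftInd_mem_pairSpace s u) (shiftInd_mem_pairSpace s v) le_rfl

theorem isUnitValued_agree (u v : V) : IsUnitValued 4 (agree u v : (V → S) × (V → S) → ℝ) :=
  isUnitValued_of_idem (agree_mem_pairSpace u v) fun z => by
    unfold agree; split_ifs <;> simp

variable (I : Instance G S)

theorem Instance.sat_eq_zero_or_one (u v : V) (x : V → S) : I.sat u v x = 0 ∨ I.sat u v x = 1 := by
  unfold Instance.sat; split_ifs <;> simp

theorem Instance.sat_fst_mem_pairSpace (u v : V) :
    (fun z : (V → S) × (V → S) => I.sat u v z.1) ∈ pairSpace V S 2 := by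
  have : (fun z : (V → S) × (V → S) => I.sat u v z.1) = fun z => ∑ a : S,
      (if z.1 u = a then (1 : ℝ) else 0) * (if z.1 v = I.perm u v a then (1 : ℝ) else 0) := by
    ext z
    rw [Fintype.sum_eq_single (z.1 u) fun a ha => by rw [if_neg (Ne.symm ha), zero_mul]]
    simp [Instance.sat, eq_comm]
  rw [this]
  exact sum_mem_pairSpace _ fun a _ =>
    mul_mem_pairSpace_of_le (fst_mem_pairSpace u a) (fst_mem_pairSpace v _) le_rfl

theorem Instance.sat_snd_mem_pairSpace (u v : V) :
    (fun z : (V → S) × (V → S) => I.sat u v z.2) ∈ pairSpace V S 2 := by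
  have : (fun z : (V → S) × (V → S) => I.sat u v z.2) = fun z => ∑ a : S,
      (if z.2 u = a then (1 : ℝ) else 0) * (if z.2 v = I.perm u v a then (1 : ℝ) else 0) := by
    ext z
    rw [Fintype.sum_eq_single (z.2 u) fun a ha => by rw [if_neg (Ne.symm ha), zero_mul]]
    simp [Instance.sat, eq_comm]
  rw [this]
  exact sum_mem_pairSpace _ fun a _ =>
    mul_mem_pairSpace_of_le (snd_mem_pairSpace u a) (snd_mem_pairSpace v _) le_rfl

theorem Instance.isUnitValued_sat_fst (u v : V) :
    IsUnitValued 2 fun z : (V → S) × (V → S) => I.sat u v z.1 :=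
  isUnitValued_of_idem (I.sat_fst_mem_pairSpace u v) fun _ => I.sat_eq_zero_or_one u v _

theorem Instance.isUnitValued_sat_snd (u v : V) :
    IsUnitValued 2 fun z : (V → S) × (V → S) => I.sat u v z.2 :=
  isUnitValued_of_idem (I.sat_snd_mem_pairSpace u v) fun _ => I.sat_eq_zero_or_one u v _

theorem Instance.localValue_mem_pairSpace (v : V) : I.localValue v ∈ pairSpace V S 2 :=
  sum_smul_mem_pairSpace _ _ fun w _ => I.sat_snd_mem_pairSpace v w

theorem Instance.isUnitValued_localValue (v : V) : IsUnitValued 2 (I.localValue v) :=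
  IsUnitValued.sum (G.transition_nonneg v) (G.sum_transition v) fun w => I.isUnitValued_sat_snd v w

theorem Instance.part_mem_pairSpace (s : S) (v : V) : I.part s v ∈ pairSpace V S 4 :=
  mul_mem_pairSpace_of_le (shiftInd_mem_pairSpace s v) (I.localValue_mem_pairSpace v) le_rfl

theorem Instance.isUnitValued_part (s : S) (v : V) : IsUnitValued 4 (I.part s v) :=
  (isUnitValued_shiftInd s v).mul (I.isUnitValued_localValue v) le_rfl

theorem Instance.sum_part_mul_part (u v : V) (z : (V → S) × (V → S)) :
    ∑ s, I.part s u z * I.part s v z = agree u v z * (I.localValue u z * I.localValue v z) := by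
  rw [agree_eq, Finset.sum_mul]
  exact Finset.sum_congr rfl fun s _ => by simp only [Instance.part]; ring

theorem agree_self (u : V) (z : (V → S) × (V → S)) : agree u u z = 1 := by simp [agree]

theorem Instance.sum_part (v : V) (z : (V → S) × (V → S)) :
    ∑ s, I.part s v z = I.localValue v z := by
  simp only [Instance.part, ← Finset.sum_mul]
  simp [shiftInd]

theorem Instance.sum_part_sq_mul_part_sq (u v : V) (z : (V → S) × (V → S)) :
    ∑ s, I.part s u z ^ 2 * I.part s v z ^ 2 =
      agree u v z * (I.localValue u z ^ 2 * I.localValue v z ^ 2) := by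
  rw [agree_eq, Finset.sum_mul]
  refine Finset.sum_congr rfl fun s _ => ?_
  simp only [Instance.part, shiftInd]
  split_ifs <;> simp

theorem Instance.value_eq (x : V → S) :
    I.value x = ∑ u, ∑ v, G.edgeProb u v * I.sat u v x := rfl

theorem Instance.sum_stat_localValue (z : (V → S) × (V → S)) :
    ∑ v, G.stat v * I.localValue v z = I.value z.2 := by
  simp only [Instance.localValue, Finset.mul_sum, ← mul_assoc, G.stat_mul_transition]
  rfl

/-- This is where affineness enters: if both assignments satisfy x_u - x_v = a, subtraction cancels
a and the shifts at u and v coincide. The difference is then 0/1-valued, hence its own square. -/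
theorem Instance.agree_sub_mem_pairCone (hI : I.IsAffine) {u v : V} (h : 0 < G.w u v) :
    (agree u v - fun z => I.sat u v z.1 * I.sat u v z.2 :
      (V → S) × (V → S) → ℝ) ∈ pairCone V S 4 := by
  obtain ⟨a, ha⟩ := hI
  refine mem_pairCone_of_idem (Submodule.sub_mem _ (agree_mem_pairSpace u v)
    (mul_mem_pairSpace_of_le (I.sat_fst_mem_pairSpace u v) (I.sat_snd_mem_pairSpace u v) le_rfl)) fun z => ?_
  by_cases h12 : z.1 u - a u v = z.1 v ∧ z.2 u - a u v = z.2 v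
  · have h3 : agree u v z = 1 := by
      rw [agree, if_pos]
      rw [← h12.1, ← h12.2]; abel
    simp [Instance.sat, ha u v h, h12, h3]
  · have h3 : I.sat u v z.1 * I.sat u v z.2 = 0 := by
      simp only [Instance.sat, ha u v h]
      by_cases h1 : z.1 u - a u v = z.1 v
      · rw [if_neg (fun h2 => h12 ⟨h1, h2⟩), mul_zero]
      · rw [if_neg h1, zero_mul]
    simp only [Pi.sub_apply, h3, sub_zero, agree]
    split_ifs <;> simp

end Correlation

/-! ### Certificates evaluated on functions of a pair -/

section Hypercontractive

variable {V S : Type*} [Fintype V] [DecidableEq V] [Fintype S] [DecidableEq S]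
  {G : WeightedGraph V}

theorem eval_formOf (P : (V → ℝ) →ₗ[ℝ] (V → ℝ)) (v : V) (f : V → ℝ) :
    eval f (formOf P v) = P f v := by
  have hf : f = ∑ u, f u • (Pi.single u 1 : V → ℝ) := by
    ext v
    simp [Finset.sum_apply, Pi.single_apply]
  conv_rhs => rw [hf]
  simp [formOf, map_sum, Finset.sum_apply, mul_comm]

theorem totalDegree_formOf_le (P : (V → ℝ) →ₗ[ℝ] (V → ℝ)) (v : V) :
    (formOf P v).totalDegree ≤ 1 :=
  totalDegree_finsetSum_le fun u _ => (totalDegree_mul _ _).trans (by simp)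

/-- The certificate of hypercontractivity, as an identity between functions: it consists of squares
of quadratic polynomials. -/
theorem CertHypercontractive.exists_list {lam C : ℝ} {D : ℕ}
    (h : CertHypercontractive G lam C D) : ∃ l : List (MvPolynomial V ℝ),
      (∀ q ∈ l, q.totalDegree ≤ 2) ∧ ∀ f : V → ℝ,
        C * (∑ v, G.stat v * f v ^ 2) ^ 2 =
          ∑ v, G.stat v * G.lowProj lam f v ^ 4 + (l.map fun q => eval f q ^ 2).sum := by
  obtain ⟨s, hs, -, hCs⟩ := h
  -- The certificate equals a difference of two polynomials of degree at most 4, so its squares are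
  -- those of quadratics.
  have hd : s.totalDegree ≤ 2 * 2 := by
    rw [eq_comm, ← eq_sub_iff_add_eq'] at hCs
    rw [hCs]
    refine (totalDegree_sub _ _).trans (max_le ?_ ?_)
    · refine (totalDegree_mul _ _).trans ?_
      rw [totalDegree_C, zero_add]
      refine (totalDegree_pow _ _).trans (Nat.mul_le_mul_left 2 ?_)
      refine totalDegree_finsetSum_le fun v _ => (totalDegree_mul _ _).trans ?_
      simp
    · refine totalDegree_finsetSum_le fun v _ => (totalDegree_mul _ _).trans ?_
      rw [totalDegree_C, zero_add]
      exact (totalDegree_pow _ _).trans (by have := totalDegree_formOf_le (G.lowProj lam) v; omega)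
  obtain ⟨l, hl, rfl⟩ := exists_list_of_isSumSq hs hd
  refine ⟨l, hl, fun f => ?_⟩
  have := congrArg (eval f) hCs
  simp only [map_mul, map_add, map_pow, map_sum, eval_C, eval_X, eval_formOf, map_list_sum,
    List.map_map] at this
  rw [this]
  congr 2
  exact List.map_congr_left fun q _ => by simp

/-- The projection fixes constants, which have eigenvalue 0, so at f = 1 the certificate reads C = 1
+ (squares). -/
theorem CertHypercontractive.one_le [Nonempty V] {lam C : ℝ} {D : ℕ} (hlam : 0 < lam)
    (h : CertHypercontractive G lam C D) : 1 ≤ C := by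
  obtain ⟨l, -, hl⟩ := h.exists_list
  have h1 := hl 1
  rw [G.lowProj_const lam hlam] at h1
  simp only [Pi.one_apply, one_pow, mul_one, G.sum_stat] at h1
  have : 0 ≤ (l.map fun q => eval (1 : V → ℝ) q ^ 2).sum := by
    refine List.sum_nonneg fun y hy => ?_
    obtain ⟨q, -, rfl⟩ := List.mem_map.1 hy
    positivity
  linarith

theorem linearMap_apply_mem_pairSpace {m : ℕ} {F : V → (V → S) × (V → S) → ℝ}
    (hF : ∀ v, F v ∈ pairSpace V S m) (P : (V → ℝ) →ₗ[ℝ] (V → ℝ)) (v : V) :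
    (fun z => P (fun u => F u z) v) ∈ pairSpace V S m := by
  simp only [← eval_formOf]
  simpa using eval_mem_pairSpace hF (formOf P v) (totalDegree_formOf_le P v)

theorem CertHypercontractive.mem_pairCone {lam C : ℝ} {D : ℕ}
    (h : CertHypercontractive G lam C D) {m : ℕ} {F : V → (V → S) × (V → S) → ℝ}
    (hF : ∀ v, F v ∈ pairSpace V S m) :
    (fun z => C * (∑ v, G.stat v * F v z ^ 2) ^ 2 -
      ∑ v, G.stat v * G.lowProj lam (fun u => F u z) v ^ 4) ∈ pairCone V S (m * 2) := by
  obtain ⟨l, hl, hf⟩ := h.exists_list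
  refine mem_pairCone_congr (G := fun z => (l.map fun q => eval (fun u => F u z) q ^ 2).sum) ?_
    fun z => by rw [hf fun u => F u z]; ring
  clear hf
  induction l with
  | nil => simpa using const_mem_pairCone le_rfl _
  | cons q l ih =>
    simp only [List.map_cons, List.sum_cons]
    refine add_mem (sq_mem_pairCone (eval_mem_pairSpace hF q (hl q (by simp)))) ?_
    exact ih fun q hq => hl q (by simp [hq])

/-- The form of `lowProj_form_nonneg` as a sum of squares. -/
theorem lowProj_form_mem_pairCone {lam : ℝ} (hlam : 0 < lam) {m : ℕ}
    {F : V → (V → S) × (V → S) → ℝ} (hF : ∀ v, F v ∈ pairSpace V S m) :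
    (fun z => G.statInner (fun u => F u z) (G.lowProj lam fun u => F u z) -
      G.statInner (fun u => F u z) (fun u => F u z) +
      lam⁻¹ * G.statInner (fun u => F u z) (G.laplacian fun u => F u z)) ∈ pairCone V S m := by
  let B : LinearMap.BilinForm ℝ (V → ℝ) :=
    G.statInner.compl₂ (G.lowProj lam) - G.statInner + lam⁻¹ • G.statInner.compl₂ G.laplacian
  have hB : ∀ f, B f f = G.statInner f (G.lowProj lam f) - G.statInner f f +
      lam⁻¹ * G.statInner f (G.laplacian f) := fun f => rfl
  obtain ⟨k, b, hb⟩ := exists_sum_sq_of_bilin_nonneg B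
    fun f => (G.lowProj_form_nonneg lam hlam f).trans_eq (hB f).symm
  simp only [← hB, hb]
  exact sum_mem_pairCone _ fun i _ => sq_mem_pairCone (sum_smul_mem_pairSpace _ _ fun u _ => hF u)

/-- The tangent line of the fourth power at `1`, weighted by a function between `0` and `1`. -/
theorem IsUnitValued.tangent_mem_pairCone {F A : (V → S) × (V → S) → ℝ} {m : ℕ}
    (hF : IsUnitValued m F) (hA : A ∈ pairSpace V S m) :
    (fun z => A z ^ 4 - 4 * (F z * A z) + 3 * F z) ∈ pairCone V S (3 * m) := by
  have hA2 : A ^ 2 ∈ pairSpace V S (m * 2) := pow_mem_pairSpace hA 2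
  have hA4 : (A ^ 2) ^ 2 ∈ pairCone V S (m * 2) := sq_mem_pairCone hA2
  have h1 : (A ^ 2 - 1) ^ 2 ∈ pairCone V S (m * 2) :=
    sq_mem_pairCone (Submodule.sub_mem _ hA2 (one_mem_pairSpace _))
  have h2 : (2 : ℝ) • (A - 1) ^ 2 ∈ pairCone V S (m * 2) :=
    smul_mem_pairCone zero_le_two (pairCone_mono (by omega)
      (sq_mem_pairCone (Submodule.sub_mem _ hA (one_mem_pairSpace _))))
  -- The expression is (1 - F) A⁴ + F (A⁴ - 4A + 3), with A⁴ - 4A + 3 = (A² - 1)² + 2 (A - 1)².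
  refine mem_pairCone_congr (add_mem (mul_mem_pairCone_of_le hF.2 hA4 (by omega))
    (mul_mem_pairCone_of_le hF.1 (add_mem h1 h2) (by omega))) fun z => ?_
  simp only [Pi.add_apply, Pi.sub_apply, Pi.pow_apply, Pi.one_apply, Pi.smul_apply, smul_eq_mul]
  ring

end Hypercontractive

/-! ### Sum-of-squares analysis of the shift partition -/

section Correlation

variable {V S : Type*} [Fintype V] [DecidableEq V] [Fintype S] [DecidableEq S] [AddCommGroup S]
  {G : WeightedGraph V} (I : Instance G S)

theorem Instance.sum_sq_norm_part (z : (V → S) × (V → S)) :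
    ∑ s, (∑ v, G.stat v * I.part s v z ^ 2) ^ 2 =
      ∑ u, ∑ v, G.stat u * G.stat v *
        (agree u v z * (I.localValue u z ^ 2 * I.localValue v z ^ 2)) := by
  simp only [← I.sum_part_sq_mul_part_sq, Finset.mul_sum]
  simp only [sq (∑ v, G.stat v * _), Finset.sum_mul_sum]
  rw [Finset.sum_comm]
  refine Finset.sum_congr rfl fun u _ => ?_
  rw [Finset.sum_comm]
  exact Finset.sum_congr rfl fun v _ => Finset.sum_congr rfl fun s _ => by ring

theorem Instance.sum_norm_part (z : (V → S) × (V → S)) :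
    ∑ s, G.statInner (fun v => I.part s v z) (fun v => I.part s v z) =
      ∑ v, G.stat v * I.localValue v z ^ 2 := by
  simp only [WeightedGraph.statInner_apply]
  rw [Finset.sum_comm]
  refine Finset.sum_congr rfl fun v _ => ?_
  rw [← Finset.mul_sum, I.sum_part_mul_part, agree_self]; ring

theorem Instance.sum_laplacian_part (z : (V → S) × (V → S)) :
    ∑ s, G.statInner (fun v => I.part s v z) (G.laplacian fun v => I.part s v z) =
      ∑ v, G.stat v * I.localValue v z ^ 2 -
        ∑ u, ∑ v, G.edgeProb u v * (agree u v z * (I.localValue u z * I.localValue v z)) := by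
  simp only [WeightedGraph.statInner_laplacian, Finset.sum_sub_distrib, I.sum_norm_part]
  congr 1
  rw [Finset.sum_comm]
  refine Finset.sum_congr rfl fun u _ => ?_
  rw [Finset.sum_comm]
  refine Finset.sum_congr rfl fun v _ => ?_
  rw [← Finset.mul_sum, I.sum_part_mul_part]

/-- Expanding the squared norms gives the average of agree · p_u² · p_v², with p the local values.
It remains to drop factors at most 1: p_v - p_u² p_v² = p_v (1 - p_u²) + p_u² p_v (1 - p_v). -/
theorem Instance.correlation_sub_mem_pairCone :
    (fun z => ∑ u, ∑ v, G.stat u * G.stat v * (agree u v z * I.localValue v z) -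
      ∑ s, (∑ v, G.stat v * I.part s v z ^ 2) ^ 2) ∈ pairCone V S 12 := by
  have h : ∀ u v : V, (fun z => agree u v z *
      (I.localValue v z - I.localValue u z ^ 2 * I.localValue v z ^ 2)) ∈ pairCone V S 12 := by
    intro u v
    have hu := I.isUnitValued_localValue u
    have hv := I.isUnitValued_localValue v
    have huu := hu.mul hu le_rfl
    refine mul_mem_pairCone_of_le (n := 8) (isUnitValued_agree u v).1 ?_ (by norm_num)
    refine mem_pairCone_congr (add_mem (mul_mem_pairCone_of_le hv.1 huu.2 (k := 8) (by norm_num))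
      (mul_mem_pairCone_of_le huu.1 (mul_mem_pairCone_of_le hv.1 hv.2 le_rfl) (k := 8)
        (by norm_num))) fun z => ?_
    simp only [Pi.add_apply, Pi.sub_apply, Pi.one_apply]
    ring
  refine mem_pairCone_congr (sum_mem_pairCone Finset.univ fun u _ =>
    sum_smul_mem_pairCone Finset.univ (fun v _ => mul_nonneg (G.stat_nonneg u) (G.stat_nonneg v))
      fun v _ => h u v) fun z => ?_
  rw [I.sum_sq_norm_part]
  simp only [← Finset.sum_sub_distrib]
  exact Finset.sum_congr rfl fun u _ => Finset.sum_congr rfl fun v _ => by ring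

/-- A union bound over four factors. On an edge, `agree` is at least the product of the two
satisfaction indicators, and xy ≥ x + y - 1, that is (1 - x)(1 - y) ≥ 0, is applied three times.
Averaged over edges, one indicator gives the value of the first assignment; the other and both local
values give that of the second. -/
theorem Instance.dirichlet_mem_pairCone [Nonempty V] (hI : I.IsAffine) :
    (fun z => ∑ u, ∑ v, G.edgeProb u v * (agree u v z * (I.localValue u z * I.localValue v z)) -
      (I.value z.1 + 3 * I.value z.2 - 3)) ∈ pairCone V S 8 := by
  have h : ∀ u v : V, 0 < G.w u v →
      (fun z => agree u v z * (I.localValue u z * I.localValue v z) -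
        (I.sat u v z.1 + I.sat u v z.2 + I.localValue u z + I.localValue v z - 3)) ∈
        pairCone V S 8 := by
    intro u v huv
    have hu := I.isUnitValued_localValue u
    have hv := I.isUnitValued_localValue v
    have huv' := hu.mul hv le_rfl
    have h1 := I.isUnitValued_sat_fst u v
    have h2 := I.isUnitValued_sat_snd u v
    have h12 := h1.mul h2 le_rfl
    have h12u := h12.mul hu le_rfl
    refine mem_pairCone_congr (add_mem (add_mem (add_mem
      (mul_mem_pairCone_of_le (I.agree_sub_mem_pairCone hI huv) huv'.1 (k := 8) (by norm_num))
      (mul_mem_pairCone_of_le h1.2 h2.2 (k := 8) (by norm_num)))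
      (mul_mem_pairCone_of_le h12.2 hu.2 (k := 8) (by norm_num)))
      (mul_mem_pairCone_of_le h12u.2 hv.2 (k := 8) (by norm_num))) fun z => ?_
    simp only [Pi.add_apply, Pi.sub_apply, Pi.one_apply]
    ring
  have h' : ∀ u v : V, (fun z => G.edgeProb u v *
      (agree u v z * (I.localValue u z * I.localValue v z) -
        (I.sat u v z.1 + I.sat u v z.2 + I.localValue u z + I.localValue v z - 3))) ∈
        pairCone V S 8 := by
    intro u v
    rcases (G.nonneg u v).eq_or_lt with h0 | h0
    · refine mem_pairCone_congr (zero_mem _) fun z => ?_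
      simp [WeightedGraph.edgeProb, ← h0]
    · exact smul_mem_pairCone (G.edgeProb_nonneg u v) (h u v h0)
  refine mem_pairCone_congr (sum_mem_pairCone Finset.univ fun u _ =>
    sum_mem_pairCone Finset.univ fun v _ => h' u v) fun z => ?_
  have e1 : ∑ u, ∑ v, G.edgeProb u v * I.localValue u z = I.value z.2 := by
    simp only [← Finset.sum_mul, G.sum_edgeProb, I.sum_stat_localValue]
  have e2 : ∑ u, ∑ v, G.edgeProb u v * I.localValue v z = I.value z.2 := by
    rw [Finset.sum_comm]
    simp only [← Finset.sum_mul, G.sum_edgeProb', I.sum_stat_localValue]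
  have e3 : ∑ u, ∑ v, G.edgeProb u v * 3 = 3 := by
    simp only [← Finset.sum_mul, G.sum_edgeProb, G.sum_stat, one_mul]
  simp only [mul_sub, mul_add, Finset.sum_sub_distrib, Finset.sum_add_distrib, ← I.value_eq,
    e1, e2, e3]
  ring

/-- The sum-of-squares analysis of the shift partition: on two independent samples from a
pseudodistribution of value at least `1 - ε`, the shifts at two random vertices agree often. -/
theorem Instance.le_pairE_agree [Nonempty V] (hI : I.IsAffine) {lam C ε : ℝ} {D : ℕ}
    (hlam : 0 < lam) (hG : CertHypercontractive G lam C D) {ν : (V → S) → ℝ}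
    (hν : ∀ f ∈ affineSpace V S ^ 12, 0 ≤ ∑ x, ν x * f x ^ 2) (hν1 : ∑ x, ν x = 1)
    (hval : 1 - ε ≤ ∑ x, ν x * I.value x) :
    1 - 8 * ε - 16 * ε / lam ≤
      C * pairE ν (fun z => ∑ u, ∑ v, G.stat u * G.stat v * (agree u v z * I.localValue v z)) := by
  have hC : 1 ≤ C := hG.one_le hlam
  have hmono : ∀ {F : (V → S) × (V → S) → ℝ} {m : ℕ}, m ≤ 12 → F ∈ pairCone V S m →
      0 ≤ pairE ν F := fun hm hF => pairE_nonneg hν (pairCone_mono hm hF)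
  have hone : pairE ν (fun _ => 1) = 1 := by
    have := pairE_mul ν (fun _ => 1) (fun _ => 1)
    simpa [hν1] using this
  have hval1 : pairE ν (fun z => I.value z.1) = ∑ x, ν x * I.value x := by
    have := pairE_mul ν I.value (fun _ => 1)
    simpa [hν1] using this
  have hval2 : pairE ν (fun z => I.value z.2) = ∑ x, ν x * I.value x := by
    have := pairE_mul ν (fun _ => 1) I.value
    simpa [hν1] using this
  have hpart : ∀ s v, I.part s v ∈ pairSpace V S 4 := I.part_mem_pairSpace
  set R : (V → S) × (V → S) → ℝ := fun z =>
    ∑ u, ∑ v, G.stat u * G.stat v * (agree u v z * I.localValue v z) with hR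
  set N : (V → S) × (V → S) → ℝ := fun z =>
    ∑ s, (∑ v, G.stat v * I.part s v z ^ 2) ^ 2 with hN
  set P : (V → S) × (V → S) → ℝ := fun z =>
    ∑ s, ∑ v, G.stat v * G.lowProj lam (fun u => I.part s u z) v ^ 4 with hP
  set Q : (V → S) × (V → S) → ℝ := fun z => ∑ v, G.stat v * I.localValue v z ^ 2 with hQ
  set M : (V → S) × (V → S) → ℝ := fun z =>
    ∑ s, G.statInner (fun v => I.part s v z) (G.lowProj lam fun v => I.part s v z) with hM
  set T : (V → S) × (V → S) → ℝ := fun z =>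
    ∑ u, ∑ v, G.edgeProb u v * (agree u v z * (I.localValue u z * I.localValue v z)) with hT
  set W : (V → S) × (V → S) → ℝ := fun z => I.value z.2 with hW
  -- On average C·R ≥ C·N ≥ P ≥ 4M - 3W and M ≥ Q - λ⁻¹(Q - T). The remaining inequalities place Q
  -- and W near 1 and bound Q - T. The largest cone degree used is 12.
  have h1 : 0 ≤ pairE ν (R - N) := hmono le_rfl I.correlation_sub_mem_pairCone
  have h2 : 0 ≤ pairE ν (C • N - P) := by
    refine hmono (m := 4 * 2) (by norm_num) (mem_pairCone_congr (sum_mem_pairCone Finset.univ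
      fun s _ => hG.mem_pairCone (hpart s)) fun z => ?_)
    simp [hN, hP, Finset.mul_sum]
  have h3 : 0 ≤ pairE ν (P - (4 : ℝ) • M + (3 : ℝ) • W) := by
    refine hmono (m := 3 * 4) (by norm_num) (mem_pairCone_congr (sum_mem_pairCone Finset.univ
      fun s _ => sum_smul_mem_pairCone Finset.univ (fun v _ => G.stat_nonneg v) fun v _ =>
        (I.isUnitValued_part s v).tangent_mem_pairCone
          (linearMap_apply_mem_pairSpace (hpart s) (G.lowProj lam) v)) fun z => ?_)
    have hWz : W z = ∑ s, ∑ v, G.stat v * I.part s v z := by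
      rw [Finset.sum_comm]
      simp only [← Finset.mul_sum, I.sum_part, I.sum_stat_localValue, hW]
    simp only [Pi.add_apply, Pi.sub_apply, Pi.smul_apply, smul_eq_mul, hWz]
    simp only [hP, hM, WeightedGraph.statInner_apply, Finset.mul_sum, mul_add, mul_sub,
      Finset.sum_add_distrib, Finset.sum_sub_distrib]
    congr 1
    · congr 1
      exact Finset.sum_congr rfl fun s _ => Finset.sum_congr rfl fun v _ => by ring
    · exact Finset.sum_congr rfl fun s _ => Finset.sum_congr rfl fun v _ => by ring
  have h4 : 0 ≤ pairE ν (M - Q + lam⁻¹ • (Q - T)) := by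
    refine hmono (m := 4) (by norm_num) (mem_pairCone_congr (sum_mem_pairCone Finset.univ
      fun s _ => lowProj_form_mem_pairCone (G := G) hlam (hpart s)) fun z => ?_)
    simp only [Pi.add_apply, Pi.sub_apply, Pi.smul_apply, smul_eq_mul, Finset.sum_add_distrib,
      Finset.sum_sub_distrib, I.sum_norm_part, ← Finset.mul_sum, I.sum_laplacian_part, hM, hQ, hT]
  have h5 : 0 ≤ pairE ν (Q - (2 : ℝ) • W + fun _ => 1) := by
    refine hmono (m := 2) (by norm_num) (mem_pairCone_congr (sum_smul_mem_pairCone Finset.univ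
      (fun v _ => G.stat_nonneg v) fun v _ => sq_mem_pairCone (Submodule.sub_mem _
        (I.localValue_mem_pairSpace v) (one_mem_pairSpace 2))) fun z => ?_)
    have hWz : W z = ∑ v, G.stat v * I.localValue v z := (I.sum_stat_localValue z).symm
    have h1z : (1 : ℝ) = ∑ v, G.stat v := G.sum_stat.symm
    simp only [Pi.add_apply, Pi.sub_apply, Pi.smul_apply, smul_eq_mul, hWz, hQ, Pi.pow_apply,
      Pi.one_apply]
    conv_lhs => rw [h1z]
    rw [Finset.mul_sum, ← Finset.sum_sub_distrib, ← Finset.sum_add_distrib]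
    exact Finset.sum_congr rfl fun v _ => by ring
  have h6 : 0 ≤ pairE ν (W - Q) := by
    refine hmono (m := 4) (by norm_num) (mem_pairCone_congr (sum_smul_mem_pairCone Finset.univ
      (fun v _ => G.stat_nonneg v) fun v _ => mul_mem_pairCone_of_le
        (I.isUnitValued_localValue v).1 (I.isUnitValued_localValue v).2 le_rfl) fun z => ?_)
    have hWz : W z = ∑ v, G.stat v * I.localValue v z := (I.sum_stat_localValue z).symm
    simp only [Pi.sub_apply, hWz, hQ, Pi.one_apply]
    rw [← Finset.sum_sub_distrib]
    exact Finset.sum_congr rfl fun v _ => by ring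
  have h7 : 0 ≤ pairE ν ((fun _ => 1) - W) := by
    refine hmono (m := 2) (by norm_num) (mem_pairCone_congr
      (IsUnitValued.sum G.stat_nonneg G.sum_stat I.isUnitValued_localValue).2 fun z => ?_)
    simp [hW, ← I.sum_stat_localValue]
  have h8 : 0 ≤ pairE ν (T - ((fun z => I.value z.1) + (3 : ℝ) • W - (3 : ℝ) • fun _ => 1)) := by
    refine hmono (m := 8) (by norm_num) (mem_pairCone_congr (I.dirichlet_mem_pairCone hI)
      fun z => ?_)
    simp [hT, hW]
  simp only [map_add, map_sub, map_smul, smul_eq_mul, hone, hval1, hval2] at h1 h2 h3 h4 h5 h6 h7 h8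
  set ω := ∑ x, ν x * I.value x
  -- Q ≤ W ≤ 1, while T ≥ 4ω - 3 ≥ 1 - 4ε.
  have h9 : lam⁻¹ * (pairE ν Q - pairE ν T) ≤ lam⁻¹ * (4 * ε) :=
    mul_le_mul_of_nonneg_left (by linarith) (inv_nonneg.2 hlam.le)
  have h10 : 16 * ε / lam = 4 * (lam⁻¹ * (4 * ε)) := by ring
  have h11 : C * pairE ν N ≤ C * pairE ν R := mul_le_mul_of_nonneg_left (by linarith) (by linarith)
  rw [h10]
  linarith

end Correlation

/-! ### Pair marginals of a product distribution -/

section ProductDistribution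

variable {V S : Type*} [Fintype V] [DecidableEq V] [Fintype S] [DecidableEq S]

theorem sum_prod_eq_one {m : V → S → ℝ} (hm : ∀ v, ∑ a, m v a = 1) :
    ∑ y : V → S, ∏ v, m v (y v) = 1 := by
  rw [← Fintype.prod_sum]
  simp [hm]

theorem sum_prod_mul_pair {m : V → S → ℝ} (hm : ∀ v, ∑ a, m v a = 1) {v w : V} (hvw : v ≠ w)
    (a b : S) :
    ∑ y : V → S, (∏ u, m u (y u)) * ((if y v = a then 1 else 0) * (if y w = b then 1 else 0)) =
      m v a * m w b := by
  have h1 : ∀ y : V → S,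
      (∏ u, m u (y u)) * ((if y v = a then 1 else 0) * (if y w = b then 1 else 0)) =
      ∏ u, m u (y u) * ((if u = v then (if y u = a then 1 else 0) else 1) *
        (if u = w then (if y u = b then 1 else 0) else 1)) := by
    intro y
    rw [Finset.prod_mul_distrib, Finset.prod_mul_distrib, Fintype.prod_ite_eq',
      Fintype.prod_ite_eq']
  simp only [h1]
  rw [← Fintype.prod_sum fun u c => m u c * ((if u = v then (if c = a then 1 else 0) else 1) *
        (if u = w then (if c = b then 1 else 0) else 1)),
    Finset.prod_eq_mul v w hvw]
  · simp [hvw, hvw.symm]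
  · rintro u - ⟨h, h'⟩
    simp [h, h', hm]
  · simp
  · simp

theorem sum_prod_mul_perm {m : V → S → ℝ} (hm : ∀ v, ∑ a, m v a = 1) {v w : V} (hvw : v ≠ w)
    (π : Equiv.Perm S) :
    ∑ y : V → S, (∏ u, m u (y u)) * (if π (y v) = y w then 1 else 0) =
      ∑ a, m v a * m w (π a) := by
  simp only [← sum_prod_mul_pair hm hvw]
  rw [Finset.sum_comm]
  refine Finset.sum_congr rfl fun y _ => ?_
  rw [← Finset.mul_sum]
  congr 1
  rw [Fintype.sum_eq_single (y v) fun a ha => by rw [if_neg (Ne.symm ha), zero_mul]]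
  simp [eq_comm]

end ProductDistribution

/-! ### From agreement of two samples to Condition & Round -/

section Rounding

variable {V S : Type*} [Fintype V] [DecidableEq V] [Fintype S] [DecidableEq S] [AddCommGroup S]
  {d : ℕ} {E : MvPolynomial (V × S) ℝ →ₗ[ℝ] ℝ} {G : WeightedGraph V}

theorem totalDegree_X_mul_X_le {σ : Type*} (i j : σ) :
    (X i * X j : MvPolynomial σ ℝ).totalDegree ≤ 2 :=
  (totalDegree_mul _ _).trans (by simp)

theorem symmetrize_rename (p : MvPolynomial (V × S) ℝ) (t : S) :
    symmetrize E (rename (fun i : V × S => (i.1, i.2 + t)) p) = symmetrize E p := by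
  simp only [symmetrize, LinearMap.smul_apply, LinearMap.sum_apply, LinearMap.comp_apply,
    AlgHom.toLinearMap_apply, rename_rename]
  congr 1
  refine Fintype.sum_equiv (Equiv.subRight t) _ _ fun s => ?_
  congr 3
  funext i
  simp only [Function.comp, Equiv.subRight_apply, Prod.mk.injEq, true_and]
  abel

theorem ShiftSymmetric.map_rename (hS : ShiftSymmetric d E) {p : MvPolynomial (V × S) ℝ}
    (hp : p.totalDegree ≤ d) (t : S) :
    E (rename (fun i : V × S => (i.1, i.2 + t)) p) = E p := by
  rw [← hS p hp, ← symmetrize_rename p t, hS _ ((totalDegree_rename_le _ _).trans hp)]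

theorem ShiftSymmetric.map_pair (hS : ShiftSymmetric d E) (hd : 2 ≤ d) (u v : V) (a b t : S) :
    E (X (v, a + t) * X (u, b + t)) = E (X (v, a) * X (u, b)) := by
  have := hS.map_rename ((totalDegree_X_mul_X_le (v, a) (u, b)).trans hd) t
  simpa using this

theorem ShiftSymmetric.map_X (hS : ShiftSymmetric d E) (hd : 1 ≤ d) (u : V) (a : S) :
    E (X (u, a)) = E (X (u, 0)) := by
  have := hS.map_rename (p := X (u, 0)) (by simpa using hd) a
  simpa using this

theorem SatisfiesUG.sum_map_X (hE : SatisfiesUG d E) (hd : 1 ≤ d) (u : V) :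
    ∑ a, E (X (u, a)) = E 1 := by
  have := hE.total u 1 (by
    rw [one_mul]
    refine (totalDegree_sub _ _).trans (max_le ?_ (by simp))
    exact totalDegree_finsetSum_le fun a _ => by simpa using hd)
  rw [one_mul, map_sub, map_sum] at this
  linarith

theorem SatisfiesUG.sum_map_pair (hE : SatisfiesUG d E) (hd : 2 ≤ d) (u v : V) (b : S) :
    ∑ a, E (X (v, a) * X (u, b)) = E (X (u, b)) := by
  have := hE.total v (X (u, b)) (by
    refine (totalDegree_mul _ _).trans ?_
    have h : (∑ a, X (v, a) - 1 : MvPolynomial (V × S) ℝ).totalDegree ≤ 1 := by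
      refine (totalDegree_sub _ _).trans (max_le ?_ (by simp))
      exact totalDegree_finsetSum_le fun a _ => by simp
    rw [totalDegree_X]
    omega)
  rw [mul_sub, mul_one, map_sub, Finset.mul_sum, map_sum, sub_eq_zero] at this
  rw [← this]
  exact Finset.sum_congr rfl fun a _ => by rw [mul_comm]

theorem map_X_zero (hP : IsPseudoexpectation d E) (hE : SatisfiesUG d E)
    (hS : ShiftSymmetric d E) (hd : 2 ≤ d) (u : V) :
    E (X (u, 0)) = (Fintype.card S : ℝ)⁻¹ := by
  have h := hE.sum_map_X (by omega) u
  simp only [hS.map_X (by omega) u, hP.one] at h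
  rw [Finset.sum_const, Finset.card_univ, nsmul_eq_mul] at h
  exact eq_inv_of_mul_eq_one_right h

theorem map_X_zero_pos (hP : IsPseudoexpectation d E) (hE : SatisfiesUG d E)
    (hS : ShiftSymmetric d E) (hd : 2 ≤ d) (u : V) : 0 < E (X (u, 0)) := by
  rw [map_X_zero hP hE hS hd]
  have : 0 < Fintype.card S := Fintype.card_pos
  positivity

theorem sum_condMarginal (hP : IsPseudoexpectation d E) (hE : SatisfiesUG d E)
    (hS : ShiftSymmetric d E) (hd : 2 ≤ d) (u v : V) : ∑ a, condMarginal E u v a = 1 := by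
  simp only [condMarginal, ← Finset.sum_div, hE.sum_map_pair hd]
  exact div_self (map_X_zero_pos hP hE hS hd u).ne'

/-- At assignments the monomial takes values 0 and 1, so its pseudoexpectation equals that of its
square; this costs degree 4. -/
theorem map_pair_nonneg (hP : IsPseudoexpectation d E) (hE : SatisfiesUG d E) (hd : 4 ≤ d)
    (u v : V) (a b : S) : 0 ≤ E (X (v, a) * X (u, b)) := by
  obtain ⟨ν, hν⟩ := hE.exists_signedMeasure
  have h1 := hP.sq_nonneg (X (v, a) * X (u, b)) (by
    have := totalDegree_X_mul_X_le (v, a) (u, b); omega)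
  rw [hν _ (by
    refine (totalDegree_pow _ _).trans ?_
    have := totalDegree_X_mul_X_le (v, a) (u, b); omega)] at h1
  rw [hν _ ((totalDegree_X_mul_X_le _ _).trans (by omega))]
  refine h1.trans_eq (Finset.sum_congr rfl fun x _ => ?_)
  simp only [map_pow, map_mul, eval_X, pt]
  split_ifs <;> simp

theorem condMarginal_nonneg (hP : IsPseudoexpectation d E) (hE : SatisfiesUG d E)
    (hS : ShiftSymmetric d E) (hd : 4 ≤ d) (u v : V) (a : S) : 0 ≤ condMarginal E u v a :=
  div_nonneg (map_pair_nonneg hP hE hd u v a 0) (map_X_zero_pos hP hE hS (by omega) u).le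

theorem Instance.sum_signedMeasure_mul_value (I : Instance G S) {ν : (V → S) → ℝ}
    (hν : ∀ p : MvPolynomial (V × S) ℝ, p.totalDegree ≤ d → E p = ∑ x, ν x * eval (pt x) p)
    (hd : 2 ≤ d) : ∑ x, ν x * I.value x = E I.valuePoly := by
  rw [hν]
  · refine Finset.sum_congr rfl fun x _ => ?_
    congr 1
    rw [Instance.value, Instance.valuePoly, map_sum]
    refine Finset.sum_congr rfl fun u _ => ?_
    rw [map_sum]
    refine Finset.sum_congr rfl fun v _ => ?_
    simp only [map_mul, eval_C, map_sum, eval_X, pt]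
    congr 1
    rw [Fintype.sum_eq_single (x u) fun a ha => by rw [if_neg (Ne.symm ha), zero_mul]]
    simp [eq_comm]
  · refine totalDegree_finsetSum_le fun u _ => totalDegree_finsetSum_le fun v _ => ?_
    refine (totalDegree_mul _ _).trans ?_
    rw [totalDegree_C, zero_add]
    exact totalDegree_finsetSum_le fun a _ => (totalDegree_X_mul_X_le _ _).trans hd

theorem signedMeasure_sq_nonneg {ν : (V → S) → ℝ}
    (hν : ∀ p : MvPolynomial (V × S) ℝ, p.totalDegree ≤ d → E p = ∑ x, ν x * eval (pt x) p)
    (hP : IsPseudoexpectation d E) {m : ℕ} (hd : 2 * m ≤ d) :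
    ∀ f ∈ affineSpace V S ^ m, 0 ≤ ∑ x, ν x * f x ^ 2 := by
  intro f hf
  obtain ⟨p, hp, hpf⟩ := exists_poly_of_mem_affineSpace_pow m f hf
  have h := hP.sq_nonneg p (by omega)
  rw [hν _ ((totalDegree_pow _ _).trans (by omega))] at h
  refine h.trans_eq (Finset.sum_congr rfl fun x _ => ?_)
  rw [map_pow, hpf]

/-- Indicator of the constraint `v, w` being satisfied by the label of `v` under the first and the
label of `w` under the second assignment, up to the shift at `u`. -/
def crossInd (π : Equiv.Perm S) (u v w : V) (z : (V → S) × (V → S)) : ℝ :=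
  if z.2 w - π (z.1 v) = z.2 u - z.1 u then 1 else 0

theorem crossInd_eq (π : Equiv.Perm S) (u v w : V) (z : (V → S) × (V → S)) :
    crossInd π u v w z = ∑ b, ∑ s, ∑ a,
      ((if z.1 v = a then (1 : ℝ) else 0) * (if z.1 u = b then 1 else 0)) *
      ((if z.2 w = π a + s then 1 else 0) * (if z.2 u = b + s then 1 else 0)) := by
  rw [Fintype.sum_eq_single (z.1 u) fun b hb => Finset.sum_eq_zero fun s _ =>
      Finset.sum_eq_zero fun a _ => by rw [if_neg (Ne.symm hb)]; ring,
    Fintype.sum_eq_single (z.2 u - z.1 u) fun s hs => Finset.sum_eq_zero fun a _ => by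
      rw [if_neg (fun h => hs (by rw [h]; abel) : ¬ z.2 u = z.1 u + s)]; ring,
    Fintype.sum_eq_single (z.1 v) fun a ha => by rw [if_neg (Ne.symm ha)]; ring]
  rw [crossInd]
  simp [sub_eq_iff_eq_add, add_comm]

theorem crossInd_mem_pairSpace (π : Equiv.Perm S) (u v w : V) :
    crossInd π u v w ∈ pairSpace V S 4 := by
  rw [funext (crossInd_eq π u v w)]
  refine sum_mem_pairSpace _ fun b _ => sum_mem_pairSpace _ fun s _ =>
    sum_mem_pairSpace _ fun a _ => ?_
  exact mul_mem_pairSpace_of_le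
    (mul_mem_pairSpace_of_le (fst_mem_pairSpace v a) (fst_mem_pairSpace u b) le_rfl)
    (mul_mem_pairSpace_of_le (snd_mem_pairSpace w _) (snd_mem_pairSpace u _) le_rfl) le_rfl

theorem Instance.crossInd_sub_mem_pairCone (I : Instance G S) (hI : I.IsAffine) (u : V) {v w : V}
    (h : 0 < G.w v w) :
    (crossInd (I.perm v w) u v w - fun z => agree u v z * I.sat v w z.2) ∈ pairCone V S 6 := by
  obtain ⟨a, ha⟩ := hI
  refine mem_pairCone_of_idem (Submodule.sub_mem _
    (pairSpace_mono (by norm_num) (crossInd_mem_pairSpace _ u v w))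
    (mul_mem_pairSpace_of_le (agree_mem_pairSpace u v) (I.sat_snd_mem_pairSpace v w)
      le_rfl)) fun z => ?_
  by_cases h12 : z.2 u - z.1 u = z.2 v - z.1 v ∧ z.2 v - a v w = z.2 w
  · have h3 : crossInd (I.perm v w) u v w z = 1 := by
      rw [crossInd, ha v w h, if_pos]
      rw [h12.1, ← h12.2]; abel
    simp [Instance.sat, ha v w h, h12, h3, agree]
  · have h3 : agree u v z * I.sat v w z.2 = 0 := by
      simp only [Instance.sat, ha v w h, agree]
      by_cases h1 : z.2 u - z.1 u = z.2 v - z.1 v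
      · rw [if_neg (fun h2 => h12 ⟨h1, h2⟩), mul_zero]
      · rw [if_neg h1, zero_mul]
    simp only [Pi.sub_apply, h3, sub_zero, crossInd]
    split_ifs <;> simp

/-- The event couples the two samples only through their labels at u. Once these are fixed, the
expectation factors into two pair moments, and shift symmetry brings the label of u to 0 in each. -/
theorem Instance.pairE_crossInd (I : Instance G S) (hI : I.IsAffine) {ν : (V → S) → ℝ}
    (hν : ∀ p : MvPolynomial (V × S) ℝ, p.totalDegree ≤ d → E p = ∑ x, ν x * eval (pt x) p)
    (hP : IsPseudoexpectation d E) (hE : SatisfiesUG d E)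
    (hS : ShiftSymmetric d E) (hd : 2 ≤ d) (u : V) {v w : V} (h : 0 < G.w v w) :
    pairE ν (crossInd (I.perm v w) u v w) =
      ∑ a, condMarginal E u v a * condMarginal E u w (I.perm v w a) := by
  obtain ⟨t, ht⟩ := hI
  have hq : ∀ v a b, ∑ x, ν x * ((if x v = a then (1 : ℝ) else 0) * (if x u = b then 1 else 0)) =
      E (X (v, a) * X (u, b)) := by
    intro v a b
    rw [hν _ ((totalDegree_X_mul_X_le _ _).trans hd)]
    simp [pt]
  have hcross : crossInd (I.perm v w) u v w = ∑ b, ∑ s, ∑ a, fun z =>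
      ((if z.1 v = a then (1 : ℝ) else 0) * (if z.1 u = b then 1 else 0)) *
      ((if z.2 w = I.perm v w a + s then 1 else 0) * (if z.2 u = b + s then 1 else 0)) := by
    ext z
    simp only [Finset.sum_apply, crossInd_eq]
  rw [hcross]
  simp only [map_sum]
  have hterm : ∀ b s a, pairE ν (fun z =>
      ((if z.1 v = a then (1 : ℝ) else 0) * (if z.1 u = b then 1 else 0)) *
      ((if z.2 w = I.perm v w a + s then 1 else 0) * (if z.2 u = b + s then 1 else 0))) =
      E (X (v, a - b) * X (u, 0)) * E (X (w, I.perm v w (a - b)) * X (u, 0)) := by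
    intro b s a
    -- The first moment is shifted by b and the second by b + s. An affine constraint commutes with
    -- translation, so w ends with the label π(a - b).
    rw [pairE_mul ν (fun x => (if x v = a then (1 : ℝ) else 0) * (if x u = b then 1 else 0))
      (fun x => (if x w = I.perm v w a + s then (1 : ℝ) else 0) * (if x u = b + s then 1 else 0)),
      hq, hq, ← hS.map_pair hd u v (a - b) 0 b,
      ← hS.map_pair hd u w (I.perm v w (a - b)) 0 (b + s), ht v w h, ht v w h]
    congr 4
    · abel_nf
    · abel_nf
    · abel_nf
    · abel_nf
  simp only [hterm]
  have hshift : ∀ b, ∑ a, E (X (v, a - b) * X (u, 0)) * E (X (w, I.perm v w (a - b)) * X (u, 0)) =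
      ∑ a, E (X (v, a) * X (u, 0)) * E (X (w, I.perm v w a) * X (u, 0)) := fun b =>
    Fintype.sum_equiv (Equiv.subRight b) _ _ fun a => by simp
  -- All |S|² pairs (b, s) contribute equally, and this factor cancels the two denominators E X(u,0)
  -- = 1/|S| of the conditional marginals.
  have hcard : (Fintype.card S : ℝ) ≠ 0 := Nat.cast_ne_zero.2 Fintype.card_ne_zero
  simp only [hshift, Finset.sum_const, Finset.card_univ, nsmul_eq_mul, condMarginal,
    map_X_zero hP hE hS hd, Finset.mul_sum]
  exact Finset.sum_congr rfl fun a _ => by field_simp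

/-- Rounding a constraint does at least as well as two independent samples agreeing. -/
theorem Instance.pairE_agree_le (I : Instance G S) (hI : I.IsAffine) {ν : (V → S) → ℝ}
    (hν : ∀ p : MvPolynomial (V × S) ℝ, p.totalDegree ≤ d → E p = ∑ x, ν x * eval (pt x) p)
    (hP : IsPseudoexpectation d E) (hE : SatisfiesUG d E)
    (hS : ShiftSymmetric d E) (hd : 12 ≤ d) (u : V) {v w : V} (h : 0 < G.w v w) :
    pairE ν (fun z => agree u v z * I.sat v w z.2) ≤
      ∑ y : V → S, (∏ v, condMarginal E u v (y v)) * I.sat v w y := by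
  have hν6 := signedMeasure_sq_nonneg hν hP (m := 6) (by omega)
  have hm := sum_condMarginal hP hE hS (by omega) u
  -- At a loop the output has a single label, not two independent ones. An affine loop constraint
  -- holds for every label or for none, so this case is direct.
  by_cases hvw : v = w
  · subst hvw
    obtain ⟨t, ht⟩ := hI
    have hsat : ∀ x, I.sat v v x = if t v v = 0 then 1 else 0 := fun x => by
      simp [Instance.sat, ht v v h]
    simp only [hsat]
    by_cases ht0 : t v v = 0
    · simp only [ht0, if_true, mul_one, sum_prod_eq_one hm]
      have h1 := pairE_mono hν6 (pairCone_mono (by norm_num) (isUnitValued_agree (S := S) u v).2)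
      have h2 : pairE ν 1 = 1 := by
        have h3 : ∑ x, ν x = 1 := by
          have := hν 1 (by simp)
          rw [hP.one] at this
          simpa using this.symm
        have := pairE_mul ν (fun _ => 1) (fun _ => 1)
        simp only [mul_one, h3] at this
        exact this
      rw [h2] at h1
      exact h1
    · simp only [ht0, if_false, mul_zero, Finset.sum_const_zero]
      exact (map_zero (pairE ν)).le
  · refine (pairE_mono hν6 (I.crossInd_sub_mem_pairCone hI u h)).trans_eq ?_
    rw [I.pairE_crossInd hI hν hP hE hS (by omega) u h]
    exact (sum_prod_mul_perm hm hvw _).symm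

theorem condRoundProb_nonneg (hP : IsPseudoexpectation d E) (hE : SatisfiesUG d E)
    (hS : ShiftSymmetric d E) (hd : 4 ≤ d) (y : V → S) : 0 ≤ condRoundProb G E y :=
  Finset.sum_nonneg fun u _ => mul_nonneg (G.stat_nonneg u)
    (Finset.prod_nonneg fun v _ => condMarginal_nonneg hP hE hS hd u v (y v))

theorem sum_condRoundProb [Nonempty V] (hP : IsPseudoexpectation d E) (hE : SatisfiesUG d E)
    (hS : ShiftSymmetric d E) (hd : 2 ≤ d) : ∑ y, condRoundProb G E y = 1 := by
  simp only [condRoundProb]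
  rw [Finset.sum_comm]
  simp only [← Finset.mul_sum, sum_prod_eq_one (sum_condMarginal hP hE hS hd _), mul_one,
    G.sum_stat]

/-- The expected value of Condition & Round. -/
theorem Instance.le_expected_value [Nonempty V] (I : Instance G S) (hI : I.IsAffine)
    {lam C ε : ℝ} {D : ℕ} (hlam : 0 < lam) (hG : CertHypercontractive G lam C D)
    (hP : IsPseudoexpectation d E) (hE : SatisfiesUG d E) (hS : ShiftSymmetric d E) (hd : 24 ≤ d)
    (hval : 1 - ε ≤ E I.valuePoly) :
    1 - 8 * ε - 16 * ε / lam ≤ C * ∑ y, condRoundProb G E y * I.value y := by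
  obtain ⟨ν, hν⟩ := hE.exists_signedMeasure
  have hν1 : ∑ x, ν x = 1 := by
    have := hν 1 (by simp)
    rw [hP.one] at this
    simpa using this.symm
  have h1 := I.le_pairE_agree hI hlam hG (signedMeasure_sq_nonneg hν hP (by omega)) hν1
    (hval.trans_eq (I.sum_signedMeasure_mul_value hν (by omega)).symm)
  refine h1.trans (mul_le_mul_of_nonneg_left ?_ (zero_le_one.trans (hG.one_le hlam)))
  have h2 : (fun z => ∑ u, ∑ v, G.stat u * G.stat v * (agree u v z * I.localValue v z)) =
      ∑ u, G.stat u • ∑ v, ∑ w, G.edgeProb v w • fun z => agree u v z * I.sat v w z.2 := by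
    ext z
    simp only [Finset.sum_apply, Pi.smul_apply, smul_eq_mul, Instance.localValue, Finset.mul_sum,
      ← G.stat_mul_transition]
    exact Finset.sum_congr rfl fun u _ => Finset.sum_congr rfl fun v _ =>
      Finset.sum_congr rfl fun w _ => by ring
  have h3 : ∑ y, condRoundProb G E y * I.value y = ∑ u, G.stat u * ∑ v, ∑ w, G.edgeProb v w *
      ∑ y : V → S, (∏ v, condMarginal E u v (y v)) * I.sat v w y := by
    simp only [condRoundProb, I.value_eq, Finset.sum_mul]
    rw [Finset.sum_comm]
    refine Finset.sum_congr rfl fun u _ => ?_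
    simp only [mul_assoc, ← Finset.mul_sum]
    congr 1
    simp only [Finset.mul_sum]
    rw [Finset.sum_comm]
    refine Finset.sum_congr rfl fun v _ => ?_
    rw [Finset.sum_comm]
    refine Finset.sum_congr rfl fun w _ => Finset.sum_congr rfl fun y _ => ?_
    ring
  rw [h2, h3, map_sum]
  refine Finset.sum_le_sum fun u _ => ?_
  rw [map_smul, smul_eq_mul, map_sum]
  refine mul_le_mul_of_nonneg_left (Finset.sum_le_sum fun v _ => ?_) (G.stat_nonneg u)
  rw [map_sum]
  refine Finset.sum_le_sum fun w _ => ?_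
  rw [map_smul, smul_eq_mul]
  rcases (G.nonneg v w).eq_or_lt with h0 | h0
  · simp [WeightedGraph.edgeProb, ← h0]
  · exact mul_le_mul_of_nonneg_left (I.pairE_agree_le hI hν hP hE hS (by omega) u h0)
      (G.edgeProb_nonneg v w)

end Rounding

/-! ### Couplings of programs with abstract samplers -/

section Coupling

variable {α β γ δ : Type*}

/-- A coupling of two distributions along a relation. -/
def Couples (μ : PMF β) (ν : PMF α) (R : β → α → Prop) : Prop :=
  ∃ κ : PMF (β × α), κ.map Prod.fst = μ ∧ κ.map Prod.snd = ν ∧ ∀ x ∈ κ.support, R x.1 x.2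

theorem Couples.pure {R : β → α → Prop} {b : β} {a : α} (h : R b a) :
    Couples (PMF.pure b) (PMF.pure a) R := by
  refine ⟨PMF.pure (b, a), PMF.pure_map _ _, PMF.pure_map _ _, fun x hx => ?_⟩
  rw [PMF.support_pure, Set.mem_singleton_iff] at hx
  rw [hx]; exact h

/-- Couplings compose: sample from κ, then from a coupling of the continuations. Pairs violating R
get an arbitrary continuation and have mass zero. -/
theorem Couples.bind {μ : PMF β} {ν : PMF α} {R : β → α → Prop} (h : Couples μ ν R)
    {f : β → PMF δ} {g : α → PMF γ} {R' : δ → γ → Prop}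
    (hfg : ∀ b a, R b a → Couples (f b) (g a) R') : Couples (μ.bind f) (ν.bind g) R' := by
  classical
  obtain ⟨κ, rfl, rfl, hR⟩ := h
  have : Nonempty (PMF (δ × γ)) := by
    obtain ⟨x, hx⟩ := κ.support_nonempty
    obtain ⟨κ', -⟩ := hfg _ _ (hR x hx)
    exact ⟨κ'⟩
  choose! κ' h1 h2 h3 using hfg
  refine ⟨κ.bind fun x => κ' x.1 x.2, ?_, ?_, ?_⟩
  · rw [PMF.map_bind, PMF.bind_map]
    refine PMF.ext fun d => ?_
    simp only [PMF.bind_apply]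
    refine tsum_congr fun x => ?_
    by_cases hx : x ∈ κ.support
    · rw [h1 _ _ (hR x hx)]; rfl
    · rw [(PMF.apply_eq_zero_iff κ x).2 hx, zero_mul, zero_mul]
  · rw [PMF.map_bind, PMF.bind_map]
    refine PMF.ext fun d => ?_
    simp only [PMF.bind_apply]
    refine tsum_congr fun x => ?_
    by_cases hx : x ∈ κ.support
    · rw [h2 _ _ (hR x hx)]; rfl
    · rw [(PMF.apply_eq_zero_iff κ x).2 hx, zero_mul, zero_mul]
  · intro y hy
    obtain ⟨x, hx, hy⟩ := (PMF.mem_support_bind_iff _ _ _).1 hy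
    exact h3 _ _ (hR x hx) y hy

theorem Couples.mono {μ : PMF β} {ν : PMF α} {R R' : β → α → Prop} (h : Couples μ ν R)
    (hR : ∀ b a, R b a → R' b a) : Couples μ ν R' := by
  obtain ⟨κ, h1, h2, h3⟩ := h
  exact ⟨κ, h1, h2, fun x hx => hR _ _ (h3 x hx)⟩

theorem Couples.map {μ : PMF β} {ν : PMF α} {R : β → α → Prop} (h : Couples μ ν R)
    {f : β → δ} {g : α → γ} {R' : δ → γ → Prop} (hR : ∀ b a, R b a → R' (f b) (g a)) :
    Couples (μ.map f) (ν.map g) R' := by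
  rw [← PMF.bind_pure_comp, ← PMF.bind_pure_comp]
  exact h.bind fun b a hba => Couples.pure (hR b a hba)

theorem Couples.map_left {μ : PMF β} {ν : PMF α} {R : β → α → Prop} (h : Couples μ ν R)
    {f : β → δ} {R' : δ → α → Prop} (hR : ∀ b a, R b a → R' (f b) a) :
    Couples (μ.map f) ν R' := by
  have := h.map (f := f) (g := id) hR
  rwa [PMF.map_id] at this

theorem Couples.map_eq {μ : PMF β} {ν : PMF α} {f : β → γ} {g : α → γ}
    (h : Couples μ ν fun b a => f b = g a) : μ.map f = ν.map g := by
  obtain ⟨κ, rfl, rfl, h3⟩ := h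
  rw [PMF.map_comp, PMF.map_comp]
  refine PMF.ext fun c => ?_
  rw [PMF.map_apply, PMF.map_apply]
  refine tsum_congr fun x => ?_
  by_cases hx : x ∈ κ.support
  · have h : (f ∘ Prod.fst) x = (g ∘ Prod.snd) x := h3 x hx
    rw [h]
  · simp [(PMF.apply_eq_zero_iff κ x).2 hx]

theorem Couples.exists_of_mem_support {μ : PMF β} {ν : PMF α} {R : β → α → Prop}
    (h : Couples μ ν R) {b : β} (hb : b ∈ μ.support) : ∃ a, R b a := by
  obtain ⟨κ, rfl, rfl, h3⟩ := h
  obtain ⟨x, hx, rfl⟩ := (PMF.mem_support_map_iff _ _ _).1 hb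
  exact ⟨x.2, h3 x hx⟩

theorem Couples.refl (μ : PMF β) : Couples μ μ fun b a => b = a := by
  refine ⟨μ.map fun b => (b, b), ?_, ?_, fun x hx => ?_⟩
  · rw [PMF.map_comp]; exact PMF.map_id μ
  · rw [PMF.map_comp]; exact PMF.map_id μ
  · obtain ⟨b, -, rfl⟩ := (PMF.mem_support_map_iff _ _ _).1 hx
    rfl

end Coupling

/-! ### Simulation of samplers with exact step counts -/

section Simulation

variable {α γ : Type*}

/-- Iteration of a randomized step depending on the number of the round. -/
def iter (h : ℕ → α → PMF α) : ℕ → α → PMF α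
  | 0, a => PMF.pure a
  | i + 1, a => (iter h i a).bind (h i)

/-- From the state `s` the program takes `N` steps, and the resulting state is coupled to the
sampler `ν` along `R`. -/
def Prog.Sim (p : Prog) (s : State) (ν : PMF α) (N : ℕ) (R : State → α → Prop) : Prop :=
  Couples (p.run s) ν fun x a => x.2 = N ∧ R x.1 a

theorem Prog.Sim.mono {p : Prog} {s : State} {ν : PMF α} {N M : ℕ} {R R' : State → α → Prop}
    (h : p.Sim s ν N R) (hN : N = M) (hR : ∀ s a, R s a → R' s a) : p.Sim s ν M R' :=
  Couples.mono h fun _ _ hx => ⟨hx.1.trans hN, hR _ _ hx.2⟩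

theorem Prog.Sim.instr {i : Instr} {s s' : State} (hs : i.exec s = PMF.pure s') {a : α}
    {R : State → α → Prop} (h : R s' a) : (Prog.instr i).Sim s (PMF.pure a) 1 R := by
  rw [Prog.Sim, Prog.run, hs, PMF.pure_map]
  exact Couples.pure ⟨rfl, h⟩

theorem Prog.Sim.coin (dst r : ℕ) (s : State) :
    (Prog.instr (.coin dst r)).Sim s (UG.coin (s.real r)) 1
      fun s' b => s' = s.setNat dst (cond b 1 0) := by
  rw [Prog.Sim, Prog.run, Instr.exec, PMF.map_comp]
  exact (Couples.refl _).map_left fun b a h => ⟨rfl, by rw [h]; rfl⟩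

theorem Prog.Sim.seq {p q : Prog} {s : State} {ν : PMF α} {N M : ℕ} {R : State → α → Prop}
    (hp : p.Sim s ν N R) {h : α → PMF γ} {R' : State → γ → Prop}
    (hq : ∀ s' a, R s' a → q.Sim s' (h a) M R') : (Prog.seq p q).Sim s (ν.bind h) (N + M) R' := by
  rw [Prog.Sim, Prog.run]
  refine Couples.bind hp fun x a hx => ?_
  exact (hq x.1 a hx.2).map_left fun y c hy => ⟨by rw [hx.1, hy.1], hy.2⟩

theorem Prog.Sim.det_seq {p q : Prog} {s : State} {N M : ℕ} {R : State → Unit → Prop}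
    (hp : p.Sim s (PMF.pure ()) N R) {ν : PMF γ} {R' : State → γ → Prop}
    (hq : ∀ s', R s' () → q.Sim s' ν M R') : (Prog.seq p q).Sim s ν (N + M) R' := by
  have := hp.seq (h := fun _ => ν) fun s' _ => hq s'
  rwa [PMF.pure_bind] at this

theorem Prog.Sim.instr_seq {i : Instr} {q : Prog} {s s' : State} (hs : i.exec s = PMF.pure s')
    {M : ℕ} {ν : PMF γ} {R : State → γ → Prop} (hq : q.Sim s' ν M R) :
    (Prog.seq (.instr i) q).Sim s ν (1 + M) R :=
  Prog.Sim.det_seq (R := fun t _ => t = s') (Prog.Sim.instr hs rfl) fun t ht => by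
    rw [ht]; exact hq

theorem Prog.Sim.ifz {r : ℕ} {p q : Prog} {s : State} {ν : PMF α} {N : ℕ} {R : State → α → Prop}
    (hp : s.nat r = 0 → p.Sim s ν N R) (hq : s.nat r ≠ 0 → q.Sim s ν N R) :
    (Prog.ifz r p q).Sim s ν (N + 1) R := by
  rw [Prog.Sim, Prog.run]
  by_cases h : s.nat r = 0
  · rw [if_pos h]
    exact (hp h).map_left fun x a hx => ⟨by rw [hx.1], hx.2⟩
  · rw [if_neg h]
    exact (hq h).map_left fun x a hx => ⟨by rw [hx.1], hx.2⟩

theorem Prog.Sim.loop {r : ℕ} {p : Prog} {N : ℕ} (Inv : ℕ → State → α → Prop)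
    {h : ℕ → α → PMF α} {n : ℕ} {s : State} {a : α} (hr : s.nat r = n) (h0 : Inv 0 s a)
    (hp : ∀ i < n, ∀ s a, Inv i s a → p.Sim s (h i a) N (Inv (i + 1))) :
    (Prog.loop r p).Sim s (iter h n a) (n * (N + 1) + 1) (Inv n) := by
  rw [Prog.Sim, Prog.run, hr]
  clear hr
  induction n with
  | zero => exact Couples.pure ⟨by simp, h0⟩
  | succ n ih =>
    refine Couples.bind (ih fun i hi => hp i (hi.trans n.lt_succ_self)) fun x b hx => ?_
    refine (hp n n.lt_succ_self x.1 b hx.2).map_left fun y c hy => ⟨?_, hy.2⟩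
    rw [hx.1, hy.1]; ring

theorem iter_pure (n : ℕ) : iter (fun _ (_ : Unit) => PMF.pure ()) n () = PMF.pure () := by
  induction n with
  | zero => rfl
  | succ n ih => rw [iter, ih, PMF.pure_bind]

theorem Prog.Sim.det_loop {r : ℕ} {p : Prog} {N : ℕ} (Inv : ℕ → State → Prop)
    {n : ℕ} {s : State} (hr : s.nat r = n) (h0 : Inv 0 s)
    (hp : ∀ i < n, ∀ s, Inv i s → p.Sim s (PMF.pure ()) N fun s _ => Inv (i + 1) s) :
    (Prog.loop r p).Sim s (PMF.pure ()) (n * (N + 1) + 1) fun s _ => Inv n s := by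
  have := Prog.Sim.loop (α := Unit) (fun i s _ => Inv i s) (h := fun _ _ => PMF.pure ()) (a := ())
    hr h0 fun i hi s _ hs => hp i hi s hs
  rwa [iter_pure] at this

end Simulation

/-! ### Reservoir sampling -/

section Reservoir

/-- One round of reservoir sampling: item `i` replaces the current one with probability equal to its
share of the total weight so far. -/
def reservoirStep (q : ℕ → ℝ) (i r : ℕ) : PMF ℕ :=
  (coin (q i / ∑ j ∈ Finset.range (i + 1), q j)).map fun b => cond b i r

/-- Reservoir sampling from the first `n` items. -/
def reservoir (q : ℕ → ℝ) (n : ℕ) : PMF ℕ := iter (reservoirStep q) n 0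

theorem coin_apply_true {p : ℝ} (h : p ≤ 1) : coin p true = ENNReal.ofReal p := by
  simp [coin, h]

theorem coin_apply_false {p : ℝ} (h0 : 0 ≤ p) (h : p ≤ 1) :
    coin p false = ENNReal.ofReal (1 - p) := by
  simp [coin, h, ENNReal.ofReal_sub _ h0]

theorem reservoirStep_apply (q : ℕ → ℝ) (i r j : ℕ) : reservoirStep q i r j =
    (if j = i then coin (q i / ∑ j ∈ Finset.range (i + 1), q j) true else 0) +
      (if j = r then coin (q i / ∑ j ∈ Finset.range (i + 1), q j) false else 0) := by
  rw [reservoirStep, PMF.map_apply, tsum_bool, add_comm]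
  simp only [cond_true, cond_false]
  congr

theorem reservoir_succ_apply (q : ℕ → ℝ) (n j : ℕ) : reservoir q (n + 1) j =
    (if j = n then coin (q n / ∑ j ∈ Finset.range (n + 1), q j) true else 0) +
      reservoir q n j * coin (q n / ∑ j ∈ Finset.range (n + 1), q j) false := by
  have h : reservoir q (n + 1) = (reservoir q n).bind (reservoirStep q n) := rfl
  rw [h, PMF.bind_apply]
  simp only [reservoirStep_apply, mul_add]
  rw [ENNReal.tsum_add, ENNReal.tsum_mul_right, PMF.tsum_coe, one_mul]
  congr 1
  rw [tsum_eq_single j fun r hr => by rw [if_neg (Ne.symm hr), mul_zero], if_pos rfl]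

/-- An earlier item survives the last round with probability (S - q_n)/S, which rescales its share
q_j/(S - q_n) to q_j/S. -/
theorem reservoir_apply {q : ℕ → ℝ} (n : ℕ) (hq : ∀ i < n, 0 ≤ q i)
    (hS : 0 < ∑ j ∈ Finset.range n, q j) (j : ℕ) : reservoir q n j =
      if j < n then ENNReal.ofReal (q j / ∑ j ∈ Finset.range n, q j) else 0 := by
  induction n with
  | zero => simp at hS
  | succ n ih =>
    rw [reservoir_succ_apply]
    set S := ∑ j ∈ Finset.range (n + 1), q j with hSdef
    have hqn : 0 ≤ q n := hq n n.lt_succ_self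
    have hle : ∑ j ∈ Finset.range n, q j = S - q n := by
      rw [hSdef, Finset.sum_range_succ]; ring
    have hnn : 0 ≤ ∑ j ∈ Finset.range n, q j :=
      Finset.sum_nonneg fun i hi => hq i ((Finset.mem_range.1 hi).trans n.lt_succ_self)
    have h1 : q n / S ≤ 1 := (div_le_one hS).2 (by linarith)
    have h0 : 0 ≤ q n / S := div_nonneg hqn hS.le
    rw [coin_apply_true h1, coin_apply_false h0 h1]
    -- If all earlier weights vanish, the induction hypothesis does not apply, but then item n is
    -- taken with certainty.
    rcases hnn.eq_or_lt with hz | hpos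
    · have hqS : q n / S = 1 := by
        rw [div_eq_one_iff_eq hS.ne']; linarith
      rw [hqS, sub_self, ENNReal.ofReal_zero, mul_zero, add_zero]
      rcases lt_trichotomy j n with h | h | h
      · rw [if_neg h.ne, if_pos (by omega)]
        have : q j = 0 := (Finset.sum_eq_zero_iff_of_nonneg fun i hi =>
          hq i ((Finset.mem_range.1 hi).trans n.lt_succ_self)).1 hz.symm j (Finset.mem_range.2 h)
        simp [this]
      · subst h
        rw [if_pos rfl, if_pos (by omega), hqS]
      · rw [if_neg h.ne', if_neg (by omega)]
    · rw [ih (fun i hi => hq i (hi.trans n.lt_succ_self)) hpos]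
      rcases lt_trichotomy j n with h | h | h
      · rw [if_neg h.ne, if_pos h, if_pos (by omega), zero_add,
          ← ENNReal.ofReal_mul (div_nonneg (hq j (by omega)) hnn), hle]
        congr 1
        have : S - q n ≠ 0 := by rw [← hle]; exact hpos.ne'
        field_simp
      · subst h
        simp
      · rw [if_neg h.ne', if_neg (by omega), if_neg (by omega)]
        simp

/-- Independent reservoir sampling for several output cells. -/
def fillStep (q : ℕ → ℕ → ℝ) (k v : ℕ) (o : ℕ → ℕ) : PMF (ℕ → ℕ) :=
  (reservoir (q v) k).map fun a => Function.update o v a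

/-- Round n writes only cell n and its draw ignores the other cells, so the Boolean event for the
first n + 1 cells is a conjunction of two independent events. -/
theorem iter_fillStep (q : ℕ → ℕ → ℝ) (k : ℕ) (o t : ℕ → ℕ) (n : ℕ) :
    ((iter (fillStep q k) n o).map fun o' => decide (∀ i < n, o' i = t i)) true =
      ∏ i ∈ Finset.range n, reservoir (q i) k (t i) := by
  induction n with
  | zero => simp [iter, PMF.pure_map]
  | succ n ih =>
    rw [Finset.prod_range_succ, ← ih]
    set β := (iter (fillStep q k) n o).map fun o' => decide (∀ i < n, o' i = t i) with hβ
    have h : ((iter (fillStep q k) (n + 1) o).map fun o' => decide (∀ i < n + 1, o' i = t i)) =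
        β.bind fun c => (reservoir (q n) k).map fun a => c && decide (a = t n) := by
      rw [hβ, PMF.bind_map, iter, PMF.map_bind]
      congr 1
      funext o'
      rw [fillStep, PMF.map_comp]
      simp only [Function.comp_apply]
      congr 1
      funext a
      rw [Bool.eq_iff_iff]
      simp only [Function.comp_apply, decide_eq_true_eq, Bool.and_eq_true]
      constructor
      · intro h
        refine ⟨fun i hi => ?_, ?_⟩
        · have := h i (hi.trans n.lt_succ_self)
          rwa [Function.update_of_ne hi.ne] at this
        · simpa using h n n.lt_succ_self
      · rintro ⟨h1, h2⟩ i hi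
        rcases (Nat.lt_succ_iff.1 hi).eq_or_lt with h | h
        · subst h; simpa using h2
        · rw [Function.update_of_ne h.ne]; exact h1 i h
    rw [h, PMF.bind_apply, tsum_bool]
    simp only [PMF.map_apply]
    simp [tsum_ite_eq]

end Reservoir

/-! ### The program for Condition & Round -/

section Program

open Prog Instr

/-- One step of reservoir sampling: the item of weight `real w` numbered `nat i` replaces `nat r`
with probability `real w / real t`, where `real t` is the total so far including `real w`.
Registers `9`, `13`, `14` are the coin, the constant `0` and scratch. -/
def sampleProg (t w i r : ℕ) : Prog :=
  seq (instr (radd t t w)) <| seq (instr (rdiv 2 w t)) <| seq (instr (Instr.coin 9 2)) <|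
    ifz 9 (instr (nconst 14 0)) (instr (nadd r i 13))

/-- Compute the constants `1` (register `3`), `0` (register `13`), the base `n * k + 1` of the
addresses (register `4`), the distance between the addresses belonging to successive vertices
(register `5`) and the address belonging to the first vertex (registers `6` and `8`). -/
def setupProg : Prog :=
  seq (instr (nconst 3 1)) <| seq (instr (nconst 13 0)) <| seq (instr (nconst 4 1)) <|
    seq (loop 0 (instr (nadd 4 4 1))) <|
    seq (instr (nconst 5 0)) <| seq (loop 1 (instr (nadd 5 5 4))) <|
    seq (instr (nadd 6 4 13)) <| seq (loop 2 (instr (nadd 6 6 4))) <|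
    seq (instr (nconst 7 0)) <| seq (instr (nadd 8 6 13)) <| instr (rconst 0 0)

/-- Sum up a row of the weight matrix. -/
def degProg : Prog :=
  seq (instr (rconst 1 0)) <|
    loop 0 (seq (instr (load 3 0 7)) <| seq (instr (radd 1 1 3)) (instr (nadd 7 7 3)))

/-- Sample a vertex. -/
def vertexProg : Prog :=
  loop 0 (seq degProg (seq (sampleProg 0 1 6 8) (instr (nadd 6 6 5))))

/-- Sample a label for the next vertex. -/
def labelProg : Prog :=
  seq (instr (rconst 0 0)) <| seq (instr (nconst 11 0)) <| seq (instr (nconst 12 0)) <|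
    loop 1 (seq (instr (load 1 1 8)) <| seq (sampleProg 0 1 11 12) <|
      seq (instr (nadd 11 11 3)) (instr (nadd 8 8 3)))

/-- Sample and write the labels of all vertices. -/
def fillProg : Prog :=
  seq (instr (nadd 8 8 3)) <| seq (instr (nconst 10 0)) <|
    loop 0 (seq labelProg (seq (instr (write 10 12)) (instr (nadd 10 10 3))))

/-- Condition & Round. -/
def condRoundProg : Prog := seq setupProg (seq vertexProg fillProg)

/-- The registers and arrays which keep their contents after the setup. -/
structure Frame (n k : ℕ) (w M : ℕ → ℝ) (s : State) : Prop where
  n0 : s.nat 0 = n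
  n1 : s.nat 1 = k
  n3 : s.nat 3 = 1
  n5 : s.nat 5 = k * (n * k + 1)
  n13 : s.nat 13 = 0
  i0 : s.input 0 = w
  i1 : s.input 1 = M

variable {n k z : ℕ} {w M : ℕ → ℝ}

/-- The instruction set has no product of natural numbers, so each of the three loops forms one by
repeated addition. -/
theorem setupProg_sim {s : State} (h0 : s.nat 0 = n) (h1 : s.nat 1 = k) (h2 : s.nat 2 = z)
    (hw : s.input 0 = w) (hM : s.input 1 = M) (ho : s.out = fun _ => 0) :
    setupProg.Sim s (PMF.pure ()) (2 * n + 2 * k + 2 * z + 11) fun s _ => Frame n k w M s ∧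
      s.nat 6 = (1 + z) * (n * k + 1) ∧ s.nat 7 = 0 ∧ s.nat 8 = (1 + z) * (n * k + 1) ∧
      s.real 0 = 0 ∧ s.out = fun _ => 0 := by
  refine Sim.mono (Sim.instr_seq rfl <| Sim.instr_seq rfl <| Sim.instr_seq rfl <|
    Sim.det_seq (R := fun s _ => s.nat 0 = n ∧ s.nat 1 = k ∧ s.nat 2 = z ∧ s.nat 3 = 1 ∧
      s.nat 13 = 0 ∧ s.nat 4 = n * k + 1 ∧ s.input 0 = w ∧ s.input 1 = M ∧ s.out = fun _ => 0)
      (Sim.det_loop (n := n) (N := 1) (fun i s => s.nat 0 = n ∧ s.nat 1 = k ∧ s.nat 2 = z ∧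
        s.nat 3 = 1 ∧ s.nat 13 = 0 ∧ s.nat 4 = i * k + 1 ∧ s.input 0 = w ∧ s.input 1 = M ∧
        s.out = fun _ => 0) ?_ ?_ ?_)
      fun s hs => Sim.instr_seq rfl <|
    Sim.det_seq (R := fun s _ => s.nat 0 = n ∧ s.nat 1 = k ∧ s.nat 2 = z ∧ s.nat 3 = 1 ∧
      s.nat 13 = 0 ∧ s.nat 4 = n * k + 1 ∧ s.nat 5 = k * (n * k + 1) ∧
      s.input 0 = w ∧ s.input 1 = M ∧ s.out = fun _ => 0)
      (Sim.det_loop (n := k) (N := 1) (fun i s => s.nat 0 = n ∧ s.nat 1 = k ∧ s.nat 2 = z ∧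
        s.nat 3 = 1 ∧ s.nat 13 = 0 ∧ s.nat 4 = n * k + 1 ∧ s.nat 5 = i * (n * k + 1) ∧
        s.input 0 = w ∧ s.input 1 = M ∧ s.out = fun _ => 0) ?_ ?_ ?_)
      fun s hs => Sim.instr_seq rfl <|
    Sim.det_seq (R := fun s _ => s.nat 0 = n ∧ s.nat 1 = k ∧ s.nat 3 = 1 ∧
      s.nat 13 = 0 ∧ s.nat 4 = n * k + 1 ∧ s.nat 5 = k * (n * k + 1) ∧ s.nat 6 = (1 + z) * (n * k + 1) ∧
      s.input 0 = w ∧ s.input 1 = M ∧ s.out = fun _ => 0)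
      (Sim.det_loop (n := z) (N := 1) (fun i s => s.nat 0 = n ∧ s.nat 1 = k ∧ s.nat 3 = 1 ∧
        s.nat 13 = 0 ∧ s.nat 4 = n * k + 1 ∧ s.nat 5 = k * (n * k + 1) ∧
        s.nat 6 = (1 + i) * (n * k + 1) ∧ s.input 0 = w ∧ s.input 1 = M ∧ s.out = fun _ => 0)
        ?_ ?_ ?_)
      fun s hs => Sim.instr_seq rfl <| Sim.instr_seq rfl <| Sim.instr rfl ?_)
    (by ring) fun _ _ h => h
  · simpa [State.setNat] using h0
  · simp [State.setNat, h0, h1, h2, hw, hM, ho]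
  · intro i _ s hs
    refine Sim.instr rfl ?_
    simp [State.setNat, hs]
    ring
  · simpa [State.setNat] using hs.2.1
  · simp [State.setNat, hs]
  · intro i _ s hs
    refine Sim.instr rfl ?_
    simp [State.setNat, hs]
    ring
  · simpa [State.setNat] using hs.2.2.1
  · simp [State.setNat, hs]
  · intro i _ s hs
    refine Sim.instr rfl ?_
    simp [State.setNat, hs]
    ring
  · obtain ⟨a0, a1, a3, a13, -, a5, a6, ai, am, ao⟩ := hs
    refine ⟨⟨?_, ?_, ?_, ?_, ?_, ?_, ?_⟩, ?_⟩ <;>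
      simp [State.setNat, State.setReal, a0, a1, a3, a13, a5, a6, ai, am, ao]

/-- The weighted degree of the vertex number `i`, as computed from the weight table. -/
def rowSum (w : ℕ → ℝ) (n i : ℕ) : ℝ := ∑ j ∈ Finset.range n, w (i * n + j)

theorem degProg_sim {s : State} {i : ℕ} (hf : Frame n k w M s) (h7 : s.nat 7 = i * n) :
    degProg.Sim s (PMF.pure ()) (4 * n + 2) fun s' _ => Frame n k w M s' ∧
      s'.nat 6 = s.nat 6 ∧ s'.nat 7 = (i + 1) * n ∧ s'.nat 8 = s.nat 8 ∧
      s'.real 0 = s.real 0 ∧ s'.real 1 = rowSum w n i ∧ s'.out = s.out := by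
  refine Sim.mono (Sim.instr_seq rfl (Sim.det_loop (n := n) (N := 3) (fun j s' =>
    Frame n k w M s' ∧ s'.nat 6 = s.nat 6 ∧ s'.nat 7 = i * n + j ∧ s'.nat 8 = s.nat 8 ∧
      s'.real 0 = s.real 0 ∧ s'.real 1 = ∑ l ∈ Finset.range j, w (i * n + l) ∧ s'.out = s.out)
    ?_ ?_ ?_)) (by ring) ?_
  · simpa [State.setReal] using hf.n0
  · obtain ⟨a0, a1, a3, a5, a13, ai, am⟩ := hf
    refine ⟨⟨?_, ?_, ?_, ?_, ?_, ?_, ?_⟩, ?_⟩ <;>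
      simp [State.setReal, a0, a1, a3, a13, a5, ai, am, h7]
  · rintro j - s' ⟨⟨a0, a1, a3, a5, a13, ai, am⟩, b6, b7, b8, b0, b1, bo⟩
    refine Sim.instr_seq rfl <| Sim.instr_seq rfl <| Sim.instr rfl ?_
    refine ⟨⟨?_, ?_, ?_, ?_, ?_, ?_, ?_⟩, ?_⟩ <;>
      simp [State.setReal, State.setNat, a0, a1, a3, a13, a5, ai, am, b6, b7, b8, b0, b1, bo,
        Finset.sum_range_succ, add_assoc]
  · rintro s' - ⟨hf, b6, b7, b8, b0, b1, bo⟩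
    exact ⟨hf, b6, by rw [b7]; ring, b8, b0, b1, bo⟩

/-- The function g encodes items in registers: vertices are represented by table addresses, labels
by their numbers. The branch keeping the old item performs an idle assignment, so both branches cost
the same. -/
theorem sampleProg_sim {s : State} {q : ℕ → ℝ} {t wt a r j v : ℕ} (ht : t ≠ wt) (ht2 : t ≠ 2)
    (ha9 : a ≠ 9) (hr9 : r ≠ 9) (hr14 : r ≠ 14)
    (h13 : s.nat 13 = 0) (hw : s.real wt = q j) (hS : s.real t = ∑ l ∈ Finset.range j, q l)
    (g : ℕ → ℕ) (ha : s.nat a = g j) (hr : s.nat r = g v) :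
    (sampleProg t wt a r).Sim s (reservoirStep q j v) 5 fun s' v' => s'.nat r = g v' ∧
      s'.real t = ∑ l ∈ Finset.range (j + 1), q l ∧
      (∀ i, i ≠ 9 → i ≠ 14 → i ≠ r → s'.nat i = s.nat i) ∧
      s'.input = s.input ∧ s'.out = s.out := by
  rw [reservoirStep, ← PMF.bind_pure_comp]
  refine Sim.mono (Sim.instr_seq rfl <| Sim.instr_seq rfl <| Sim.seq (N := 1) (M := 2)
    (R := fun s' b => s'.nat 9 = cond b 1 0 ∧ s'.real t = ∑ l ∈ Finset.range (j + 1), q l ∧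
      (∀ i, i ≠ 9 → s'.nat i = s.nat i) ∧ s'.input = s.input ∧ s'.out = s.out)
    (h := fun b => PMF.pure (cond b j v)) ?_ ?_) rfl fun _ _ h => h
  · have h1 := Sim.coin 9 2 (((s.setReal t (s.real t + s.real wt)).setReal 2
      ((s.setReal t (s.real t + s.real wt)).real wt / (s.setReal t (s.real t + s.real wt)).real t)))
    have h2 : (((s.setReal t (s.real t + s.real wt)).setReal 2
        ((s.setReal t (s.real t + s.real wt)).real wt /
          (s.setReal t (s.real t + s.real wt)).real t))).real 2 =
        q j / ∑ l ∈ Finset.range (j + 1), q l := by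
      simp [State.setReal, ht.symm, hw, hS, Finset.sum_range_succ]
    rw [h2] at h1
    refine h1.mono rfl fun s' b hs' => ?_
    subst hs'
    refine ⟨by simp [State.setNat], ?_, fun i hi => ?_, rfl, rfl⟩
    · simp [State.setNat, State.setReal, ht2, hw, hS, Finset.sum_range_succ]
    · simp [State.setNat, State.setReal, hi]
  · rintro s' b ⟨b9, bt, bn, bi, bo⟩
    refine Sim.ifz (N := 1) (fun h => Sim.instr rfl ?_) (fun h => Sim.instr rfl ?_)
    · rw [b9] at h
      cases b
      · refine ⟨?_, bt, fun i h1 h2 _ => ?_, bi, bo⟩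
        · simp [State.setNat, hr14, bn r hr9, hr]
        · simp [State.setNat, h2, bn i h1]
      · simp at h
    · rw [b9] at h
      cases b
      · simp at h
      · refine ⟨?_, bt, fun i h1 _ h2 => ?_, bi, bo⟩
        · simp [State.setNat, bn a ha9, ha, bn 13 (by norm_num), h13]
        · simp [State.setNat, h2, bn i h1]

theorem Prog.Sim.seq_pure {α : Type*} {p q : Prog} {s : State} {ν : PMF α} {N M : ℕ}
    {R R' : State → α → Prop} (hp : p.Sim s ν N R)
    (hq : ∀ s' a, R s' a → q.Sim s' (PMF.pure a) M R') : (Prog.seq p q).Sim s ν (N + M) R' := by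
  have := hp.seq hq
  rwa [PMF.bind_pure] at this

theorem vertexProg_sim {s : State} (hf : Frame n k w M s) (h6 : s.nat 6 = (1 + z) * (n * k + 1))
    (h7 : s.nat 7 = 0) (h8 : s.nat 8 = (1 + z) * (n * k + 1)) (h0 : s.real 0 = 0)
    (ho : s.out = fun _ => 0) :
    vertexProg.Sim s (reservoir (rowSum w n) n) (n * (4 * n + 9) + 1) fun s' u =>
      Frame n k w M s' ∧ s'.nat 8 = (1 + z + u * k) * (n * k + 1) ∧ s'.out = fun _ => 0 := by
  refine Sim.mono (Sim.loop (N := 4 * n + 8) (fun i s u => Frame n k w M s ∧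
    s.nat 6 = (1 + z + i * k) * (n * k + 1) ∧ s.nat 7 = i * n ∧
    s.nat 8 = (1 + z + u * k) * (n * k + 1) ∧
    s.real 0 = ∑ l ∈ Finset.range i, rowSum w n l ∧ s.out = fun _ => 0) hf.n0 ?_ ?_) rfl ?_
  · exact ⟨hf, by simpa using h6, by simpa using h7, by simpa using h8, by simpa using h0, ho⟩
  · rintro i - s u ⟨hf, h6, h7, h8, h0, ho⟩
    refine Sim.mono (Sim.det_seq (degProg_sim hf h7) fun s1 h => ?_) (M := 4 * n + 8)
      (N := 4 * n + 2 + (5 + 1)) (by ring) fun _ _ h => h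
    obtain ⟨f1, b6, b7, b8, b0, b1, bo⟩ := h
    refine Sim.seq_pure (sampleProg_sim (by norm_num) (by norm_num) (by norm_num) (by norm_num)
      (by norm_num) f1.n13 b1 (b0.trans h0) (fun u => (1 + z + u * k) * (n * k + 1))
      (b6.trans h6) (b8.trans h8)) ?_
    rintro s2 u' ⟨c8, c0, cn, ci, co⟩
    have cf : Frame n k w M s2 := by
      obtain ⟨a0, a1, a3, a5, a13, ai, am⟩ := f1
      constructor <;> simp [cn, ci, a0, a1, a3, a5, a13, ai, am]
    refine Sim.instr rfl ⟨?_, ?_, ?_, ?_, ?_, ?_⟩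
    · obtain ⟨a0, a1, a3, a5, a13, ai, am⟩ := cf
      constructor <;> simp [State.setNat, a0, a1, a3, a5, a13, ai, am]
    · have : s2.nat 6 = (1 + z + i * k) * (n * k + 1) := by simp [cn, b6, h6]
      simp [State.setNat, this, cf.n5]; ring
    · simp [State.setNat, cn, b7]
    · simpa [State.setNat] using c8
    · exact c0
    · simp [State.setNat, co, bo, ho]
  · rintro s' u ⟨hf, -, -, h8, -, ho⟩
    exact ⟨hf, h8, ho⟩

theorem labelProg_sim {s : State} {A : ℕ} (hf : Frame n k w M s) (h8 : s.nat 8 = A) :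
    labelProg.Sim s (reservoir (fun a => M (A + a)) k) (9 * k + 4) fun s' a =>
      Frame n k w M s' ∧ s'.nat 8 = A + k ∧ s'.nat 10 = s.nat 10 ∧ s'.nat 12 = a ∧
      s'.out = s.out := by
  refine Sim.mono (Sim.instr_seq rfl <| Sim.instr_seq rfl <| Sim.instr_seq rfl <|
    Sim.loop (N := 8) (n := k) (a := 0) (fun a s' r => Frame n k w M s' ∧ s'.nat 8 = A + a ∧
    s'.nat 10 = s.nat 10 ∧ s'.nat 11 = a ∧ s'.nat 12 = r ∧
    s'.real 0 = ∑ l ∈ Finset.range a, M (A + l) ∧ s'.out = s.out) ?_ ?_ ?_) (by ring) ?_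
  · simpa [State.setReal, State.setNat] using hf.n1
  · obtain ⟨a0, a1, a3, a5, a13, ai, am⟩ := hf
    refine ⟨⟨?_, ?_, ?_, ?_, ?_, ?_, ?_⟩, ?_⟩ <;>
      simp [State.setReal, State.setNat, a0, a1, a3, a13, a5, ai, am, h8]
  · rintro a - s1 r ⟨⟨a0, a1, a3, a5, a13, ai, am⟩, b8, b10, b11, b12, b0, bo⟩
    refine Sim.mono (Sim.instr_seq rfl (Sim.seq_pure (sampleProg_sim (q := fun a => M (A + a))
      (j := a) (v := r) (by norm_num) (by norm_num) (by norm_num) (by norm_num)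
      (by norm_num) ?_ ?_ ?_ id ?_ ?_) (M := 2) ?_)) rfl fun _ _ h => h
    · simpa [State.setReal] using a13
    · simp [State.setReal, am, b8]
    · simpa [State.setReal] using b0
    · simpa [State.setReal] using b11
    · simpa [State.setReal] using b12
    · rintro s2 r' ⟨c12, c0, cn, ci, co⟩
      refine Sim.instr_seq rfl <| Sim.instr rfl ?_
      have cn' : ∀ i, i ≠ 9 → i ≠ 14 → i ≠ 12 → s2.nat i = s1.nat i := cn
      refine ⟨⟨?_, ?_, ?_, ?_, ?_, ?_, ?_⟩, ?_⟩ <;>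
        simp [State.setReal, State.setNat, a0, a1, a3, a13, a5, ai, am, cn', c12, c0, ci, co, b8,
          b10, b11, bo, add_assoc]
  · rintro s' a ⟨hf, b8, b10, -, b12, -, bo⟩
    exact ⟨hf, b8, b10, b12, bo⟩

/-- The moments needed for all labels of all vertices lie at consecutive addresses starting from A +
1, so the address register is only ever incremented. -/
theorem fillProg_sim {s : State} {A : ℕ} (hf : Frame n k w M s) (h8 : s.nat 8 = A) :
    fillProg.Sim s (iter (fillStep (fun v a => M (A + 1 + v * k + a)) k) n s.out)
      (n * (9 * k + 7) + 3) fun s' o => s'.out = o := by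
  refine Sim.mono (Sim.instr_seq rfl <| Sim.instr_seq rfl <|
    Sim.loop (N := 9 * k + 6) (n := n) (a := s.out) (fun v s' o => Frame n k w M s' ∧
      s'.nat 8 = A + 1 + v * k ∧ s'.nat 10 = v ∧ s'.out = o) ?_ ?_ ?_) (by ring) ?_
  · simpa [State.setNat] using hf.n0
  · obtain ⟨a0, a1, a3, a5, a13, ai, am⟩ := hf
    refine ⟨⟨?_, ?_, ?_, ?_, ?_, ?_, ?_⟩, ?_⟩ <;>
      simp [State.setNat, a0, a1, a3, a13, a5, ai, am, h8]
  · rintro v - s1 o ⟨hf, b8, b10, bo⟩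
    rw [fillStep, ← PMF.bind_pure_comp]
    refine Sim.mono (Sim.seq (labelProg_sim hf b8) (M := 2) (h := fun a =>
      PMF.pure (Function.update o v a)) ?_) (by ring) fun _ _ h => h
    rintro s2 a ⟨⟨a0, a1, a3, a5, a13, ai, am⟩, c8, c10, c12, co⟩
    refine Sim.instr_seq rfl <| Sim.instr rfl ?_
    refine ⟨⟨?_, ?_, ?_, ?_, ?_, ?_, ?_⟩, ?_⟩ <;>
      simp [State.setNat, a0, a1, a3, a13, a5, ai, am, c8, c10, c12, co, b10, bo, add_mul,
        add_assoc]
  · rintro s' o ⟨-, -, -, h⟩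
    exact h

/-- The law of the program: reservoir sampling of a vertex, then of all labels. -/
theorem condRoundProg_sim {s : State} (h0 : s.nat 0 = n) (h1 : s.nat 1 = k) (h2 : s.nat 2 = z)
    (hw : s.input 0 = w) (hM : s.input 1 = M) (ho : s.out = fun _ => 0) :
    condRoundProg.Sim s ((reservoir (rowSum w n) n).bind fun u =>
      iter (fillStep (fun v a => M ((1 + z + u * k) * (n * k + 1) + 1 + v * k + a)) k) n
        fun _ => 0)
      ((2 * n + 2 * k + 2 * z + 11) + ((n * (4 * n + 9) + 1) + (n * (9 * k + 7) + 3)))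
      fun s' o => s'.out = o := by
  refine Sim.det_seq (setupProg_sim h0 h1 h2 hw hM ho) ?_
  rintro s1 ⟨hf, h6, h7, h8, hr, ho⟩
  refine Sim.seq (vertexProg_sim hf h6 h7 h8 hr ho) ?_
  rintro s2 u ⟨hf, h8, ho⟩
  have := fillProg_sim hf h8
  rwa [ho] at this

end Program

/-! ### Reading the input tables -/

section Decoding

variable {V S : Type*} [Fintype V] [Fintype S] {n k : ℕ}

theorem finProdFinEquiv_symm_mk {i j : ℕ} (hi : i < n) (hj : j < k) (h : i * k + j < n * k) :
    finProdFinEquiv.symm (⟨i * k + j, h⟩ : Fin (n * k)) = (⟨i, hi⟩, ⟨j, hj⟩) := by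
  rw [Equiv.symm_apply_eq]
  ext
  simp [finProdFinEquiv]
  ring

theorem mul_add_lt_mul {i j : ℕ} (hi : i < n) (hj : j < k) : i * k + j < n * k := by
  calc i * k + j < i * k + k := by omega
    _ = (i + 1) * k := by ring
    _ ≤ n * k := Nat.mul_le_mul_right k hi

theorem weightTable_apply (G : WeightedGraph V) (eV : V ≃ Fin n) (u v : V) :
    weightTable G eV ((eV u : ℕ) * n + eV v) = G.w u v := by
  have h := mul_add_lt_mul (eV u).2 (eV v).2
  rw [weightTable, dif_pos h, finProdFinEquiv_symm_mk (eV u).2 (eV v).2]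
  simp

theorem sum_range_eq_sum_equiv (eV : V ≃ Fin n) (f : ℕ → ℝ) :
    ∑ i ∈ Finset.range n, f i = ∑ v, f (eV v) := by
  rw [Finset.sum_range]
  exact (Fintype.sum_equiv eV _ _ fun v => rfl).symm

theorem rowSum_weightTable (G : WeightedGraph V) (eV : V ≃ Fin n) (u : V) :
    rowSum (weightTable G eV) n (eV u) = G.deg u := by
  rw [rowSum, sum_range_eq_sum_equiv eV]
  simp only [weightTable_apply]
  rfl

theorem sum_rowSum_weightTable (G : WeightedGraph V) (eV : V ≃ Fin n) :
    ∑ i ∈ Finset.range n, rowSum (weightTable G eV) n i = G.totalWeight := by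
  rw [sum_range_eq_sum_equiv eV]
  simp only [rowSum_weightTable]
  rfl

theorem digitPoly_apply (eV : V ≃ Fin n) (eS : S ≃ Fin k) (u : V) (a : S) :
    digitPoly eV eS (1 + ((eV u : ℕ) * k + eS a)) = X (u, a) := by
  have h := mul_add_lt_mul (eV u).2 (eS a).2
  have h' : 1 + ((eV u : ℕ) * k + eS a) - 1 = (eV u : ℕ) * k + eS a := by omega
  rw [digitPoly, dif_pos ⟨by omega, by omega⟩]
  simp only [h', finProdFinEquiv_symm_mk (eV u).2 (eS a).2]
  simp

/-- In base n k + 1 the address has two nonzero digits: the low one names X(v,a), the high one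
X(u,b). -/
theorem momentTable_apply (eV : V ≃ Fin n) (eS : S ≃ Fin k) {d : ℕ} (hd : 2 ≤ d)
    (E : MvPolynomial (V × S) ℝ →ₗ[ℝ] ℝ) (u v : V) (a b : S) :
    momentTable eV eS d E
      ((1 + (eS b : ℕ) + (eV u : ℕ) * k) * (n * k + 1) + 1 + (eV v : ℕ) * k + eS a) =
      E (X (v, a) * X (u, b)) := by
  have h1 := mul_add_lt_mul (eV v).2 (eS a).2
  have h2 := mul_add_lt_mul (eV u).2 (eS b).2
  have hm : (1 + (eS b : ℕ) + (eV u : ℕ) * k) * (n * k + 1) + 1 + (eV v : ℕ) * k + eS a =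
      (1 + ((eV v : ℕ) * k + eS a)) + (n * k + 1) * (1 + ((eV u : ℕ) * k + eS b)) := by ring
  have hlt : (1 + ((eV v : ℕ) * k + eS a)) + (n * k + 1) * (1 + ((eV u : ℕ) * k + eS b)) <
      (n * k + 1) ^ d := by
    calc _ < (n * k + 1) + (n * k + 1) * (n * k) := by
          refine add_lt_add_of_lt_of_le (by omega) (Nat.mul_le_mul_left _ (by omega))
      _ = (n * k + 1) ^ 2 := by ring
      _ ≤ (n * k + 1) ^ d := Nat.pow_le_pow_right (by omega) hd
  rw [hm, momentTable, if_pos hlt, Nat.digits_add _ (by omega) _ _ (by omega) (by omega),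
    Nat.digits_of_lt _ _ (by omega) (by omega)]
  simp only [List.map_cons, List.map_nil, List.prod_cons, List.prod_nil, mul_one, digitPoly_apply]

end Decoding

/-! ### Output law and running time of the program -/

section Law

variable {V S : Type*} [Fintype V] [DecidableEq V] [Fintype S] [DecidableEq S] [AddCommGroup S]
  {n k d : ℕ} {E : MvPolynomial (V × S) ℝ →ₗ[ℝ] ℝ} {G : WeightedGraph V}

theorem map_apply_eq_decide {α γ : Type*} [DecidableEq γ] (μ : PMF α) (f : α → γ) (c : γ) :
    μ.map f c = (μ.map fun x => decide (f x = c)) true := by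
  rw [PMF.map_apply, PMF.map_apply]
  refine tsum_congr fun x => ?_
  by_cases h : f x = c
  · simp [h]
  · simp [h, Ne.symm h]

/-- The moments E X(v,a)X(u,0) sum over a to E X(u,0), so the normalization built into reservoir
sampling is exactly the conditioning on X_u = 0. -/
theorem reservoir_momentTable (hP : IsPseudoexpectation d E) (hE : SatisfiesUG d E)
    (hS : ShiftSymmetric d E) (hd : 4 ≤ d) (eV : V ≃ Fin n) (eS : S ≃ Fin k) (u v : V) (a : S) :
    reservoir (fun a => momentTable eV eS d E
      ((1 + (eS 0 : ℕ) + (eV u : ℕ) * k) * (n * k + 1) + 1 + (eV v : ℕ) * k + a)) k (eS a) =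
      ENNReal.ofReal (condMarginal E u v a) := by
  have hM := fun a => momentTable_apply eV eS (by omega : 2 ≤ d) E u v a 0
  have hsum : ∑ j ∈ Finset.range k, momentTable eV eS d E
      ((1 + (eS 0 : ℕ) + (eV u : ℕ) * k) * (n * k + 1) + 1 + (eV v : ℕ) * k + j) =
      E (X (u, 0)) := by
    rw [sum_range_eq_sum_equiv eS]
    simp only [hM, hE.sum_map_pair (by omega : 2 ≤ d)]
  rw [reservoir_apply, if_pos (eS a).2, hsum, hM]
  · rfl
  · intro i hi
    have := hM (eS.symm ⟨i, hi⟩)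
    rw [Equiv.apply_symm_apply] at this
    rw [this]
    exact map_pair_nonneg hP hE hd u v _ 0
  · rw [hsum]
    exact map_X_zero_pos hP hE hS (by omega) u

theorem reservoir_weightTable [Nonempty V] (eV : V ≃ Fin n) (u : V) :
    reservoir (rowSum (weightTable G eV) n) n (eV u) = ENNReal.ofReal (G.stat u) := by
  rw [reservoir_apply, if_pos (eV u).2, sum_rowSum_weightTable, rowSum_weightTable]
  · rfl
  · intro i hi
    have := rowSum_weightTable G eV (eV.symm ⟨i, hi⟩)
    rw [Equiv.apply_symm_apply] at this
    rw [this]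
    exact (G.deg_pos _).le
  · rw [sum_rowSum_weightTable]
    exact G.totalWeight_pos

theorem reservoir_weightTable_of_le [Nonempty V] (eV : V ≃ Fin n) {i : ℕ} (hi : n ≤ i) :
    reservoir (rowSum (weightTable G eV) n) n i = 0 := by
  rw [reservoir_apply, if_neg (by omega)]
  · intro i hi
    have := rowSum_weightTable G eV (eV.symm ⟨i, hi⟩)
    rw [Equiv.apply_symm_apply] at this
    rw [this]
    exact (G.deg_pos _).le
  · rw [sum_rowSum_weightTable]
    exact G.totalWeight_pos

theorem outputProb_condRoundProg [Nonempty V] (hP : IsPseudoexpectation d E)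
    (hE : SatisfiesUG d E) (hS : ShiftSymmetric d E) (hd : 4 ≤ d) (eV : V ≃ Fin n)
    (eS : S ≃ Fin k) (y : V → S) :
    outputProb eV eS condRoundProg (initState G eV eS d E) y = condRoundProb G E y := by
  have hsim := condRoundProg_sim (s := initState G eV eS d E) (n := n) (k := k) (z := (eS 0 : ℕ))
    (w := weightTable G eV) (M := momentTable eV eS d E) rfl rfl rfl rfl rfl rfl
  have hmap := Couples.map_eq (f := fun x : State × ℕ => fun v : V => x.1.out (eV v))
    (g := fun o : ℕ → ℕ => fun v : V => o (eV v))
    (Couples.mono hsim fun x o h => by simp only [h.2])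
  rw [outputProb, hmap, map_apply_eq_decide]
  let t : ℕ → ℕ := fun i => if h : i < n then eS (y (eV.symm ⟨i, h⟩)) else 0
  have ht : ∀ v, t (eV v) = eS (y v) := fun v => by simp [t]
  have hev : (fun o : ℕ → ℕ => decide ((fun v : V => o (eV v)) = fun v => (eS (y v) : ℕ))) =
      fun o => decide (∀ i < n, o i = t i) := by
    funext o
    rw [Bool.eq_iff_iff, decide_eq_true_eq, decide_eq_true_eq]
    constructor
    · intro h i hi
      have := congrFun h (eV.symm ⟨i, hi⟩)
      simp only [Equiv.apply_symm_apply] at this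
      rw [this]
      simp [t, hi]
    · intro h
      funext v
      rw [h _ (eV v).2, ht]
  rw [hev, PMF.map_bind, PMF.bind_apply]
  simp only [iter_fillStep]
  rw [tsum_eq_sum (s := Finset.range n) fun i hi => by
    rw [reservoir_weightTable_of_le eV (by simpa using hi), zero_mul]]
  rw [Finset.sum_range, ← Fintype.sum_equiv eV (fun u => ENNReal.ofReal (G.stat u *
    ∏ v, condMarginal E u v (y v))) _ fun u => ?_]
  · rw [ENNReal.toReal_sum fun _ _ => ENNReal.ofReal_ne_top]
    refine Finset.sum_congr rfl fun u _ => ENNReal.toReal_ofReal ?_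
    exact mul_nonneg (G.stat_nonneg u)
      (Finset.prod_nonneg fun v _ => condMarginal_nonneg hP hE hS hd u v (y v))
  · rw [reservoir_weightTable, ENNReal.ofReal_mul (G.stat_nonneg u),
      ENNReal.ofReal_prod_of_nonneg fun v _ => condMarginal_nonneg hP hE hS hd u v (y v),
      Finset.prod_range]
    congr 1
    refine Fintype.prod_equiv eV _ _ fun v => ?_
    rw [ht, reservoir_momentTable hP hE hS hd]

theorem steps_condRoundProg_le (G : WeightedGraph V) (E : MvPolynomial (V × S) ℝ →ₗ[ℝ] ℝ)
    (d : ℕ) (eV : V ≃ Fin n) (eS : S ≃ Fin k) (hn : 0 < n) (hk : 0 < k) {x : State × ℕ}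
    (hx : x ∈ (condRoundProg.run (initState G eV eS d E)).support) :
    x.2 ≤ 4 * (n * k) ^ 2 + 31 * (n * k) + 15 := by
  have hsim := condRoundProg_sim (s := initState G eV eS d E) (n := n) (k := k) (z := (eS 0 : ℕ))
    (w := weightTable G eV) (M := momentTable eV eS d E) rfl rfl rfl rfl rfl rfl
  obtain ⟨o, hN, -⟩ := Couples.exists_of_mem_support hsim hx
  have h1 : n ≤ n * k := Nat.le_mul_of_pos_right n hk
  have h2 : k ≤ n * k := Nat.le_mul_of_pos_left k hn
  have h3 : (eS 0 : ℕ) < k := (eS 0).2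
  have h4 : n * n ≤ (n * k) ^ 2 := by rw [sq]; exact Nat.mul_le_mul h1 h1
  rw [hN]
  ring_nf at h4 ⊢
  nlinarith

end Law

/-- The numerical constants: the general bound suffices since `ε < lam ^ 2 / 100`. -/
theorem bound_of_le_expected {lam C ε R : ℝ} (hlam : 0 < lam) (hlam2 : lam < 2) (hC : 0 < C)
    (hε : 0 < ε) (hεlam : ε < lam ^ 2 / 100) (h : 1 - 8 * ε - 16 * ε / lam ≤ C * R) :
    ε * lam ^ 4 / (64 * C) ≤ R := by
  -- Both error terms are at most 8/25, so C·R ≥ 9/25, whereas ε λ⁴/64 ≤ 1/100.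
  have h1 : ε / lam ≤ lam / 100 := by
    rw [div_le_iff₀ hlam]; nlinarith
  have h2 : 16 * ε / lam = 16 * (ε / lam) := by ring
  have h3 : lam ^ 2 ≤ 4 := by nlinarith
  have h4 : lam ^ 4 ≤ 16 := (pow_le_pow_left₀ hlam.le hlam2.le 4).trans_eq (by norm_num)
  have h5 : ε ≤ 1 / 25 := by linarith
  have h6 : ε * lam ^ 4 ≤ 1 / 25 * 16 :=
    mul_le_mul h5 h4 (by positivity) (by norm_num)
  rw [div_le_iff₀ (by positivity)]
  rw [h2] at h
  nlinarith

end UG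

end

theorem theorem4p2 :
    ∃ (prog : UG.Prog) (P : Polynomial ℕ) (K : ℝ) (c : ℕ),
      ∀ (V S : Type*) [Fintype V] [DecidableEq V] [Fintype S] [DecidableEq S] [AddCommGroup S]
        (G : UG.WeightedGraph V) (I : UG.Instance G S)
        (lam C ε : ℝ) (D d : ℕ) (E : MvPolynomial (V × S) ℝ →ₗ[ℝ] ℝ)
        (n k : ℕ) (eV : V ≃ Fin n) (eS : S ≃ Fin k),
        0 < lam → lam < 2 → 0 < C → 2 ≤ D →
        UG.CertHypercontractive G lam C D →
        I.IsAffine →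
        0 < ε → ε < lam ^ 2 / 100 →
        (D : ℝ) + K * (C / (ε * lam ^ 4)) * Real.log (C / (ε * lam ^ 4) + 2) ^ c ≤ d →
        UG.IsPseudoexpectation d E →
        UG.SatisfiesUG d E →
        UG.ShiftSymmetric d E →
        1 - ε ≤ E I.valuePoly →
        -- every run takes at most `P (|V| * |S|)` steps
        (∀ x ∈ (prog.run (UG.initState G eV eS d E)).support, x.2 ≤ P.eval (n * k)) ∧
        -- the output follows the law of Condition & Round, which is a probability distribution
        (∀ y, UG.outputProb eV eS prog (UG.initState G eV eS d E) y = UG.condRoundProb G E y) ∧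
        (∀ y, 0 ≤ UG.condRoundProb G E y) ∧
        (∑ y, UG.condRoundProb G E y = 1) ∧
        -- the expected value of the output
        ε * lam ^ 4 / (64 * C) ≤ ∑ y, UG.condRoundProb G E y * I.value y := by
  -- The analysis squares functions of degree 12 in each sample, hence needs d ≥ 24. Since t ≥ 1,
  -- because C ≥ 1 and ε λ⁴ ≤ 16/25, the constants K = 24 and c = 0 guarantee this.
  refine ⟨UG.condRoundProg, 4 * Polynomial.X ^ 2 + 31 * Polynomial.X + 15, 24, 0, ?_⟩
  intro V S _ _ _ _ _ G I lam C ε D d E n k eV eS hlam hlam2 hC hD hG hI hε hεlam hd hP hE hS hval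
  have hε1 : ε < 1 / 25 := by nlinarith
  -- Without vertices the value polynomial is 0, against the lower bound 1 - ε > 0.
  have hV : Nonempty V := by
    by_contra hV
    rw [not_nonempty_iff] at hV
    have : I.valuePoly = 0 := by simp [UG.Instance.valuePoly]
    rw [this, map_zero] at hval
    linarith
  have hn : 0 < n := Fin.pos (eV hV.some)
  have hk : 0 < k := Fin.pos (eS 0)
  have hC1 : 1 ≤ C := hG.one_le hlam
  have hd24 : 24 ≤ d := by
    have h1 : lam ^ 4 ≤ 16 := (pow_le_pow_left₀ hlam.le hlam2.le 4).trans_eq (by norm_num)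
    have h2 : ε * lam ^ 4 ≤ 1 / 25 * 16 := mul_le_mul hε1.le h1 (by positivity) (by norm_num)
    have h3 : 1 ≤ C / (ε * lam ^ 4) := by
      rw [le_div_iff₀ (by positivity)]; linarith
    rw [pow_zero, mul_one] at hd
    have h4 : (0 : ℝ) ≤ D := Nat.cast_nonneg D
    have h5 : (24 : ℝ) ≤ d := by linarith
    exact_mod_cast h5
  refine ⟨fun x hx => ?_, UG.outputProb_condRoundProg hP hE hS (by omega) eV eS,
    UG.condRoundProb_nonneg hP hE hS (by omega), UG.sum_condRoundProb hP hE hS (by omega),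
    UG.bound_of_le_expected hlam hlam2 hC hε hεlam
      (I.le_expected_value hI hlam hG hP hE hS hd24 hval)⟩
  have := UG.steps_condRoundProg_le G E d eV eS hn hk hx
  simpa using this
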